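/- **Setting.** Let $\Omega$ be a finite set with a distinguished element $0\in\Omega$, and let $\ell\ge 1$, $0\le i\le \ell-1$, $\delta>0$, $\epsilon_{pe}\in(0,1)$. An *instance* consists of an energy function $E:\Omega\to[0,\infty)$; inverse temperatures $0=\beta_0\le\beta_1\le\dots\le\beta_\ell$ such that, with $Z_j=\sum_{\sigma}e^{-\beta_jE(\sigma)}$, the ratios $\alpha_j=Z_{j+1}/Z_j$ satisfy $\alpha_j\ge\frac12$ for $0\le j\le\ell-1$; for each $1\le j\le \ell-1$ an ergodic Markov chain $P_j$ on $\Omega$ that is reversible with respect to the Boltzmann distribution $\pi_j(\sigma)=e^{-\beta_jE(\sigma)}/Z_j$ and whose spectral gap $1-\max\{|\mu|:\mu\neq1\text{ an eigenvalue of }P_j\}$ is at least $\delta$ (the gap is $1$ if $|\Omega|=1$); and for each such $j$ a unitary $U_j$ on $\mathbb C^\Omega\otimes\mathbb C^\Omega$ with $U_j|x\rangle|0\rangle=\sum_y\sqrt{P_j(x,y)}\,|x\rangle|y\rangle$ for all $x\in\Omega$. The quantum walk is $W(P_j)=R_{\mathcal B_j}R_{\mathcal A}$, where $R_{\mathcal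 A},R_{\mathcal B_j}$ are the reflections about $\mathcal A=\mathrm{span}\{|x\rangle|0\rangle:x\in\Omega\}$ and $\mathcal B_j=U_j^\dagger SU_j\mathcal A$, with $S$ the swap of the two registers. Let $V_i=\sum_\sigma|\sigma\rangle\langle\sigma|\otimes\begin{pmatrix}\sqrt{y_i(\sigma)}&\sqrt{1-y_i(\sigma)}\\-\sqrt{1-y_i(\sigma)}&\sqrt{y_i(\sigma)}\end{pmatrix}$ with $y_i(\sigma)=e^{-(\beta_{i+1}-\beta_i)E(\sigma)}$. A *scheme* is a quantum circuit on two registers with basis $\Omega$, a qubit and a finite ancilla register, started in a fixed computational basis state. Its gates are controlled walks $W(P_j)$ with $1\le j\le\ell-1$, the rotation $V_i$, and unitaries that do not depend on the instance; at the end the circuit is measured in the computational basis and a fixed function of the outcome is output as the estimate $Q_i''$. **Lemma.** There is a universal constant $C>0$ such that for all $\Omega$, $0\in\Omega$, $\ell$, $i$, $\delta$, $\epsilon_{pe}$ as above there is a scheme that does not depend on the instance, such that for every instance its estimate satisfies $$\Pr\big[(1-\epsilon_{pe})\alpha_i\le Q_i''\le(1+\epsilon_{pe})\alpha_i\big]\ge\tfrac34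 ,$$ and that uses at most $$C\left(\frac{\ell}{\sqrt\delta}\log^2\ell+\frac1{\epsilon_{pe}\sqrt\delta}\log\frac1{\epsilon_{pe}}\right)$$ controlled walk operators from $\{W(P_1),\dots,W(P_{\ell-1})\}$ and at most $C/\epsilon_{pe}$ rotations $V_i$. -/

import Mathlib

noncomputable section

namespace QPartition

/-! ### Gibbs distributions along a cooling schedule, and the Markov chains -/

/-- The Gibbs partition function at inverse temperature `b`. -/
def partitionFn {Ω : Type*} [Fintype Ω] (E : Ω → ℝ) (b : ℝ) : ℝ :=
  ∑ s, Real.exp (-b * E s)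

/-- The Boltzmann distribution at inverse temperature `b`. -/
def boltzmann {Ω : Type*} [Fintype Ω] (E : Ω → ℝ) (b : ℝ) (s : Ω) : ℝ :=
  Real.exp (-b * E s) / partitionFn E b

/-- The absolute spectral gap of a reversible ergodic chain: one minus the largest modulus of an
eigenvalue other than `1` (all eigenvalues are real; the gap is `1` on a one-point space). -/
def spectralGap {Ω : Type*} [Fintype Ω] [DecidableEq Ω] (P : Matrix Ω Ω ℝ) : ℝ :=
  1 - sSup {r : ℝ | ∃ μ : ℝ, Module.End.HasEigenvalue (Matrix.toLin' P) μ ∧ μ ≠ 1 ∧ r = |μ|}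

/-! ### Quantum walks -/

/-- The Hilbert space of two registers with basis `Ω`. -/
abbrev TwoReg (Ω : Type*) [Fintype Ω] : Type _ := EuclideanSpace ℂ (Ω × Ω)

/-- `U` is a quantum update for `P` with reference state `z`: a unitary with
`U |x⟩|z⟩ = |x⟩|p_x⟩`, where `|p_x⟩ = ∑ y, √(P x y) |y⟩`. -/
def IsQuantumUpdate {Ω : Type*} [Fintype Ω] [DecidableEq Ω] (z : Ω) (P : Matrix Ω Ω ℝ)
    (U : TwoReg Ω ≃ₗᵢ[ℂ] TwoReg Ω) : Prop :=
  ∀ x : Ω, U (EuclideanSpace.single (x, z) 1) =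
    WithLp.toLp 2 (fun q : Ω × Ω => if q.1 = x then ((Real.sqrt (P x q.2) : ℝ) : ℂ) else 0)

/-- The swap of the two registers. -/
def swapReg (Ω : Type*) [Fintype Ω] : TwoReg Ω ≃ₗᵢ[ℂ] TwoReg Ω :=
  LinearIsometryEquiv.piLpCongrLeft 2 ℂ ℂ (Equiv.prodComm Ω Ω)

/-- The space `𝒜`, spanned by the vectors `|x⟩|z⟩`. -/
def spaceA {Ω : Type*} [Fintype Ω] [DecidableEq Ω] (z : Ω) : Submodule ℂ (TwoReg Ω) :=
  Submodule.span ℂ (Set.range fun x : Ω => EuclideanSpace.single (x, z) (1 : ℂ))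

/-- The space `ℬ = U† S U 𝒜`. -/
def spaceB {Ω : Type*} [Fintype Ω] [DecidableEq Ω] (z : Ω)
    (U : TwoReg Ω ≃ₗᵢ[ℂ] TwoReg Ω) : Submodule ℂ (TwoReg Ω) :=
  (spaceA z).map ((U.trans ((swapReg Ω).trans U.symm)).toLinearEquiv : TwoReg Ω →ₗ[ℂ] TwoReg Ω)

/-- The quantum walk `W = R_ℬ R_𝒜` (first reflect about `𝒜`, then about `ℬ`). -/
def walkOp {Ω : Type*} [Fintype Ω] [DecidableEq Ω] (z : Ω)
    (U : TwoReg Ω ≃ₗᵢ[ℂ] TwoReg Ω) : TwoReg Ω ≃ₗᵢ[ℂ] TwoReg Ω :=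
  (spaceA z).reflection.trans (spaceB z U).reflection

/-! ### Problem instances -/

/-- The data of an instance. Only `beta 0, …, beta ℓ` and `chain j`, `update j` for
`1 ≤ j < ℓ` are relevant. -/
structure AnnealingData (Ω : Type*) [Fintype Ω] where
  /-- energy function -/
  energy : Ω → ℝ
  /-- inverse temperatures `β_j = 1 / (k T_j)` -/
  beta : ℕ → ℝ
  /-- transition matrices of the Markov chains `P_j` -/
  chain : ℕ → Matrix Ω Ω ℝ
  /-- quantum updates of the chains -/
  update : ℕ → (TwoReg Ω ≃ₗᵢ[ℂ] TwoReg Ω)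

namespace AnnealingData

variable {Ω : Type*} [Fintype Ω]

/-- The ratio `α_j = Z_{j+1} / Z_j`. -/
def ratio (I : AnnealingData Ω) (j : ℕ) : ℝ :=
  partitionFn I.energy (I.beta (j + 1)) / partitionFn I.energy (I.beta j)

/-- `y_j(s) = exp (-(β_{j+1} - β_j) E(s))`. -/
def yval (I : AnnealingData Ω) (j : ℕ) (s : Ω) : ℝ :=
  Real.exp (-(I.beta (j + 1) - I.beta j) * I.energy s)

/-- The standing assumptions. The energy is nonnegative, so that `0 < y_j ≤ 1`; the initial
temperature is infinite and the temperatures decrease; the ratios are at least `1/2`; the chains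
`P_1, …, P_{ℓ-1}` are ergodic and reversible with respect to the Boltzmann distributions, with
spectral gaps at least `δ`. -/
structure Admissible [DecidableEq Ω] (I : AnnealingData Ω) (z : Ω) (ℓ : ℕ) (δ : ℝ) : Prop where
  energy_nonneg : ∀ s, 0 ≤ I.energy s
  beta_zero : I.beta 0 = 0
  beta_mono : ∀ j < ℓ, I.beta j ≤ I.beta (j + 1)
  ratio_ge : ∀ j < ℓ, 1 / 2 ≤ I.ratio j
  stochastic : ∀ j, 1 ≤ j → j < ℓ → I.chain j ∈ Matrix.rowStochastic ℝ Ω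
  ergodic : ∀ j, 1 ≤ j → j < ℓ → (I.chain j).IsPrimitive
  reversible : ∀ j, 1 ≤ j → j < ℓ → ∀ x y,
    boltzmann I.energy (I.beta j) x * I.chain j x y =
      boltzmann I.energy (I.beta j) y * I.chain j y x
  gap_ge : ∀ j, 1 ≤ j → j < ℓ → δ ≤ spectralGap (I.chain j)
  isUpdate : ∀ j, 1 ≤ j → j < ℓ → IsQuantumUpdate z (I.chain j) (I.update j)

end AnnealingData

/-! ### Quantum circuits with black-box access to the walks and to the rotation `V_i` -/

/-- Computational basis: two `Ω`-registers, one qubit, and an ancilla register. -/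
abbrev Conf (Ω K : Type*) : Type _ := (Ω × Ω) × (Fin 2 × K)

/-- Gates of a circuit: instance-independent unitaries, controlled walks
(for the chains `P_1, …, P_{ℓ-1}` only), and the rotation `V_i`. -/
inductive Gate (Ω : Type*) [Fintype Ω] (K : Type) [Fintype K] (ℓ : ℕ) : Type _ where
  | free (F : EuclideanSpace ℂ (Conf Ω K) ≃ₗᵢ[ℂ] EuclideanSpace ℂ (Conf Ω K))
  | walk (j : ℕ) (one_le : 1 ≤ j) (lt : j < ℓ)
  | rot

/-- The controlled version of an operator `W` on the two `Ω`-registers: it applies `W` if the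
qubit is `1` and does nothing if the qubit is `0`. -/
def controlled {Ω : Type*} [Fintype Ω] {K : Type} [Fintype K]
    (W : TwoReg Ω ≃ₗᵢ[ℂ] TwoReg Ω) (ψ : EuclideanSpace ℂ (Conf Ω K)) :
    EuclideanSpace ℂ (Conf Ω K) :=
  WithLp.toLp 2 fun c : Conf Ω K =>
    if c.2.1 = 1 then W (WithLp.toLp 2 fun q : Ω × Ω => ψ (q, c.2)) c.1 else ψ c

/-- The rotation matrix with first row `√y, √(1-y)` and second row `-√(1-y), √y`. -/
def rotMatrix (y : ℝ) : Matrix (Fin 2) (Fin 2) ℝ :=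
  !![Real.sqrt y, Real.sqrt (1 - y); -Real.sqrt (1 - y), Real.sqrt y]

/-- The unitary `V = ∑ s, |s⟩⟨s| ⊗ rotMatrix (y s)` on the first `Ω`-register and the qubit. -/
def rotation {Ω : Type*} [Fintype Ω] {K : Type} [Fintype K]
    (y : Ω → ℝ) (ψ : EuclideanSpace ℂ (Conf Ω K)) : EuclideanSpace ℂ (Conf Ω K) :=
  WithLp.toLp 2 fun c : Conf Ω K =>
    ∑ b : Fin 2, ((rotMatrix (y c.1.1) c.2.1 b : ℝ) : ℂ) * ψ (c.1, (b, c.2.2))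

namespace Gate

variable {Ω : Type*} [Fintype Ω] {K : Type} [Fintype K] {ℓ : ℕ}

/-- `1` for a controlled walk and `0` for any other gate. -/
def walkCost : Gate Ω K ℓ → ℕ
  | free _ => 0
  | walk _ _ _ => 1
  | rot => 0

/-- `1` for the rotation `V_i` and `0` for any other gate. -/
def rotCost : Gate Ω K ℓ → ℕ
  | free _ => 0
  | walk _ _ _ => 0
  | rot => 1

/-- The action of a gate on the instance `I`, the rotation being `V_i`. -/
def act [DecidableEq Ω] (I : AnnealingData Ω) (z : Ω) (i : ℕ) :
    Gate Ω K ℓ → EuclideanSpace ℂ (Conf Ω K) → EuclideanSpace ℂ (Conf Ω K)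
  | free F, ψ => F ψ
  | walk j _ _, ψ => controlled (walkOp z (I.update j)) ψ
  | rot, ψ => rotation (I.yval i) ψ

end Gate

/-- An estimation scheme: an ancilla register, an initial basis state, a list of gates (applied
from the head of the list on), and a real number attached to every outcome of the final
measurement in the computational basis. -/
structure Scheme (Ω : Type*) [Fintype Ω] (ℓ : ℕ) where
  Anc : Type
  [fintypeAnc : Fintype Anc]
  [decEqAnc : DecidableEq Anc]
  init : Conf Ω Anc
  gates : List (Gate Ω Anc ℓ)
  output : Conf Ω Anc → ℝ

attribute [instance] Scheme.fintypeAnc Scheme.decEqAnc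

namespace Scheme

variable {Ω : Type*} [Fintype Ω] {ℓ : ℕ}

/-- The number of controlled walks in the circuit. -/
def walkCount (A : Scheme Ω ℓ) : ℕ := (A.gates.map Gate.walkCost).sum

/-- The number of rotations `V_i` in the circuit. -/
def rotCount (A : Scheme Ω ℓ) : ℕ := (A.gates.map Gate.rotCost).sum

/-- The state before the final measurement. -/
def finalState [DecidableEq Ω] (A : Scheme Ω ℓ) (I : AnnealingData Ω) (z : Ω) (i : ℕ) :
    EuclideanSpace ℂ (Conf Ω A.Anc) :=
  A.gates.foldl (fun ψ g => g.act I z i ψ) (EuclideanSpace.single A.init 1)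

open Classical in
/-- The probability that the estimate output by the scheme lies in the set `S`. -/
def prob [DecidableEq Ω] (A : Scheme Ω ℓ) (I : AnnealingData Ω) (z : Ω) (i : ℕ)
    (S : Set ℝ) : ℝ :=
  ∑ c ∈ Finset.univ.filter (fun c => A.output c ∈ S), ‖A.finalState I z i c‖ ^ 2

end Scheme

end QPartition

end

/-! Write `s_j` for the coherent Gibbs state with amplitudes `√π_j`, and `ψ` for the rotated state
`V_i (s_i ⊗ |0⟩)`. The bit of `ψ` is `0` with probability `α_i`, so the reflection `F` that negates
bit `0` has expectation `c = 1 - 2 α_i` in `ψ`. Since `α_i ≥ 1/2`, an additive error `ε` in `c` is a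
relative error at most `ε` in `α_i`.

The walks serve only to apply phases along `s_j`. By reversibility, the compression of `U†SU` to `𝒜`
is the discriminant, a matrix similar to `P_j`. Hence `W` fixes `s_j ⊗ |z⟩`, and on the rest of `𝒜`
it satisfies `‖Wx - x‖² ≥ 4δ‖x‖²`. Averaging `T ≈ 2/√δ` powers of `W` halves the norm there, so the
`r`-th power of the average is within `2^(-r)` of the projection onto `s_j`
(`norm_average_pow_walkOp_le`). This power is a convex combination `∑ c_k W^k`. A counter register
in the state `∑ √c_k |k⟩` controls the exponent of `W`; a phase along the counter state, followed by
undoing the walks, yields the phase along `s_j` with error `2 · 2^(-r)` and `2 r (T - 1)` walks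
(`implementable_gibbsPhase`). The state `s_0` is uniform and needs no walk.

Preparation: consecutive Gibbs states have squared overlap at least `1/2`. The π/3 fixed-point
iteration cubes the infidelity at each level, so `3^m = O(log ℓ)` phases per temperature bring `s_0`
close to `s_i`, up to a global phase.

Estimation: let `g` be the Grover iterate, `F` followed by the reflection about `ψ`. Then `gψ + g⁻¹ψ
= 2cψ`, so the vectors `g^k ψ` obey the Chebyshev recursion. For a slowly varying window `a`, the
state `∑ a_k |k⟩ g^k ψ` is nearly an eigenvector, with eigenvalue `c`, of the cosine of the cyclic
shift of the index. Measuring in an eigenbasis of that cosine gives a value with mean square error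
`O(1/n²)` about `c` (`sum_estimate_le`), and Chebyshev's inequality finishes with `n = O(1/ε)`,
without repetition.

For `ℓ ≥ 2` there are `O(ℓ log ℓ + 1/ε)` phases in all, each costing `O(log max(ℓ, 1/ε) / √δ)`
walks; the mixed terms of the product are absorbed by the two pure ones (`log_max_mul_le`). For `ℓ =
1` no walk gate exists. -/

noncomputable section

namespace QPartition

set_option linter.unusedSectionVars false

open scoped ComplexConjugate

/-! ### Phase shifts and fixed-point amplitude amplification -/

section Hilbert

variable {X H : Type*} [NormedAddCommGroup X] [InnerProductSpace ℂ X] [FiniteDimensional ℂ X]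
  [NormedAddCommGroup H] [InnerProductSpace ℂ H] [FiniteDimensional ℂ H]

/-- Two isometric embeddings of the same space differ by a unitary. -/
theorem exists_unitary_comp_eq (f g : X →ₗᵢ[ℂ] H) :
    ∃ F : H ≃ₗᵢ[ℂ] H, ∀ x, F (f x) = g x := by
  let e : X ≃ₗᵢ[ℂ] LinearMap.range f.toLinearMap := f.equivRange
  let k : LinearMap.range f.toLinearMap →ₗᵢ[ℂ] H := g.comp e.symm.toLinearIsometry
  refine ⟨k.extend.toLinearIsometryEquiv rfl, fun x => ?_⟩
  have h := k.extend_apply (e x)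
  have h2 : ((e x : LinearMap.range f.toLinearMap) : H) = f x := rfl
  rw [h2] at h
  rw [LinearIsometry.coe_toLinearIsometryEquiv, h]
  simp [k]

/-- Multiplication by the phase `ω` on the line spanned by `s`, identity on its complement. -/
def phaseShift (s : X) (ω : Circle) : X ≃ₗᵢ[ℂ] X :=
  LinearIsometry.toLinearIsometryEquiv
    { toLinearMap := LinearMap.id + ((ω : ℂ) - 1) • ((ℂ ∙ s).starProjection : X →ₗ[ℂ] X)
      norm_map' := fun x => by
        set p := (ℂ ∙ s).starProjection x with hp
        have horth : inner ℂ p (x - p) = 0 := by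
          rw [← Submodule.mem_orthogonal_singleton_iff_inner_right]
          have hx : x - p ∈ (ℂ ∙ s)ᗮ := Submodule.sub_starProjection_mem_orthogonal x
          have hps : p ∈ (ℂ ∙ s) := Submodule.starProjection_apply_mem _ x
          rw [Submodule.mem_orthogonal_singleton_iff_inner_right]
          exact (Submodule.mem_orthogonal _ _).1 hx p hps
        have h1 : ‖p + (x - p)‖ ^ 2 = ‖p‖ ^ 2 + ‖x - p‖ ^ 2 := by
          have := norm_add_sq_eq_norm_sq_add_norm_sq_of_inner_eq_zero p (x - p) horth
          nlinarith
        have h2 : ‖(ω : ℂ) • p + (x - p)‖ ^ 2 = ‖p‖ ^ 2 + ‖x - p‖ ^ 2 := by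
          have := norm_add_sq_eq_norm_sq_add_norm_sq_of_inner_eq_zero ((ω : ℂ) • p) (x - p)
            (by rw [inner_smul_left, horth, mul_zero])
          rw [norm_smul, Circle.norm_coe, one_mul] at this
          nlinarith
        have h3 : ((LinearMap.id : X →ₗ[ℂ] X) + ((ω : ℂ) - 1) • ((ℂ ∙ s).starProjection : X →ₗ[ℂ] X)) x
            = (ω : ℂ) • p + (x - p) := by
          simp only [LinearMap.add_apply, LinearMap.id_apply, LinearMap.smul_apply,
            ContinuousLinearMap.coe_coe, ← hp]
          module
        rw [h3, ← sq_eq_sq₀ (norm_nonneg _) (norm_nonneg _), h2, ← h1]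
        congr 2
        abel } rfl

theorem phaseShift_apply {s : X} (hs : ‖s‖ = 1) (ω : Circle) (x : X) :
    phaseShift s ω x = x + (((ω : ℂ) - 1) * inner ℂ s x) • s := by
  have h : phaseShift s ω x = x + ((ω : ℂ) - 1) • (ℂ ∙ s).starProjection x := rfl
  rw [h, Submodule.starProjection_unit_singleton ℂ hs, smul_smul]

/-- The fixed-point iterate `U R_s U⁻¹ R_t U`. -/
def fixedPointStep (s t : X) (U : X ≃ₗᵢ[ℂ] X) : X ≃ₗᵢ[ℂ] X :=
  U.trans ((phaseShift t (Circle.exp (Real.pi / 3))).trans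
    (U.symm.trans ((phaseShift s (Circle.exp (Real.pi / 3))).trans U)))

theorem conj_phaseShift_apply {s : X} (hs : ‖s‖ = 1) (ω : Circle) (U : X ≃ₗᵢ[ℂ] X) (x : X) :
    U (phaseShift s ω (U.symm x)) = x + (((ω : ℂ) - 1) * inner ℂ (U s) x) • U s := by
  rw [phaseShift_apply hs, map_add, map_smul, LinearIsometryEquiv.apply_symm_apply]
  congr 3
  rw [← U.inner_map_map, LinearIsometryEquiv.apply_symm_apply]

theorem exp_pi_div_three_sq :
    ((Circle.exp (Real.pi / 3) : Circle) : ℂ) ^ 2 = (Circle.exp (Real.pi / 3) : Circle) - 1 := by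
  rw [Circle.coe_exp, Complex.exp_mul_I, ← Complex.ofReal_cos, ← Complex.ofReal_sin,
    Real.cos_pi_div_three, Real.sin_pi_div_three]
  have h : ((Real.sqrt 3 : ℝ) : ℂ) ^ 2 = 3 := by
    rw [← Complex.ofReal_pow, Real.sq_sqrt (by norm_num)]; norm_num
  push_cast
  linear_combination (1 / 4 : ℂ) * Complex.I ^ 2 * h + (3 / 4 : ℂ) * Complex.I_sq

/-- With `a = ⟨t, U s⟩` and `p = ‖a‖²`, the relation `ω² = ω - 1` for `ω = e^{iπ/3}` makes the new
overlap `a (ω (1 - p) + ω²)`. The second factor has squared modulus `1 + (1 - p) + (1 - p)²`, and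
multiplying by `p` gives `1 - (1 - p)³`. -/
theorem one_sub_norm_inner_fixedPointStep {s t : X} (hs : ‖s‖ = 1) (ht : ‖t‖ = 1)
    (U : X ≃ₗᵢ[ℂ] X) :
    1 - ‖inner ℂ t (fixedPointStep s t U s)‖ ^ 2 = (1 - ‖inner ℂ t (U s)‖ ^ 2) ^ 3 := by
  set ω : ℂ := ((Circle.exp (Real.pi / 3) : Circle) : ℂ) with hω
  have hω2 : ω ^ 2 = ω - 1 := exp_pi_div_three_sq
  set a := inner ℂ t (U s) with ha
  have hconj : inner ℂ (U s) t = conj a := by rw [ha, inner_conj_symm]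
  have hss : inner ℂ (U s) (U s) = 1 := by
    rw [inner_self_eq_norm_sq_to_K, U.norm_map, hs]; simp
  have htt : inner ℂ t t = 1 := by rw [inner_self_eq_norm_sq_to_K, ht]; simp
  have hp : a * conj a = ((‖a‖ ^ 2 : ℝ) : ℂ) := by
    rw [Complex.mul_conj, Complex.normSq_eq_norm_sq]
  have key : inner ℂ t (fixedPointStep s t U s)
      = a * (ω * (1 - ((‖a‖ ^ 2 : ℝ) : ℂ)) + ω ^ 2) := by
    have : fixedPointStep s t U s = U (phaseShift s (Circle.exp (Real.pi / 3))
        (U.symm (phaseShift t (Circle.exp (Real.pi / 3)) (U s)))) := rfl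
    rw [this, conj_phaseShift_apply hs, phaseShift_apply ht, ← hω]
    simp only [inner_add_right, inner_smul_right, hss, htt, ← ha, hconj, ← hp]
    linear_combination -(a * (1 - conj a * a)) * hω2
  rw [key, norm_mul, mul_pow]
  set p := ‖a‖ ^ 2 with hpdef
  have h1 : ‖ω * (1 - (p : ℂ)) + ω ^ 2‖ ^ 2 = (1 - p) ^ 2 + (1 - p) + 1 := by
    have h2 : ω * (1 - (p : ℂ)) + ω ^ 2 = ω * (((1 - p : ℝ) : ℂ) + ω) := by push_cast; ring
    rw [h2, norm_mul, hω, Circle.norm_coe, one_mul, Circle.coe_exp, Complex.exp_mul_I,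
      ← Complex.ofReal_cos, ← Complex.ofReal_sin, Real.cos_pi_div_three, Real.sin_pi_div_three,
      ← Complex.normSq_eq_norm_sq]
    have h3 : ((1 - p : ℝ) : ℂ) + (((1 / 2 : ℝ) : ℂ) + ((Real.sqrt 3 / 2 : ℝ) : ℂ) * Complex.I)
        = ((1 - p + 1 / 2 : ℝ) : ℂ) + ((Real.sqrt 3 / 2 : ℝ) : ℂ) * Complex.I := by
      push_cast; ring
    rw [h3, Complex.normSq_add_mul_I, div_pow, Real.sq_sqrt (by norm_num)]
    ring
  rw [h1]
  ring

/-- The `m`-fold fixed-point iterate. -/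
def fixedPoint (s t : X) : ℕ → (X ≃ₗᵢ[ℂ] X)
  | 0 => LinearIsometryEquiv.refl ℂ X
  | m + 1 => fixedPointStep s t (fixedPoint s t m)

theorem one_sub_norm_inner_fixedPoint {s t : X} (hs : ‖s‖ = 1) (ht : ‖t‖ = 1) (m : ℕ) :
    1 - ‖inner ℂ t (fixedPoint s t m s)‖ ^ 2 = (1 - ‖inner ℂ t s‖ ^ 2) ^ 3 ^ m := by
  induction m with
  | zero => simp [fixedPoint]
  | succ m ih =>
    rw [fixedPoint, one_sub_norm_inner_fixedPointStep hs ht, ih, ← pow_mul, ← pow_succ]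

/-- A unit vector with large overlap is close to a multiple of the target. -/
theorem exists_phase_norm_sub_sq_le {x t : X} (hx : ‖x‖ = 1) (ht : ‖t‖ = 1) {η : ℝ}
    (h : 1 - ‖inner ℂ t x‖ ^ 2 ≤ η) :
    ∃ c : Circle, ‖x - (c : ℂ) • t‖ ^ 2 ≤ 2 * η := by
  set a := inner ℂ t x with ha
  obtain ⟨c, hc⟩ : ∃ c : Circle, (conj (c : ℂ)) * a = ‖a‖ := by
    refine ⟨Circle.exp (Complex.arg a), ?_⟩
    have h1 := Complex.norm_mul_exp_arg_mul_I a
    rw [Circle.coe_exp]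
    set E := Complex.exp (Complex.arg a * Complex.I) with hE
    have h2 : conj E * E = 1 := by
      rw [← Complex.normSq_eq_conj_mul_self, Complex.normSq_eq_norm_sq, hE,
        Complex.norm_exp_ofReal_mul_I]
      simp
    linear_combination (-conj E) * h1 + (‖a‖ : ℂ) * h2
  refine ⟨c, ?_⟩
  have h1 : RCLike.re (inner ℂ x ((c : ℂ) • t)) = ‖a‖ := by
    rw [← inner_conj_symm, inner_smul_left, ← ha, hc]
    simp
  have h2 := norm_sub_sq (𝕜 := ℂ) x ((c : ℂ) • t)
  rw [h1, norm_smul, Circle.norm_coe, hx, ht] at h2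
  -- With the phase aligned, the squared distance is `2 - 2‖a‖`, which is at most `2 (1 - ‖a‖²)`
  -- because `‖a‖ ≤ 1`.
  have h3 : ‖a‖ ≤ 1 := by
    calc ‖a‖ ≤ ‖t‖ * ‖x‖ := norm_inner_le_norm t x
      _ = 1 := by rw [hx, ht, one_mul]
  have h4 := norm_nonneg a
  rw [h2]
  nlinarith

end Hilbert

/-! ### Block-diagonal and diagonal unitaries -/

section Blocks

variable {C I J : Type*} [Fintype C] [Fintype I] [Fintype J]

/-- The `i`-th block of a vector. -/
def slice (e : C ≃ I × J) (i : I) (ψ : EuclideanSpace ℂ C) : EuclideanSpace ℂ J :=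
  WithLp.toLp 2 fun j => ψ (e.symm (i, j))

@[simp] theorem slice_apply (e : C ≃ I × J) (i : I) (ψ : EuclideanSpace ℂ C) (j : J) :
    slice e i ψ j = ψ (e.symm (i, j)) := rfl

theorem slice_add (e : C ≃ I × J) (i : I) (ψ φ : EuclideanSpace ℂ C) :
    slice e i (ψ + φ) = slice e i ψ + slice e i φ := rfl

theorem slice_smul (e : C ≃ I × J) (i : I) (c : ℂ) (ψ : EuclideanSpace ℂ C) :
    slice e i (c • ψ) = c • slice e i ψ := rfl

theorem ext_slice (e : C ≃ I × J) {ψ φ : EuclideanSpace ℂ C}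
    (h : ∀ i, slice e i ψ = slice e i φ) : ψ = φ := by
  ext c
  have := congrArg (fun v : EuclideanSpace ℂ J => v (e c).2) (h (e c).1)
  simpa using this

theorem norm_sq_eq_sum_slice (e : C ≃ I × J) (ψ : EuclideanSpace ℂ C) :
    ‖ψ‖ ^ 2 = ∑ i, ‖slice e i ψ‖ ^ 2 := by
  simp only [EuclideanSpace.norm_sq_eq, slice_apply]
  rw [← Fintype.sum_prod_type' (f := fun i j => ‖ψ (e.symm (i, j))‖ ^ 2)]
  exact (Equiv.sum_comp e.symm (fun c => ‖ψ c‖ ^ 2)).symm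

/-- The block-diagonal unitary with blocks `U i`. -/
def blockIso (e : C ≃ I × J) (U : I → (EuclideanSpace ℂ J ≃ₗᵢ[ℂ] EuclideanSpace ℂ J)) :
    EuclideanSpace ℂ C ≃ₗᵢ[ℂ] EuclideanSpace ℂ C where
  toFun ψ := WithLp.toLp 2 fun c => U (e c).1 (slice e (e c).1 ψ) (e c).2
  invFun ψ := WithLp.toLp 2 fun c => (U (e c).1).symm (slice e (e c).1 ψ) (e c).2
  map_add' ψ φ := by ext c; simp [slice_add]
  map_smul' r ψ := by ext c; simp [slice_smul]
  left_inv ψ := by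
    refine ext_slice e fun i => ?_
    ext j
    have : slice e i (WithLp.toLp 2 fun c => U (e c).1 (slice e (e c).1 ψ) (e c).2)
        = U i (slice e i ψ) := by ext j; simp
    simp [this]
  right_inv ψ := by
    refine ext_slice e fun i => ?_
    ext j
    have : slice e i (WithLp.toLp 2 fun c => (U (e c).1).symm (slice e (e c).1 ψ) (e c).2)
        = (U i).symm (slice e i ψ) := by ext j; simp
    simp [this]
  norm_map' ψ := by
    rw [← sq_eq_sq₀ (norm_nonneg _) (norm_nonneg _), norm_sq_eq_sum_slice e,
      norm_sq_eq_sum_slice e ψ]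
    refine Finset.sum_congr rfl fun i _ => ?_
    rw [← (U i).norm_map (slice e i ψ)]
    congr 2
    ext j
    simp

theorem blockIso_apply (e : C ≃ I × J) (U : I → (EuclideanSpace ℂ J ≃ₗᵢ[ℂ] EuclideanSpace ℂ J))
    (ψ : EuclideanSpace ℂ C) (c : C) :
    blockIso e U ψ c = U (e c).1 (slice e (e c).1 ψ) (e c).2 := rfl

theorem slice_blockIso (e : C ≃ I × J) (U : I → (EuclideanSpace ℂ J ≃ₗᵢ[ℂ] EuclideanSpace ℂ J))
    (ψ : EuclideanSpace ℂ C) (i : I) : slice e i (blockIso e U ψ) = U i (slice e i ψ) := by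
  ext j
  simp [blockIso_apply]

/-- The diagonal unitary with phases `φ`. -/
def diagIso (φ : C → Circle) : EuclideanSpace ℂ C ≃ₗᵢ[ℂ] EuclideanSpace ℂ C :=
  LinearIsometry.toLinearIsometryEquiv
    { toFun := fun ψ => WithLp.toLp 2 fun c => (φ c : ℂ) * ψ c
      map_add' := fun ψ χ => by ext c; simp [mul_add]
      map_smul' := fun r ψ => by ext c; simp [mul_left_comm]
      norm_map' := fun ψ => by
        rw [← sq_eq_sq₀ (norm_nonneg _) (norm_nonneg _)]
        simp [EuclideanSpace.norm_sq_eq, Circle.norm_coe] } rfl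

@[simp] theorem diagIso_apply (φ : C → Circle) (ψ : EuclideanSpace ℂ C) (c : C) :
    diagIso φ ψ c = (φ c : ℂ) * ψ c := rfl

end Blocks

end QPartition

end

noncomputable section

namespace QPartition

set_option linter.unusedSectionVars false

open scoped ComplexConjugate

/-! ### Averages of powers of a unitary with a phase gap -/

section Averaging

variable {E : Type*} [NormedAddCommGroup E] [InnerProductSpace ℂ E] [FiniteDimensional ℂ E]

/-- A unitary as an element of the endomorphism algebra. -/
def toEnd (W : E ≃ₗᵢ[ℂ] E) : Module.End ℂ E := W.toLinearEquiv.toLinearMap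

@[simp] theorem toEnd_apply (W : E ≃ₗᵢ[ℂ] E) (x : E) : toEnd W x = W x := rfl

theorem toEnd_mul_symm (W : E ≃ₗᵢ[ℂ] E) : toEnd W * toEnd W.symm = 1 := by
  ext x; simp

theorem toEnd_symm_mul (W : E ≃ₗᵢ[ℂ] E) : toEnd W.symm * toEnd W = 1 := by
  ext x; simp

theorem norm_toEnd_pow (W : E ≃ₗᵢ[ℂ] E) (k : ℕ) (x : E) : ‖(toEnd W ^ k) x‖ = ‖x‖ := by
  induction k with
  | zero => simp
  | succ k ih => rw [pow_succ', Module.End.mul_apply, toEnd_apply, W.norm_map, ih]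

theorem toEnd_pow_apply_of_fixed {W : E ≃ₗᵢ[ℂ] E} {x : E} (h : W x = x) (k : ℕ) :
    (toEnd W ^ k) x = x := by
  induction k with
  | zero => simp
  | succ k ih => rw [pow_succ', Module.End.mul_apply, toEnd_apply, ih, h]

/-- The average of the first `T` powers of `W`. -/
def average (W : E ≃ₗᵢ[ℂ] E) (T : ℕ) : Module.End ℂ E :=
  (T : ℂ)⁻¹ • ∑ k ∈ Finset.range T, toEnd W ^ k

theorem inner_toEnd_pow (W : E ≃ₗᵢ[ℂ] E) (k : ℕ) (x y : E) :
    inner ℂ ((toEnd W ^ k) x) y = inner ℂ x ((toEnd W.symm ^ k) y) := by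
  induction k generalizing x y with
  | zero => simp
  | succ k ih =>
    rw [pow_succ', Module.End.mul_apply, toEnd_apply, ← W.symm.inner_map_map,
      LinearIsometryEquiv.symm_apply_apply, ih, pow_succ, Module.End.mul_apply, toEnd_apply]

theorem inner_average (W : E ≃ₗᵢ[ℂ] E) (T : ℕ) (x y : E) :
    inner ℂ (average W T x) y = inner ℂ x (average W.symm T y) := by
  simp [average, inner_toEnd_pow, mul_comm]

theorem commute_average (W : E ≃ₗᵢ[ℂ] E) (T : ℕ) : Commute (average W T) (average W.symm T) := by
  have h : Commute (toEnd W) (toEnd W.symm) := by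
    rw [commute_iff_eq, toEnd_mul_symm, toEnd_symm_mul]
  unfold average
  refine Commute.smul_left (Commute.smul_right ?_ _) _
  exact Commute.sum_left _ _ _ fun k _ => Commute.sum_right _ _ _ fun l _ => h.pow_pow k l

theorem norm_sub_sq_eq_inner (W : E ≃ₗᵢ[ℂ] E) (x : E) :
    ‖W x - x‖ ^ 2 = RCLike.re (inner ℂ x ((2 : ℂ) • x - (W x + W.symm x))) := by
  have h2 : inner ℂ x (W.symm x) = inner ℂ (W x) x := by
    rw [← W.inner_map_map, LinearIsometryEquiv.apply_symm_apply]
  rw [norm_sub_sq (𝕜 := ℂ), W.norm_map, inner_sub_right, inner_add_right, h2, inner_smul_right,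
    inner_self_eq_norm_sq_to_K]
  have h3 : RCLike.re (inner ℂ x (W x)) = RCLike.re (inner ℂ (W x) x) := inner_re_symm x (W x)
  simp only [map_sub, map_add, h3]
  have h4 : RCLike.re ((2 : ℂ) * ((‖x‖ : ℂ)) ^ 2) = 2 * ‖x‖ ^ 2 := by
    rw [← Complex.ofReal_pow]; simp [-Complex.ofReal_pow]
  have h5 := h4
  simp only [Complex.coe_algebraMap] at h5 ⊢
  rw [h5]
  ring

section

variable (W : E ≃ₗᵢ[ℂ] E) (S : Submodule ℂ E)

/-- Chebyshev recursion: `W^(n+2) + W^-(n+2)` equals `(W^(n+1) + W^-(n+1)) (W + W⁻¹)` minus `W^n +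
W^-n`. -/
theorem toEnd_pow_add_mem (hS : ∀ v ∈ S, W v + W.symm v ∈ S) (n : ℕ) :
    ∀ v ∈ S, (toEnd W ^ n) v + (toEnd W.symm ^ n) v ∈ S := by
  induction n using Nat.twoStepInduction with
  | zero => intro v hv; simpa using S.add_mem hv hv
  | one => intro v hv; simpa using hS v hv
  | more n ih1 ih2 =>
    intro v hv
    have h1 := ih2 _ (hS v hv)
    have h2 := ih1 v hv
    have h3 := S.sub_mem h1 h2
    convert h3 using 1
    have ha : ∀ x, W (W.symm x) = x := W.apply_symm_apply
    have hb : ∀ x, W.symm (W x) = x := W.symm_apply_apply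
    simp only [pow_succ, Module.End.mul_apply, toEnd_apply, map_add, ha, hb]
    abel

/-- The average itself need not preserve `S`, but its product with its adjoint is symmetric in `W`
and `W⁻¹`: the double sum pairs up into terms `W^n + W^-n`, which preserve `S`. -/
theorem average_symm_average_mem (hS : ∀ v ∈ S, W v + W.symm v ∈ S) (T : ℕ) {v : E} (hv : v ∈ S) :
    average W.symm T (average W T v) ∈ S := by
  have hpair : ∀ j k : ℕ, (toEnd W.symm ^ j * toEnd W ^ k + toEnd W.symm ^ k * toEnd W ^ j) v ∈ S := by
    have hle : ∀ j k : ℕ, j ≤ k →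
        (toEnd W.symm ^ j * toEnd W ^ k + toEnd W.symm ^ k * toEnd W ^ j) v ∈ S := by
      intro j k hjk
      have hcan : toEnd W.symm ^ j * toEnd W ^ j = 1 := by
        rw [← Commute.mul_pow, toEnd_symm_mul, one_pow]
        rw [commute_iff_eq, toEnd_mul_symm, toEnd_symm_mul]
      obtain ⟨n, rfl⟩ := Nat.exists_eq_add_of_le hjk
      have := toEnd_pow_add_mem W S hS n v hv
      have h1 : toEnd W.symm ^ j * toEnd W ^ (j + n) = toEnd W ^ n := by
        rw [pow_add, ← mul_assoc, hcan, one_mul]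
      have h2 : toEnd W.symm ^ (j + n) * toEnd W ^ j = toEnd W.symm ^ n := by
        rw [add_comm, pow_add, mul_assoc, hcan, mul_one]
      rw [h1, h2]
      simpa using this
    intro j k
    rcases le_total j k with h | h
    · exact hle j k h
    · rw [add_comm]; exact hle k j h
  have hsum : average W.symm T (average W T v) = (2⁻¹ * ((T : ℂ)⁻¹ * (T : ℂ)⁻¹)) •
      ∑ j ∈ Finset.range T, ∑ k ∈ Finset.range T,
        (toEnd W.symm ^ j * toEnd W ^ k + toEnd W.symm ^ k * toEnd W ^ j) v := by
    have h1 : average W.symm T (average W T v) = ((T : ℂ)⁻¹ * (T : ℂ)⁻¹) •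
      ∑ j ∈ Finset.range T, ∑ k ∈ Finset.range T, (toEnd W.symm ^ j * toEnd W ^ k) v := by
      simp only [average, LinearMap.smul_apply, map_smul, LinearMap.sum_apply, map_sum,
        Module.End.mul_apply]
      rw [← Finset.smul_sum, smul_smul, Finset.sum_comm]
    rw [h1]
    simp only [LinearMap.add_apply, Finset.sum_add_distrib]
    rw [Finset.sum_comm (f := fun j k => (toEnd W.symm ^ k * toEnd W ^ j) v), ← two_smul ℂ,
      smul_smul]
    congr 1
    ring
  rw [hsum]
  exact S.smul_mem _ (S.sum_mem fun j _ => S.sum_mem fun k _ => hpair j k)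

/-- The operator `2 - W - W⁻¹` is invertible on `S`, so every `v` in `S` has the form `y - W y`. The
sum of powers then telescopes to `y - W^T y`, and the gap gives `‖y‖ ≤ ‖v‖ / (2√δ)`. -/
theorem norm_average_le {δ : ℝ} (hδ : 0 < δ) (hS : ∀ v ∈ S, W v + W.symm v ∈ S)
    (hgap : ∀ v ∈ S, 4 * δ * ‖v‖ ^ 2 ≤ ‖W v - v‖ ^ 2) {T : ℕ} (hT : 2 ≤ T * Real.sqrt δ)
    {v : E} (hv : v ∈ S) : ‖average W T v‖ ≤ 1 / 2 * ‖v‖ := by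
  have hTpos : (0 : ℝ) < T := by
    by_contra h
    have : (T : ℝ) = 0 := le_antisymm (not_lt.1 h) (Nat.cast_nonneg _)
    rw [this] at hT; linarith
  -- The quadratic form of this operator at `x` is `‖W x - x‖²`, so the gap makes it injective on
  -- `S`, hence surjective in finite dimension.
  let Lap : S →ₗ[ℂ] S := LinearMap.restrict
    ((2 : ℂ) • (1 : Module.End ℂ E) - (toEnd W + toEnd W.symm))
    (fun x hx => by
      have := S.sub_mem (S.smul_mem (2 : ℂ) hx) (hS x hx)
      simpa using this)
  have hLap : ∀ x : S, (Lap x : E) = (2 : ℂ) • (x : E) - (W x + W.symm x) := fun x => by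
    simp [Lap, LinearMap.restrict_apply]
  have hinj : Function.Injective Lap := by
    rw [← LinearMap.ker_eq_bot, LinearMap.ker_eq_bot']
    intro x hx
    have h1 := hgap x x.2
    have h2 := norm_sub_sq_eq_inner W (x : E)
    rw [← hLap, hx] at h2
    simp only [ZeroMemClass.coe_zero, inner_zero_right, map_zero] at h2
    have h3 : ‖(x : E)‖ ^ 2 ≤ 0 := by
      by_contra h
      have : 0 < 4 * δ * ‖(x : E)‖ ^ 2 := by nlinarith [not_le.1 h]
      linarith
    have h4 : ‖(x : E)‖ = 0 := by
      have := sq_nonneg ‖(x : E)‖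
      exact pow_eq_zero_iff (two_ne_zero) |>.1 (le_antisymm h3 this)
    exact Subtype.ext (norm_eq_zero.1 h4)
  obtain ⟨w, hw⟩ := (LinearMap.injective_iff_surjective.1 hinj) ⟨v, hv⟩
  have hvw : v = (2 : ℂ) • (w : E) - (W w + W.symm w) := by rw [← hLap, hw]
  obtain ⟨y, hy⟩ : ∃ y : E, y = w - W.symm w := ⟨_, rfl⟩
  have hvy : v = y - W y := by
    rw [hvw, hy, map_sub, LinearIsometryEquiv.apply_symm_apply]
    module
  have htel : ∀ n : ℕ, (∑ k ∈ Finset.range n, toEnd W ^ k) v = y - (toEnd W ^ n) y := by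
    intro n
    induction n with
    | zero => simp
    | succ n ih =>
      rw [Finset.sum_range_succ, LinearMap.add_apply, ih, hvy, map_sub, pow_succ,
        Module.End.mul_apply, toEnd_apply]
      abel
  have hKv : ‖average W T v‖ ≤ (T : ℝ)⁻¹ * (2 * ‖y‖) := by
    rw [average, LinearMap.smul_apply, htel, norm_smul, norm_inv, Complex.norm_natCast]
    refine mul_le_mul_of_nonneg_left ?_ (by positivity)
    calc ‖y - (toEnd W ^ T) y‖ ≤ ‖y‖ + ‖(toEnd W ^ T) y‖ := norm_sub_le _ _
      _ = 2 * ‖y‖ := by rw [norm_toEnd_pow]; ring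
  have hynorm : ‖y‖ = ‖W w - w‖ := by
    rw [← W.norm_map y, hy, map_sub, LinearIsometryEquiv.apply_symm_apply]
  have h1 : ‖y‖ ^ 2 ≤ ‖(w : E)‖ * ‖v‖ := by
    rw [hynorm, norm_sub_sq_eq_inner, ← hvw]
    exact (RCLike.re_le_norm _).trans (norm_inner_le_norm _ _)
  have h2 : 4 * δ * ‖(w : E)‖ ^ 2 ≤ ‖y‖ ^ 2 := by rw [hynorm]; exact hgap w w.2
  have h3 : 4 * δ * ‖(w : E)‖ ≤ ‖v‖ := by
    rcases (norm_nonneg (w : E)).eq_or_lt with h | h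
    · rw [← h]; simp
    · have : (4 * δ * ‖(w : E)‖) * ‖(w : E)‖ ≤ ‖v‖ * ‖(w : E)‖ := by nlinarith
      exact le_of_mul_le_mul_right this h
  have h4 : (2 * Real.sqrt δ * ‖y‖) ^ 2 ≤ ‖v‖ ^ 2 := by
    rw [mul_pow, mul_pow, Real.sq_sqrt hδ.le]
    nlinarith [norm_nonneg v]
  have h5 : 2 * Real.sqrt δ * ‖y‖ ≤ ‖v‖ := by
    exact (sq_le_sq₀ (by positivity) (norm_nonneg _)).1 h4
  refine hKv.trans ?_
  rw [inv_mul_le_iff₀ hTpos]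
  have h6 : 2 * ‖y‖ * 2 ≤ (2 * ‖y‖) * (T * Real.sqrt δ) :=
    mul_le_mul_of_nonneg_left hT (by positivity)
  nlinarith

/-- If `W + W⁻¹` preserves `S` and `W` has a phase gap there, then averaging contracts `S`. -/
theorem norm_average_pow_le {δ : ℝ} (hδ : 0 < δ) (hS : ∀ v ∈ S, W v + W.symm v ∈ S)
    (hgap : ∀ v ∈ S, 4 * δ * ‖v‖ ^ 2 ≤ ‖W v - v‖ ^ 2) {T : ℕ} (hT : 2 ≤ T * Real.sqrt δ)
    (r : ℕ) {v : E} (hv : v ∈ S) : ‖(average W T ^ r) v‖ ≤ (1 / 2) ^ r * ‖v‖ := by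
  -- Since `average W T` may leave `S`, its bound cannot be iterated directly. It is normal, so
  -- `‖average^r v‖² = ⟨v, Q^r v⟩`, and `Q` both preserves `S` and contracts it by `1/4`.
  set Q : Module.End ℂ E := average W.symm T * average W T with hQ
  have hQmem : ∀ x ∈ S, Q x ∈ S := fun x hx => average_symm_average_mem W S hS T hx
  have hQnorm : ∀ x ∈ S, ‖Q x‖ ≤ 1 / 4 * ‖x‖ := by
    intro x hx
    have h1 : inner ℂ (Q x) (Q x) = inner ℂ (average W T (Q x)) (average W T x) := by
      rw [inner_average]; rfl
    have h2 : ‖Q x‖ ^ 2 ≤ (1 / 2 * ‖Q x‖) * (1 / 2 * ‖x‖) := by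
      have h3 : ‖Q x‖ ^ 2 = ‖inner ℂ (Q x) (Q x)‖ := by
        rw [inner_self_eq_norm_sq_to_K]; simp
      rw [h3, h1]
      refine (norm_inner_le_norm _ _).trans ?_
      exact mul_le_mul (norm_average_le W S hδ hS hgap hT (hQmem x hx))
        (norm_average_le W S hδ hS hgap hT hx) (norm_nonneg _) (by positivity)
    rcases (norm_nonneg (Q x)).eq_or_lt with h | h
    · rw [← h]; positivity
    · have : ‖Q x‖ * ‖Q x‖ ≤ (1 / 4 * ‖x‖) * ‖Q x‖ := by nlinarith
      exact le_of_mul_le_mul_right this h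
  have hQpow : ∀ n : ℕ, ∀ x ∈ S, (Q ^ n) x ∈ S ∧ ‖(Q ^ n) x‖ ≤ (1 / 4) ^ n * ‖x‖ := by
    intro n
    induction n with
    | zero => intro x hx; simpa using hx
    | succ n ih =>
      intro x hx
      obtain ⟨h1, h2⟩ := ih x hx
      rw [pow_succ', Module.End.mul_apply]
      refine ⟨hQmem _ h1, (hQnorm _ h1).trans ?_⟩
      rw [pow_succ']
      nlinarith
  have hinner : ∀ n : ℕ, ∀ x y : E, inner ℂ ((average W T ^ n) x) y
      = inner ℂ x ((average W.symm T ^ n) y) := by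
    intro n
    induction n with
    | zero => simp
    | succ n ih =>
      intro x y
      rw [pow_succ', Module.End.mul_apply, inner_average, ih, pow_succ, Module.End.mul_apply]
  have h1 : inner ℂ ((average W T ^ r) v) ((average W T ^ r) v) = inner ℂ v ((Q ^ r) v) := by
    rw [hinner, hQ, (commute_average W T).symm.mul_pow]
    rfl
  have h2 : ‖(average W T ^ r) v‖ ^ 2 ≤ ((1 / 2) ^ r * ‖v‖) ^ 2 := by
    have h3 : ‖(average W T ^ r) v‖ ^ 2
        = ‖inner ℂ ((average W T ^ r) v) ((average W T ^ r) v)‖ := by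
      rw [inner_self_eq_norm_sq_to_K]; simp
    rw [h3, h1]
    refine (norm_inner_le_norm _ _).trans ?_
    refine (mul_le_mul_of_nonneg_left (hQpow r v hv).2 (norm_nonneg v)).trans (le_of_eq ?_)
    rw [mul_pow, ← pow_mul, mul_comm r 2, pow_mul]
    norm_num
    ring
  exact (sq_le_sq₀ (norm_nonneg _) (by positivity)).1 h2

end

end Averaging

end QPartition

end

noncomputable section

namespace QPartition

set_option linter.unusedSectionVars false

/-! ### Discriminant of a reversible chain -/

section Discriminant

variable {Ω : Type*} [Fintype Ω] [DecidableEq Ω]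

theorem abs_le_of_le_spectralGap {P : Matrix Ω Ω ℝ} {δ : ℝ} (h : δ ≤ spectralGap P) {μ : ℝ}
    (hμ : Module.End.HasEigenvalue (Matrix.toLin' P) μ) (h1 : μ ≠ 1) : |μ| ≤ 1 - δ := by
  -- Finiteness makes the set bounded above; otherwise the real supremum would take its default
  -- value `0` and bound nothing.
  have hfin : {r : ℝ | ∃ μ : ℝ, Module.End.HasEigenvalue (Matrix.toLin' P) μ ∧ μ ≠ 1 ∧
      r = |μ|}.Finite := by
    have h0 : {μ : ℝ | Module.End.HasEigenvalue (Matrix.toLin' P) μ}.Finite :=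
      Module.End.finite_hasEigenvalue _
    refine (h0.image fun μ => |μ|).subset ?_
    rintro r ⟨μ, hμ, -, rfl⟩
    exact ⟨μ, hμ, rfl⟩
  have := le_csSup hfin.bddAbove ⟨μ, hμ, h1, rfl⟩
  unfold spectralGap at h
  linarith

theorem spectralGap_le_one (P : Matrix Ω Ω ℝ) : spectralGap P ≤ 1 := by
  unfold spectralGap
  have : 0 ≤ sSup {r : ℝ | ∃ μ : ℝ, Module.End.HasEigenvalue (Matrix.toLin' P) μ ∧ μ ≠ 1 ∧
      r = |μ|} := by
    refine Real.sSup_nonneg ?_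
    rintro r ⟨μ, -, -, rfl⟩
    exact abs_nonneg μ
  linarith

/-- A harmonic function of a primitive stochastic matrix is constant. -/
theorem eq_of_mulVec_eq_self {P : Matrix Ω Ω ℝ} (hP : P ∈ Matrix.rowStochastic ℝ Ω)
    (hprim : P.IsPrimitive) {g : Ω → ℝ} (hg : P.mulVec g = g) (x y : Ω) : g x = g y := by
  obtain ⟨k, -, hk⟩ := hprim.exists_pos_pow
  have hPk : P ^ k ∈ Matrix.rowStochastic ℝ Ω := pow_mem hP k
  have hgk : ∀ n : ℕ, (P ^ n).mulVec g = g := by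
    intro n
    induction n with
    | zero => simp
    | succ n ih => rw [pow_succ, ← Matrix.mulVec_mulVec, hg, ih]
  obtain ⟨m, -, hm⟩ := Finset.exists_max_image Finset.univ g ⟨x, Finset.mem_univ x⟩
  have key : ∀ w, g w = g m := by
    have h1 : ∑ w, (P ^ k) m w * (g m - g w) = 0 := by
      simp only [mul_sub, Finset.sum_sub_distrib, ← Finset.sum_mul,
        Matrix.sum_row_of_mem_rowStochastic hPk]
      have := congrFun (hgk k) m
      simp only [Matrix.mulVec, dotProduct] at this
      rw [this]; ring
    intro w
    have h2 := (Finset.sum_eq_zero_iff_of_nonneg (fun w _ =>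
      mul_nonneg (hk m w).le (sub_nonneg.2 (hm w (Finset.mem_univ w))))).1 h1 w (Finset.mem_univ w)
    rcases mul_eq_zero.1 h2 with h | h
    · exact absurd h (hk m w).ne'
    · linarith
  rw [key x, key y]

/-- The discriminant of a chain. -/
def discriminant (P : Matrix Ω Ω ℝ) : Matrix Ω Ω ℝ :=
  Matrix.of fun x y => Real.sqrt (P x y) * Real.sqrt (P y x)

theorem discriminant_isHermitian (P : Matrix Ω Ω ℝ) : (discriminant P).IsHermitian := by
  ext x y
  simp [discriminant, mul_comm]

variable {P : Matrix Ω Ω ℝ} {p : Ω → ℝ}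

/-- Detailed balance makes the discriminant the conjugate of `P` by the diagonal matrix `√p`, so the
two have the same eigenvalues. -/
theorem discriminant_apply_of_reversible (hP : P ∈ Matrix.rowStochastic ℝ Ω) (hp : ∀ x, 0 < p x)
    (hrev : ∀ x y, p x * P x y = p y * P y x) (x y : Ω) :
    discriminant P x y = Real.sqrt (p x) * P x y / Real.sqrt (p y) := by
  have h0 : 0 ≤ P x y := Matrix.nonneg_of_mem_rowStochastic hP
  have h1 : P y x = p x * P x y / p y := by
    rw [hrev x y]; field_simp [(hp y).ne']
  rw [discriminant, Matrix.of_apply, h1, Real.sqrt_div (by have := hp x; positivity),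
    Real.sqrt_mul (hp x).le]
  nth_rewrite 3 [← Real.mul_self_sqrt h0]
  ring

/-- Expand `f` in an eigenbasis of the symmetric discriminant. Dividing an eigenvector by `√p` gives
an eigenvector of `P`, so each eigenvalue other than `1` has modulus at most `1 - δ`. -/
theorem sum_sq_discriminant_mulVec_le {δ : ℝ} (hP : P ∈ Matrix.rowStochastic ℝ Ω)
    (hprim : P.IsPrimitive) (hp : ∀ x, 0 < p x) (hrev : ∀ x y, p x * P x y = p y * P y x)
    (hδ : δ ≤ spectralGap P) (f : Ω → ℝ) (hf : ∑ x, Real.sqrt (p x) * f x = 0) :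
    ∑ x, ((discriminant P).mulVec f x) ^ 2 ≤ (1 - δ) ^ 2 * ∑ x, f x ^ 2 := by
  have hD := discriminant_isHermitian P
  set b := hD.eigenvectorBasis with hb
  set μ := hD.eigenvalues with hμ
  have hsq : ∀ x, 0 < Real.sqrt (p x) := fun x => Real.sqrt_pos.2 (hp x)
  let F : EuclideanSpace ℝ Ω := WithLp.toLp 2 f
  let DF : EuclideanSpace ℝ Ω := WithLp.toLp 2 ((discriminant P).mulVec f)
  have hrepr : ∀ i, b.repr DF i = μ i * b.repr F i := by
    intro i
    have h1 := hD.mulVec_eigenvectorBasis i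
    simp only [b.repr_apply_apply, PiLp.inner_apply, DF, F]
    have h2 : ∀ u v : Ω → ℝ, ∑ x, inner ℝ (u x) (v x) = dotProduct v u := fun u v => by
      simp [dotProduct]
    rw [h2, h2, ← Matrix.vecMul_transpose, ← Matrix.dotProduct_mulVec]
    have h3 : (discriminant P).transpose = discriminant P := by
      have := hD.eq; rwa [Matrix.conjTranspose_eq_transpose_of_trivial] at this
    rw [h3, ← hb] at *
    rw [h1, dotProduct_smul]
    rfl
  have heig : ∀ i, (P.mulVec fun x => b i x / Real.sqrt (p x))
      = μ i • fun x => b i x / Real.sqrt (p x) := by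
    intro i
    have h1 := hD.mulVec_eigenvectorBasis i
    ext x
    have h2 := congrFun h1 x
    simp only [Matrix.mulVec, dotProduct, Pi.smul_apply, smul_eq_mul,
      discriminant_apply_of_reversible hP hp hrev] at h2 ⊢
    rw [← hb, ← hμ] at h2
    rw [← mul_div_assoc, ← h2, Finset.sum_div]
    refine Finset.sum_congr rfl fun y _ => ?_
    field_simp [(hsq x).ne', (hsq y).ne']
  have hcoef : ∀ i, (μ i * b.repr F i) ^ 2 ≤ (1 - δ) ^ 2 * (b.repr F i) ^ 2 := by
    intro i
    -- For eigenvalue `1`, the quotient by `√p` is harmonic, hence constant. The basis vector is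
    -- then a multiple of `√p`, to which `f` is orthogonal.
    by_cases h1 : μ i = 1
    · have h2 : b.repr F i = 0 := by
        have h3 := heig i
        rw [h1, one_smul] at h3
        have h4 := eq_of_mulVec_eq_self hP hprim h3
        rw [b.repr_apply_apply, PiLp.inner_apply]
        rcases isEmpty_or_nonempty Ω with he | ⟨⟨x0⟩⟩
        · simp
        have h5 : ∀ x, b i x = (b i x0 / Real.sqrt (p x0)) * Real.sqrt (p x) := fun x => by
          rw [← h4 x x0]; field_simp [(hsq x).ne']
        have h6 : ∑ x, inner ℝ (b i x) (F x)
            = (b i x0 / Real.sqrt (p x0)) * ∑ x, Real.sqrt (p x) * f x := by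
          rw [Finset.mul_sum]
          refine Finset.sum_congr rfl fun x _ => ?_
          conv_lhs => rw [h5 x]
          simp [F]
          ring
        rw [h6, hf, mul_zero]
      rw [h2]; simp
    · have hev : Module.End.HasEigenvalue (Matrix.toLin' P) (μ i) := by
        refine Module.End.hasEigenvalue_of_hasEigenvector
          (x := fun x => b i x / Real.sqrt (p x)) ⟨?_, ?_⟩
        · rw [Module.End.mem_eigenspace_iff, Matrix.toLin'_apply]
          exact heig i
        · intro h0
          have h2 : b i = 0 := by
            ext x
            have := congrFun h0 x
            simpa [(hsq x).ne'] using this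
          have := b.orthonormal.ne_zero i
          exact this h2
      have h3 := abs_le_of_le_spectralGap hδ hev h1
      rw [mul_pow]
      refine mul_le_mul_of_nonneg_right ?_ (sq_nonneg _)
      rw [← sq_abs]
      exact pow_le_pow_left₀ (abs_nonneg _) h3 2
  have hn : ∀ G : EuclideanSpace ℝ Ω, ∑ x, (G x) ^ 2 = ∑ i, (b.repr G i) ^ 2 := by
    intro G
    have h1 : ‖b.repr G‖ ^ 2 = ‖G‖ ^ 2 := by rw [LinearIsometryEquiv.norm_map]
    rw [EuclideanSpace.norm_sq_eq, EuclideanSpace.norm_sq_eq] at h1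
    simpa using h1.symm
  have h1 := hn DF
  have h2 := hn F
  calc ∑ x, ((discriminant P).mulVec f x) ^ 2 = ∑ i, (b.repr DF i) ^ 2 := h1
    _ = ∑ i, (μ i * b.repr F i) ^ 2 := by simp only [hrepr]
    _ ≤ ∑ i, (1 - δ) ^ 2 * (b.repr F i) ^ 2 := Finset.sum_le_sum fun i _ => hcoef i
    _ = (1 - δ) ^ 2 * ∑ x, f x ^ 2 := by rw [← Finset.mul_sum, ← h2]

end Discriminant

end QPartition

end

noncomputable section

namespace QPartition

set_option linter.unusedSectionVars false

open scoped ComplexConjugate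

/-! ### From the discriminant to the phase gap of the walk -/

section AbstractWalk

variable {E : Type*} [NormedAddCommGroup E] [InnerProductSpace ℂ E] [FiniteDimensional ℂ E]

/-- The product of the reflections about `A` and `X A` contracts, on average, the vectors of `A`
orthogonal to a common fixed vector. -/
theorem norm_average_pow_reflection_le (A : Submodule ℂ E) (X : E ≃ₗᵢ[ℂ] E)
    (hX : ∀ x, X (X x) = x) {s : E} (hs : s ∈ A) (hXs : X s = s) {δ : ℝ} (hδ : 0 < δ)
    (hδ1 : δ ≤ 1)
    (hD : ∀ v ∈ A, inner ℂ s v = 0 → ‖A.starProjection (X v)‖ ^ 2 ≤ (1 - δ) ^ 2 * ‖v‖ ^ 2)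
    {T : ℕ} (hT : 2 ≤ T * Real.sqrt δ) (r : ℕ) {v : E} (hv : v ∈ A) (hsv : inner ℂ s v = 0) :
    ‖(average (A.reflection.trans
      (A.map (X.toLinearEquiv : E →ₗ[ℂ] E)).reflection) T ^ r) v‖ ≤ (1 / 2) ^ r * ‖v‖ := by
  set W := A.reflection.trans (A.map (X.toLinearEquiv : E →ₗ[ℂ] E)).reflection with hW
  have hXsymm : ∀ x, X.symm x = X x := fun x => by
    rw [LinearIsometryEquiv.symm_apply_eq, hX]
  have hWa : ∀ x ∈ A, W x = X (A.reflection (X x)) := fun x hx => by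
    rw [hW, LinearIsometryEquiv.trans_apply, Submodule.reflection_map_apply,
      Submodule.reflection_mem_subspace_eq_self hx, hXsymm]
  have hWs : ∀ x ∈ A, W.symm x = A.reflection (X (A.reflection (X x))) := fun x hx => by
    rw [hW, LinearIsometryEquiv.symm_trans, LinearIsometryEquiv.trans_apply,
      Submodule.reflection_symm, Submodule.reflection_symm, Submodule.reflection_map_apply, hXsymm]
  have hsA : A.reflection s = s := Submodule.reflection_mem_subspace_eq_self hs
  refine norm_average_pow_le W (A ⊓ (ℂ ∙ s)ᗮ) hδ ?_ ?_ hT r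
    ⟨hv, Submodule.mem_orthogonal_singleton_iff_inner_right.2 hsv⟩
  · rintro x ⟨hx, hsx⟩
    rw [hWa x hx, hWs x hx]
    -- Here `W x = y` and `W⁻¹ x = R_A y`, so their sum is twice the projection of `y` onto `A`. All
    -- maps involved fix `s`, which keeps it orthogonal to `s`.
    set y := X (A.reflection (X x)) with hy
    have h1 : y + A.reflection y = (2 : ℂ) • A.starProjection y := by
      rw [Submodule.reflection_apply, two_smul, two_smul]; abel
    rw [h1]
    refine Submodule.smul_mem _ _ ⟨Submodule.starProjection_apply_mem _ _, ?_⟩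
    have h2 : inner ℂ s (A.starProjection y) = inner ℂ s y := by
      rw [← Submodule.inner_starProjection_left_eq_right, Submodule.starProjection_eq_self_iff.2 hs]
    have h3 : inner ℂ s y = inner ℂ s x := by
      conv_lhs => rw [← hXs, hy, LinearIsometryEquiv.inner_map_map, ← hsA,
        LinearIsometryEquiv.inner_map_map, ← hXs, LinearIsometryEquiv.inner_map_map]
    rw [SetLike.mem_coe, Submodule.mem_orthogonal_singleton_iff_inner_right, h2, h3]
    exact Submodule.mem_orthogonal_singleton_iff_inner_right.1 hsx
  · rintro x ⟨hx, hsx⟩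
    -- The displacement of `x` is twice the distance of `X x` from `A`. By Pythagoras its square is
    -- at least `4 (1 - (1 - δ)²) ‖x‖²`, and `1 - (1 - δ)² ≥ δ` because `δ ≤ 1`.
    have h1 : ‖W x - x‖ = ‖A.reflection (X x) - X x‖ := by
      rw [hWa x hx, ← X.norm_map (A.reflection (X x) - X x), map_sub, hX]
    have h2 : A.reflection (X x) - X x = (2 : ℂ) • (A.starProjection (X x) - X x) := by
      rw [Submodule.reflection_apply, two_smul, two_smul]; abel
    have h3 := hD x hx (Submodule.mem_orthogonal_singleton_iff_inner_right.1 hsx)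
    have h4 : ‖X x‖ ^ 2 = ‖A.starProjection (X x)‖ ^ 2 + ‖A.starProjection (X x) - X x‖ ^ 2 := by
      have h5 : inner ℂ (A.starProjection (X x)) (X x - A.starProjection (X x)) = 0 :=
        Submodule.inner_right_of_mem_orthogonal (Submodule.starProjection_apply_mem _ _)
          (Submodule.sub_starProjection_mem_orthogonal _)
      have h6 := norm_add_sq_eq_norm_sq_add_norm_sq_of_inner_eq_zero _ _ h5
      rw [add_sub_cancel, norm_sub_rev] at h6
      nlinarith
    rw [h1, h2, norm_smul, mul_pow]
    rw [X.norm_map] at h4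
    have h7 : ‖(2 : ℂ)‖ ^ 2 = 4 := by norm_num
    rw [h7]
    nlinarith [sq_nonneg ‖x‖, mul_nonneg (mul_nonneg hδ.le (sub_nonneg.2 hδ1)) (sq_nonneg ‖x‖)]

end AbstractWalk

/-! ### Concrete walk on two registers -/

section Walk

variable {Ω : Type*} [Fintype Ω] [DecidableEq Ω] (z : Ω)

/-- The embedding `v ↦ v ⊗ |z⟩`. -/
def inA : EuclideanSpace ℂ Ω →ₗᵢ[ℂ] TwoReg Ω where
  toFun v := WithLp.toLp 2 fun q => if q.2 = z then v q.1 else 0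
  map_add' v w := by ext q; by_cases h : q.2 = z <;> simp [h]
  map_smul' c v := by ext q; by_cases h : q.2 = z <;> simp [h]
  norm_map' v := by
    rw [← sq_eq_sq₀ (norm_nonneg _) (norm_nonneg _)]
    simp only [EuclideanSpace.norm_sq_eq, Fintype.sum_prod_type, LinearMap.coe_mk, AddHom.coe_mk]
    refine Finset.sum_congr rfl fun x _ => ?_
    rw [Finset.sum_eq_single z] <;> simp +contextual

@[simp] theorem inA_apply (v : EuclideanSpace ℂ Ω) (q : Ω × Ω) :
    inA z v q = if q.2 = z then v q.1 else 0 := rfl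

theorem inA_eq_sum (v : EuclideanSpace ℂ Ω) :
    inA z v = ∑ x, v x • EuclideanSpace.single (x, z) (1 : ℂ) := by
  ext ⟨x, y⟩
  simp only [inA_apply, WithLp.ofLp_sum, Finset.sum_apply, PiLp.smul_apply,
    PiLp.single_apply, Prod.mk.injEq, smul_eq_mul, mul_ite, mul_one, mul_zero]
  rw [Finset.sum_eq_single x] <;> simp +contextual [eq_comm]

theorem inA_mem (v : EuclideanSpace ℂ Ω) : inA z v ∈ spaceA z := by
  rw [inA_eq_sum]
  exact Submodule.sum_mem _ fun x _ => Submodule.smul_mem _ _ (Submodule.subset_span ⟨x, rfl⟩)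

/-- The component `⟨z|` of the second register. -/
def restrictA (ψ : TwoReg Ω) : EuclideanSpace ℂ Ω := WithLp.toLp 2 fun x => ψ (x, z)

@[simp] theorem restrictA_apply (ψ : TwoReg Ω) (x : Ω) : restrictA z ψ x = ψ (x, z) := rfl

theorem starProjection_spaceA (ψ : TwoReg Ω) :
    (spaceA z).starProjection ψ = inA z (restrictA z ψ) := by
  refine Submodule.eq_starProjection_of_mem_of_inner_eq_zero (inA_mem z _) ?_
  intro w hw
  induction hw using Submodule.span_induction with
  | mem w hw =>
    obtain ⟨x, rfl⟩ := hw
    simp [EuclideanSpace.inner_single_right]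
  | zero => simp
  | add u w _ _ h1 h2 => rw [inner_add_right, h1, h2, add_zero]
  | smul c w _ h => rw [inner_smul_right, h, mul_zero]

theorem reflection_spaceA_apply (ψ : TwoReg Ω) (q : Ω × Ω) :
    (spaceA z).reflection ψ q = if q.2 = z then ψ q else -ψ q := by
  obtain ⟨x, y⟩ := q
  rw [Submodule.reflection_apply, starProjection_spaceA]
  by_cases h : y = z
  · subst h; simp [two_smul]
  · simp [h]

theorem mem_spaceA {ψ : TwoReg Ω} (h : ψ ∈ spaceA z) : ψ = inA z (restrictA z ψ) := by
  rw [← starProjection_spaceA, Submodule.starProjection_eq_self_iff.2 h]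

variable {z} {P : Matrix Ω Ω ℝ} {U : TwoReg Ω ≃ₗᵢ[ℂ] TwoReg Ω}

theorem swapReg_apply (ψ : TwoReg Ω) (q : Ω × Ω) : swapReg Ω ψ q = ψ (q.2, q.1) := rfl

/-- The self-inverse unitary `U† S U`. -/
def updateSwap (U : TwoReg Ω ≃ₗᵢ[ℂ] TwoReg Ω) : TwoReg Ω ≃ₗᵢ[ℂ] TwoReg Ω :=
  U.trans ((swapReg Ω).trans U.symm)

theorem updateSwap_apply (ψ : TwoReg Ω) : updateSwap U ψ = U.symm (swapReg Ω (U ψ)) := rfl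

theorem updateSwap_updateSwap (ψ : TwoReg Ω) : updateSwap U (updateSwap U ψ) = ψ := by
  rw [updateSwap_apply, updateSwap_apply, LinearIsometryEquiv.apply_symm_apply,
    LinearIsometryEquiv.symm_apply_eq]
  ext q
  simp [swapReg_apply]

theorem update_inA (hU : IsQuantumUpdate z P U) (v : EuclideanSpace ℂ Ω) :
    U (inA z v) = WithLp.toLp 2 fun q : Ω × Ω => v q.1 * (Real.sqrt (P q.1 q.2) : ℂ) := by
  rw [inA_eq_sum, map_sum]
  simp only [map_smul, hU _]
  ext ⟨x, y⟩
  simp only [WithLp.ofLp_sum, Finset.sum_apply, PiLp.smul_apply, smul_eq_mul, mul_ite, mul_zero]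
  rw [Finset.sum_eq_single x] <;> simp +contextual [eq_comm]

/-- The entry at `(x, y)` is the overlap of `|x⟩|p_x⟩` with the swapped `|y⟩|p_y⟩`; only one basis
vector is common to both, and it contributes `√(P x y) √(P y x)`. -/
theorem restrictA_updateSwap_inA (hU : IsQuantumUpdate z P U) (v : EuclideanSpace ℂ Ω) (x : Ω) :
    restrictA z (updateSwap U (inA z v)) x = ∑ y, ((discriminant P x y : ℝ) : ℂ) * v y := by
  have h1 : restrictA z (updateSwap U (inA z v)) x
      = inner ℂ (EuclideanSpace.single (x, z) (1 : ℂ)) (updateSwap U (inA z v)) := by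
    simp [EuclideanSpace.inner_single_left]
  rw [h1, updateSwap_apply, ← U.inner_map_map, LinearIsometryEquiv.apply_symm_apply, hU x,
    update_inA hU, PiLp.inner_apply, Fintype.sum_prod_type, Finset.sum_eq_single x]
  · refine Finset.sum_congr rfl fun y _ => ?_
    simp [swapReg_apply, discriminant]
    ring
  · intro y _ hy
    simp [hy]
  · simp

theorem norm_sq_restrictA_updateSwap_le (hU : IsQuantumUpdate z P U) {p : Ω → ℝ} {δ : ℝ}
    (hP : P ∈ Matrix.rowStochastic ℝ Ω) (hprim : P.IsPrimitive) (hp : ∀ x, 0 < p x)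
    (hrev : ∀ x y, p x * P x y = p y * P y x) (hδ : δ ≤ spectralGap P) (v : EuclideanSpace ℂ Ω)
    (hv : ∑ x, (Real.sqrt (p x) : ℂ) * v x = 0) :
    ‖restrictA z (updateSwap U (inA z v))‖ ^ 2 ≤ (1 - δ) ^ 2 * ‖v‖ ^ 2 := by
  -- The discriminant is real, so the real estimate applies to real and imaginary parts separately.
  have hre := congrArg Complex.re hv
  have him := congrArg Complex.im hv
  simp only [Complex.re_sum, Complex.im_sum, Complex.re_ofReal_mul, Complex.im_ofReal_mul,
    Complex.zero_re, Complex.zero_im] at hre him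
  have h1 := sum_sq_discriminant_mulVec_le hP hprim hp hrev hδ (fun x => (v x).re) hre
  have h2 := sum_sq_discriminant_mulVec_le hP hprim hp hrev hδ (fun x => (v x).im) him
  simp only [EuclideanSpace.norm_sq_eq, restrictA_updateSwap_inA hU, ← Complex.normSq_eq_norm_sq,
    Complex.normSq_apply, Complex.re_sum, Complex.im_sum, Complex.re_ofReal_mul,
    Complex.im_ofReal_mul, Finset.sum_add_distrib]
  simp only [Matrix.mulVec, dotProduct, sq] at h1 h2
  simp only [sq]
  linarith

/-- After `U` the amplitudes are `√(p x * P x y)`; detailed balance says that they are symmetric, so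
the swap fixes the state. -/
theorem updateSwap_inA_sqrt (hU : IsQuantumUpdate z P U) {p : Ω → ℝ} (hp : ∀ x, 0 < p x)
    (hrev : ∀ x y, p x * P x y = p y * P y x) :
    updateSwap U (inA z (WithLp.toLp 2 fun x => (Real.sqrt (p x) : ℂ)))
      = inA z (WithLp.toLp 2 fun x => (Real.sqrt (p x) : ℂ)) := by
  rw [updateSwap_apply, LinearIsometryEquiv.symm_apply_eq, update_inA hU]
  ext ⟨x, y⟩
  simp only [swapReg_apply]
  rw [← Complex.ofReal_mul, ← Complex.ofReal_mul, ← Real.sqrt_mul (hp _).le,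
    ← Real.sqrt_mul (hp _).le, hrev]

theorem walkOp_eq (z : Ω) (U : TwoReg Ω ≃ₗᵢ[ℂ] TwoReg Ω) :
    walkOp z U = (spaceA z).reflection.trans
      ((spaceA z).map ((updateSwap U).toLinearEquiv : TwoReg Ω →ₗ[ℂ] TwoReg Ω)).reflection := rfl

theorem walkOp_inA_sqrt (hU : IsQuantumUpdate z P U) {p : Ω → ℝ} (hp : ∀ x, 0 < p x)
    (hrev : ∀ x y, p x * P x y = p y * P y x) :
    walkOp z U (inA z (WithLp.toLp 2 fun x => (Real.sqrt (p x) : ℂ)))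
      = inA z (WithLp.toLp 2 fun x => (Real.sqrt (p x) : ℂ)) := by
  rw [walkOp_eq, LinearIsometryEquiv.trans_apply,
    Submodule.reflection_mem_subspace_eq_self (inA_mem z _)]
  refine Submodule.reflection_mem_subspace_eq_self ?_
  exact ⟨_, inA_mem z _, updateSwap_inA_sqrt hU hp hrev⟩

theorem norm_average_pow_walkOp_le (hU : IsQuantumUpdate z P U) {p : Ω → ℝ} {δ : ℝ}
    (hP : P ∈ Matrix.rowStochastic ℝ Ω) (hprim : P.IsPrimitive) (hp : ∀ x, 0 < p x)
    (hrev : ∀ x y, p x * P x y = p y * P y x) (hδ0 : 0 < δ) (hδ1 : δ ≤ 1)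
    (hδ : δ ≤ spectralGap P) {T : ℕ} (hT : 2 ≤ T * Real.sqrt δ) (r : ℕ) (v : EuclideanSpace ℂ Ω)
    (hv : inner ℂ (WithLp.toLp 2 fun x => (Real.sqrt (p x) : ℂ) : EuclideanSpace ℂ Ω) v = 0) :
    ‖(average (walkOp z U) T ^ r) (inA z v)‖ ≤ (1 / 2) ^ r * ‖v‖ := by
  rw [walkOp_eq, ← (inA z).norm_map v]
  refine norm_average_pow_reflection_le (spaceA z) (updateSwap U) updateSwap_updateSwap
    (inA_mem z _) (updateSwap_inA_sqrt hU hp hrev) hδ0 hδ1 ?_ hT r (inA_mem z v) ?_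
  · intro w hw hsw
    rw [mem_spaceA z hw] at hsw ⊢
    rw [LinearIsometry.inner_map_map] at hsw
    rw [starProjection_spaceA, LinearIsometry.norm_map, LinearIsometry.norm_map]
    refine norm_sq_restrictA_updateSwap_le hU hP hprim hp hrev hδ _ ?_
    rw [PiLp.inner_apply] at hsw
    rw [← hsw]
    refine Finset.sum_congr rfl fun x _ => ?_
    simp [mul_comm]
  · rw [LinearIsometry.inner_map_map, hv]

end Walk

end QPartition

end

noncomputable section

namespace QPartition

set_option linter.unusedSectionVars false

/-! ### Circuits as unitaries, their inverses, and approximate implementation -/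

section Circuits

variable {Ω : Type*} [Fintype Ω] {K : Type} [Fintype K] {ℓ : ℕ}

/-- The rotation `rotMatrix y` as a unitary; it is written with an angle so as to make sense for
all `y`. -/
def rotIso (y : ℝ) : EuclideanSpace ℂ (Fin 2) ≃ₗᵢ[ℂ] EuclideanSpace ℂ (Fin 2) :=
  LinearIsometry.toLinearIsometryEquiv
    { toFun := fun v => WithLp.toLp 2
        ![(Real.cos (Real.arccos (Real.sqrt y)) : ℂ) * v 0
            + (Real.sin (Real.arccos (Real.sqrt y)) : ℂ) * v 1,
          -(Real.sin (Real.arccos (Real.sqrt y)) : ℂ) * v 0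
            + (Real.cos (Real.arccos (Real.sqrt y)) : ℂ) * v 1]
      map_add' := fun v w => by
        ext j; fin_cases j <;> simp <;> ring
      map_smul' := fun r v => by
        ext j; fin_cases j <;> simp <;> ring
      norm_map' := fun v => by
        rw [← sq_eq_sq₀ (norm_nonneg _) (norm_nonneg _)]
        have h := Real.sin_sq_add_cos_sq (Real.arccos (Real.sqrt y))
        set c := Real.cos (Real.arccos (Real.sqrt y))
        set s := Real.sin (Real.arccos (Real.sqrt y))
        simp only [EuclideanSpace.norm_sq_eq, Fin.sum_univ_two, ← Complex.normSq_eq_norm_sq,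
          Complex.normSq_apply, LinearMap.coe_mk, AddHom.coe_mk, Matrix.cons_val_zero,
          Matrix.cons_val_one, Complex.add_re, Complex.add_im, Complex.re_ofReal_mul,
          Complex.im_ofReal_mul, neg_mul, Complex.neg_re, Complex.neg_im]
        linear_combination (((v 0).re ^ 2 + (v 0).im ^ 2) + ((v 1).re ^ 2 + (v 1).im ^ 2)) * h }
    rfl

theorem rotIso_apply {y : ℝ} (h0 : 0 ≤ y) (h1 : y ≤ 1) (v : EuclideanSpace ℂ (Fin 2))
    (a : Fin 2) : rotIso y v a = ∑ b : Fin 2, ((rotMatrix y a b : ℝ) : ℂ) * v b := by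
  have hs : Real.sqrt y ≤ 1 := Real.sqrt_le_one.2 h1
  have hc : Real.cos (Real.arccos (Real.sqrt y)) = Real.sqrt y :=
    Real.cos_arccos (by linarith [Real.sqrt_nonneg y]) hs
  have hsn : Real.sin (Real.arccos (Real.sqrt y)) = Real.sqrt (1 - y) := by
    rw [Real.sin_arccos, Real.sq_sqrt h0]
  have h : rotIso y v = WithLp.toLp 2
        ![(Real.cos (Real.arccos (Real.sqrt y)) : ℂ) * v 0
            + (Real.sin (Real.arccos (Real.sqrt y)) : ℂ) * v 1,
          -(Real.sin (Real.arccos (Real.sqrt y)) : ℂ) * v 0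
            + (Real.cos (Real.arccos (Real.sqrt y)) : ℂ) * v 1] := rfl
  rw [h, hc, hsn]
  fin_cases a <;> simp [rotMatrix]

/-- Separates the qubit from the other registers. -/
def qubitEquiv (Ω K : Type*) : Conf Ω K ≃ ((Ω × Ω) × K) × Fin 2 where
  toFun c := ((c.1, c.2.2), c.2.1)
  invFun d := (d.1.1, (d.2, d.1.2))
  left_inv _ := rfl
  right_inv _ := rfl

variable [DecidableEq Ω]

/-- The action of a gate as a unitary. -/
def gateIso (I : AnnealingData Ω) (z : Ω) (i : ℕ) :
    Gate Ω K ℓ → (EuclideanSpace ℂ (Conf Ω K) ≃ₗᵢ[ℂ] EuclideanSpace ℂ (Conf Ω K))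
  | Gate.free F => F
  | Gate.walk j _ _ => blockIso (Equiv.prodComm (Ω × Ω) (Fin 2 × K)) fun c =>
      if c.1 = 1 then walkOp z (I.update j) else LinearIsometryEquiv.refl ℂ _
  | Gate.rot => blockIso (qubitEquiv Ω K) fun c => rotIso (I.yval i c.1.1)

theorem AnnealingData.Admissible.yval_mem {I : AnnealingData Ω} {z : Ω} {δ : ℝ} {i : ℕ}
    (hI : I.Admissible z ℓ δ) (hi : i < ℓ) (s : Ω) : 0 ≤ I.yval i s ∧ I.yval i s ≤ 1 := by
  refine ⟨(Real.exp_pos _).le, Real.exp_le_one_iff.2 ?_⟩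
  have h1 := hI.energy_nonneg s
  have h2 := hI.beta_mono i hi
  nlinarith

/-- Admissibility is needed only for the rotation: its matrix is unitary because `0 ≤ y ≤ 1`. -/
theorem act_eq_gateIso {I : AnnealingData Ω} {z : Ω} {δ : ℝ} {i : ℕ}
    (hI : I.Admissible z ℓ δ) (hi : i < ℓ) (g : Gate Ω K ℓ) (ψ : EuclideanSpace ℂ (Conf Ω K)) :
    g.act I z i ψ = gateIso I z i g ψ := by
  cases g with
  | free F => rfl
  | walk j h1 h2 =>
    ext c
    simp only [Gate.act, controlled, gateIso, blockIso_apply, Equiv.prodComm_apply, Prod.fst_swap,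
      Prod.snd_swap]
    by_cases h : c.2.1 = 1
    · simp only [h, if_true]; rfl
    · simp only [h, if_false]; rfl
  | rot =>
    ext c
    simp only [Gate.act, rotation, gateIso, blockIso_apply]
    rw [rotIso_apply (hI.yval_mem hi _).1 (hI.yval_mem hi _).2]
    rfl

/-- The action of a circuit as a unitary. -/
def run (I : AnnealingData Ω) (z : Ω) (i : ℕ) :
    List (Gate Ω K ℓ) → (EuclideanSpace ℂ (Conf Ω K) ≃ₗᵢ[ℂ] EuclideanSpace ℂ (Conf Ω K))
  | [] => LinearIsometryEquiv.refl ℂ _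
  | g :: gs => (gateIso I z i g).trans (run I z i gs)

theorem foldl_act_eq_run {I : AnnealingData Ω} {z : Ω} {δ : ℝ} {i : ℕ}
    (hI : I.Admissible z ℓ δ) (hi : i < ℓ) (gs : List (Gate Ω K ℓ))
    (ψ : EuclideanSpace ℂ (Conf Ω K)) :
    gs.foldl (fun ψ g => g.act I z i ψ) ψ = run I z i gs ψ := by
  induction gs generalizing ψ with
  | nil => rfl
  | cons g gs ih => rw [List.foldl_cons, ih, act_eq_gateIso hI hi]; rfl

theorem run_append (I : AnnealingData Ω) (z : Ω) (i : ℕ) (gs hs : List (Gate Ω K ℓ))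
    (ψ : EuclideanSpace ℂ (Conf Ω K)) :
    run I z i (gs ++ hs) ψ = run I z i hs (run I z i gs ψ) := by
  induction gs generalizing ψ with
  | nil => rfl
  | cons g gs ih => exact ih _

/-- The number of walks in a circuit. -/
def walkTotal (gs : List (Gate Ω K ℓ)) : ℕ := (gs.map Gate.walkCost).sum

/-- The number of rotations in a circuit. -/
def rotTotal (gs : List (Gate Ω K ℓ)) : ℕ := (gs.map Gate.rotCost).sum

theorem walkTotal_append (gs hs : List (Gate Ω K ℓ)) :
    walkTotal (gs ++ hs) = walkTotal gs + walkTotal hs := by simp [walkTotal]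

theorem rotTotal_append (gs hs : List (Gate Ω K ℓ)) :
    rotTotal (gs ++ hs) = rotTotal gs + rotTotal hs := by simp [rotTotal]

/-- A circuit for the inverse of a gate: the walk and the rotation are conjugated to their
inverses by the reflection about `𝒜` and by the Pauli matrix `Z`. -/
def invGate (z : Ω) : Gate Ω K ℓ → List (Gate Ω K ℓ)
  | Gate.free F => [Gate.free F.symm]
  | Gate.walk j h1 h2 =>
      let R := diagIso fun c : Conf Ω K => if c.1.2 = z then 1 else -1
      [Gate.free R, Gate.walk j h1 h2, Gate.free R]
  | Gate.rot =>
      let Z := diagIso fun c : Conf Ω K => if c.2.1 = 0 then 1 else -1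
      [Gate.free Z, Gate.rot, Gate.free Z]

theorem walkOp_reflection_walkOp_reflection (z : Ω) (U : TwoReg Ω ≃ₗᵢ[ℂ] TwoReg Ω)
    (ψ : TwoReg Ω) :
    (spaceA z).reflection (walkOp z U ((spaceA z).reflection (walkOp z U ψ))) = ψ := by
  simp [walkOp]

theorem rotIso_conj (y : ℝ) (v w : EuclideanSpace ℂ (Fin 2)) (h0 : w 0 = rotIso y v 0)
    (h1 : w 1 = -rotIso y v 1) : rotIso y w 0 = v 0 ∧ rotIso y w 1 = -v 1 := by
  have h := Complex.sin_sq_add_cos_sq ((Real.arccos (Real.sqrt y) : ℝ) : ℂ)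
  have key : ∀ u : EuclideanSpace ℂ (Fin 2), rotIso y u = WithLp.toLp 2
        ![(Real.cos (Real.arccos (Real.sqrt y)) : ℂ) * u 0
            + (Real.sin (Real.arccos (Real.sqrt y)) : ℂ) * u 1,
          -(Real.sin (Real.arccos (Real.sqrt y)) : ℂ) * u 0
            + (Real.cos (Real.arccos (Real.sqrt y)) : ℂ) * u 1] := fun u => rfl
  rw [key] at h0 h1
  rw [key]
  simp only [Matrix.cons_val_zero, Matrix.cons_val_one, Complex.ofReal_cos,
    Complex.ofReal_sin] at h0 h1 ⊢
  rw [h0, h1]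
  constructor
  · linear_combination v 0 * h
  · linear_combination -v 1 * h

theorem run_invGate (I : AnnealingData Ω) (z : Ω) (i : ℕ) (g : Gate Ω K ℓ)
    (ψ : EuclideanSpace ℂ (Conf Ω K)) : run I z i (invGate z g) (gateIso I z i g ψ) = ψ := by
  cases g with
  | free F => exact F.symm_apply_apply ψ
  | walk j h1 h2 =>
    set R := diagIso fun c : Conf Ω K => if c.1.2 = z then 1 else -1 with hR
    set e := Equiv.prodComm (Ω × Ω) (Fin 2 × K)
    have hs : ∀ c φ, slice e c (R φ) = (spaceA z).reflection (slice e c φ) := by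
      intro c φ
      ext q
      rw [reflection_spaceA_apply]
      simp only [hR, slice_apply, diagIso_apply]
      by_cases h : q.2 = z <;> simp [e, h]
    have hg : ∀ c φ, slice e c (gateIso I z i (Gate.walk j h1 h2 : Gate Ω K ℓ) φ)
        = if c.1 = 1 then walkOp z (I.update j) (slice e c φ) else slice e c φ := by
      intro c φ
      rw [gateIso, slice_blockIso]
      split_ifs <;> rfl
    have : run I z i (invGate z (Gate.walk j h1 h2 : Gate Ω K ℓ))
        (gateIso I z i (Gate.walk j h1 h2) ψ) = R (gateIso I z i (Gate.walk j h1 h2 : Gate Ω K ℓ)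
          (R (gateIso I z i (Gate.walk j h1 h2 : Gate Ω K ℓ) ψ))) := rfl
    rw [this]
    refine ext_slice e fun c => ?_
    rw [hs, hg, hs, hg]
    -- The reflections around the walk are not controlled; on the branch where the walk is idle, the
    -- two cancel.
    split_ifs with h
    · exact walkOp_reflection_walkOp_reflection z _ _
    · simp
  | rot =>
    set Z := diagIso fun c : Conf Ω K => if c.2.1 = 0 then 1 else -1 with hZ
    have : run I z i (invGate z (Gate.rot : Gate Ω K ℓ)) (gateIso I z i Gate.rot ψ)
        = Z (gateIso I z i (Gate.rot : Gate Ω K ℓ)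
          (Z (gateIso I z i (Gate.rot : Gate Ω K ℓ) ψ))) := rfl
    rw [this]
    refine ext_slice (qubitEquiv Ω K) fun c => ?_
    have hs : ∀ φ, slice (qubitEquiv Ω K) c (Z φ) 0 = slice (qubitEquiv Ω K) c φ 0 ∧
        slice (qubitEquiv Ω K) c (Z φ) 1 = -slice (qubitEquiv Ω K) c φ 1 := by
      intro φ
      simp [hZ, qubitEquiv]
    have hg : ∀ φ, slice (qubitEquiv Ω K) c (gateIso I z i (Gate.rot : Gate Ω K ℓ) φ)
        = rotIso (I.yval i c.1.1) (slice (qubitEquiv Ω K) c φ) := fun φ => by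
      rw [gateIso, slice_blockIso]
    have h1 := hs (gateIso I z i (Gate.rot : Gate Ω K ℓ) ψ)
    rw [hg] at h1
    have h2 := rotIso_conj _ _ _ h1.1 h1.2
    have h3 := hs (gateIso I z i (Gate.rot : Gate Ω K ℓ)
          (Z (gateIso I z i (Gate.rot : Gate Ω K ℓ) ψ)))
    rw [hg, h2.1, h2.2, neg_neg] at h3
    ext a
    fin_cases a
    · exact h3.1
    · exact h3.2

/-- A circuit for the inverse of a circuit. -/
def invCircuit (z : Ω) : List (Gate Ω K ℓ) → List (Gate Ω K ℓ)
  | [] => []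
  | g :: gs => invCircuit z gs ++ invGate z g

theorem run_invCircuit (I : AnnealingData Ω) (z : Ω) (i : ℕ) (gs : List (Gate Ω K ℓ))
    (ψ : EuclideanSpace ℂ (Conf Ω K)) : run I z i (invCircuit z gs) (run I z i gs ψ) = ψ := by
  induction gs generalizing ψ with
  | nil => rfl
  | cons g gs ih =>
    rw [invCircuit, run_append]
    have : run I z i (g :: gs) ψ = run I z i gs (gateIso I z i g ψ) := rfl
    rw [this, ih, run_invGate]

theorem walkTotal_invCircuit (z : Ω) (gs : List (Gate Ω K ℓ)) :
    walkTotal (invCircuit z gs) = walkTotal gs := by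
  induction gs with
  | nil => rfl
  | cons g gs ih =>
    rw [invCircuit, walkTotal_append, ih]
    cases g <;> simp [walkTotal, invGate, Gate.walkCost, add_comm]

theorem rotTotal_invCircuit (z : Ω) (gs : List (Gate Ω K ℓ)) :
    rotTotal (invCircuit z gs) = rotTotal gs := by
  induction gs with
  | nil => rfl
  | cons g gs ih =>
    rw [invCircuit, rotTotal_append, ih]
    cases g <;> simp [rotTotal, invGate, Gate.rotCost, add_comm]

section Implementable

variable {X : Type*} [NormedAddCommGroup X] [InnerProductSpace ℂ X]

/-- There is a circuit with at most `w` walks and `v` rotations which, on every admissible instance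
`I`, acts as `o I` on the logical space embedded by `ι`, up to the error `e`. -/
def Implementable (ℓ : ℕ) (δ : ℝ) (z : Ω) (i : ℕ) (ι : X →ₗᵢ[ℂ] EuclideanSpace ℂ (Conf Ω K))
    (o : AnnealingData Ω → (X ≃ₗᵢ[ℂ] X)) (w v : ℕ) (e : ℝ) : Prop :=
  ∃ gs : List (Gate Ω K ℓ), walkTotal gs ≤ w ∧ rotTotal gs ≤ v ∧
    ∀ I : AnnealingData Ω, I.Admissible z ℓ δ → ∀ x : X,
      ‖run I z i gs (ι x) - ι (o I x)‖ ≤ e * ‖x‖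

namespace Implementable

variable {δ : ℝ} {z : Ω} {i : ℕ} {ι : X →ₗᵢ[ℂ] EuclideanSpace ℂ (Conf Ω K)}
  {o o' : AnnealingData Ω → (X ≃ₗᵢ[ℂ] X)} {w w' v v' : ℕ} {e e' : ℝ}

/-- Errors add because the remaining circuit is unitary and does not amplify the earlier error. -/
theorem trans (h : Implementable ℓ δ z i ι o w v e) (h' : Implementable ℓ δ z i ι o' w' v' e') :
    Implementable ℓ δ z i ι (fun I => (o I).trans (o' I)) (w + w') (v + v') (e + e') := by
  obtain ⟨gs, hw, hv, hg⟩ := h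
  obtain ⟨gs', hw', hv', hg'⟩ := h'
  refine ⟨gs ++ gs', ?_, ?_, fun I hI x => ?_⟩
  · rw [walkTotal_append]; exact add_le_add hw hw'
  · rw [rotTotal_append]; exact add_le_add hv hv'
  · rw [run_append]
    have h1 := hg I hI x
    have h2 := hg' I hI (o I x)
    rw [LinearIsometryEquiv.norm_map] at h2
    have h3 : ‖run I z i gs' (run I z i gs (ι x)) - run I z i gs' (ι (o I x))‖ ≤ e * ‖x‖ := by
      rw [← map_sub, LinearIsometryEquiv.norm_map]; exact h1
    calc _ ≤ _ := norm_sub_le_norm_sub_add_norm_sub _ (run I z i gs' (ι (o I x))) _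
      _ ≤ e * ‖x‖ + e' * ‖x‖ := add_le_add h3 h2
      _ = (e + e') * ‖x‖ := by ring

/-- Apply the estimate at `(o I)⁻¹ x` and move the circuit to the other side by unitarity; inverting
gate by gate keeps both counts. -/
theorem symm (h : Implementable ℓ δ z i ι o w v e) :
    Implementable ℓ δ z i ι (fun I => (o I).symm) w v e := by
  obtain ⟨gs, hw, hv, hg⟩ := h
  refine ⟨invCircuit z gs, by rwa [walkTotal_invCircuit], by rwa [rotTotal_invCircuit],
    fun I hI x => ?_⟩
  have h1 := hg I hI ((o I).symm x)
  rw [LinearIsometryEquiv.norm_map, LinearIsometryEquiv.apply_symm_apply, norm_sub_rev] at h1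
  have h2 := run_invCircuit I z i gs (ι ((o I).symm x))
  calc _ = ‖run I z i (invCircuit z gs) (ι x)
        - run I z i (invCircuit z gs) (run I z i gs (ι ((o I).symm x)))‖ := by rw [h2]
    _ ≤ e * ‖x‖ := by rw [← map_sub, LinearIsometryEquiv.norm_map]; exact h1

theorem mono (h : Implementable ℓ δ z i ι o w v e) (hw : w ≤ w') (hv : v ≤ v') (he : e ≤ e') :
    Implementable ℓ δ z i ι o w' v' e' := by
  obtain ⟨gs, h1, h2, h3⟩ := h
  exact ⟨gs, h1.trans hw, h2.trans hv, fun I hI x => (h3 I hI x).trans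
    (mul_le_mul_of_nonneg_right he (norm_nonneg x))⟩

theorem congr (h : Implementable ℓ δ z i ι o w v e)
    (ho : ∀ I : AnnealingData Ω, I.Admissible z ℓ δ → ∀ x, o I x = o' I x) :
    Implementable ℓ δ z i ι o' w v e := by
  obtain ⟨gs, h1, h2, h3⟩ := h
  exact ⟨gs, h1, h2, fun I hI x => by rw [← ho I hI x]; exact h3 I hI x⟩

/-- Restriction to an invariant logical subspace. -/
theorem comp {Y : Type*} [NormedAddCommGroup Y] [InnerProductSpace ℂ Y]
    (h : Implementable ℓ δ z i ι o w v e) (τ : Y →ₗᵢ[ℂ] X) {u : AnnealingData Ω → (Y ≃ₗᵢ[ℂ] Y)}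
    (hu : ∀ I : AnnealingData Ω, I.Admissible z ℓ δ → ∀ y, o I (τ y) = τ (u I y)) :
    Implementable ℓ δ z i (ι.comp τ) u w v e := by
  obtain ⟨gs, h1, h2, h3⟩ := h
  refine ⟨gs, h1, h2, fun I hI y => ?_⟩
  have h4 := h3 I hI (τ y)
  rw [hu I hI, τ.norm_map] at h4
  exact h4

/-- An operation that does not depend on the instance is free. -/
theorem free [FiniteDimensional ℂ X] (ℓ : ℕ) (δ : ℝ) (z : Ω) (i : ℕ)
    (ι : X →ₗᵢ[ℂ] EuclideanSpace ℂ (Conf Ω K)) (F : X ≃ₗᵢ[ℂ] X) :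
    Implementable ℓ δ z i ι (fun _ => F) 0 0 0 := by
  obtain ⟨G, hG⟩ := exists_unitary_comp_eq ι (ι.comp F.toLinearIsometry)
  refine ⟨[Gate.free G], le_rfl, le_rfl, fun I _ x => ?_⟩
  have : run I z i [(Gate.free G : Gate Ω K ℓ)] (ι x) = ι (F x) := hG x
  rw [this, sub_self, norm_zero, zero_mul]

end Implementable

end Implementable

end Circuits

end QPartition

end

noncomputable section

namespace QPartition

set_option linter.unusedSectionVars false

open scoped ComplexConjugate

/-! ### Powers of the average as convex combinations of powers -/

section AverageCoefficients

-- The coefficients are those of `((1 + X + ⋯ + X^(T-1)) / T)^r`: they are nonnegative, and their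
-- sum is the value `1` at `X = 1`. They do not depend on `W`, so one counter state serves every
-- walk.
open Polynomial in
theorem exists_average_pow_coefficients (T r : ℕ) (hT : 0 < T) :
    ∃ c : Fin (r * (T - 1) + 1) → ℝ, (∀ k, 0 ≤ c k) ∧ ∑ k, c k = 1 ∧
      ∀ {E : Type*} [NormedAddCommGroup E] [InnerProductSpace ℂ E] [FiniteDimensional ℂ E]
        (W : E ≃ₗᵢ[ℂ] E), ∑ k, (c k : ℂ) • toEnd W ^ (k : ℕ) = average W T ^ r := by
  let p : ℝ[X] := C ((T : ℝ)⁻¹) * ∑ k ∈ Finset.range T, X ^ k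
  have hp0 : ∀ n, 0 ≤ p.coeff n := by
    intro n
    simp only [p, coeff_C_mul, finsetSum_coeff, coeff_X_pow]
    refine mul_nonneg (by positivity) (Finset.sum_nonneg fun k _ => ?_)
    split_ifs <;> norm_num
  have hpr0 : ∀ s n, 0 ≤ (p ^ s).coeff n := by
    intro s
    induction s with
    | zero => intro n; rw [pow_zero, coeff_one]; split_ifs <;> norm_num
    | succ s ih =>
      intro n
      rw [pow_succ, coeff_mul]
      exact Finset.sum_nonneg fun x _ => mul_nonneg (ih _) (hp0 _)
  have hdeg : (p ^ r).natDegree < r * (T - 1) + 1 := by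
    have h1 : p.natDegree ≤ T - 1 := by
      refine (natDegree_C_mul_le _ _).trans (natDegree_sum_le_of_forall_le _ _ fun k hk => ?_)
      rw [natDegree_X_pow]
      have := Finset.mem_range.1 hk
      omega
    have h2 : (p ^ r).natDegree ≤ r * p.natDegree := natDegree_pow_le
    have h3 : r * p.natDegree ≤ r * (T - 1) := Nat.mul_le_mul_left r h1
    omega
  have hp1 : p.eval 1 = 1 := by
    have : (T : ℝ) ≠ 0 := by exact_mod_cast hT.ne'
    simp [p, eval_finsetSum, this]
  refine ⟨fun k => (p ^ r).coeff k, fun k => hpr0 r k, ?_, ?_⟩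
  · rw [Fin.sum_univ_eq_sum_range (fun k => (p ^ r).coeff k)]
    have h1 := eval_eq_sum_range' hdeg (1 : ℝ)
    simp only [one_pow, mul_one, eval_pow, hp1] at h1
    exact h1.symm
  · intro E _ _ _ W
    let q : ℂ[X] := p.map (algebraMap ℝ ℂ)
    have hq : aeval (toEnd W) q = average W T := by
      simp [q, p, average, Polynomial.map_sum, Algebra.smul_def]
    have hqc : ∀ n, (q ^ r).coeff n = (((p ^ r).coeff n : ℝ) : ℂ) := by
      intro n
      simp only [q, ← Polynomial.map_pow, coeff_map]
      rfl
    have hqd : (q ^ r).natDegree < r * (T - 1) + 1 := by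
      simp only [q, ← Polynomial.map_pow]
      exact lt_of_le_of_lt natDegree_map_le hdeg
    rw [← hq, ← map_pow, aeval_eq_sum_range' hqd]
    rw [Fin.sum_univ_eq_sum_range (fun k => (((p ^ r).coeff k : ℝ) : ℂ) • toEnd W ^ k)]
    simp only [hqc]

end AverageCoefficients

/-! ### Walks controlled on a counter register -/

section Select

variable {Ω : Type*} [Fintype Ω] [DecidableEq Ω] {M : Type} [Fintype M] {ℓ d : ℕ}

/-- The vector with components `w k`, the qubit being `0`. -/
def qubitZero {K : Type} (w : K → TwoReg Ω) : EuclideanSpace ℂ (Conf Ω K) :=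
  WithLp.toLp 2 fun c => if c.2.1 = 0 then w c.2.2 c.1 else 0

theorem norm_sq_qubitZero {K : Type} [Fintype K] (w : K → TwoReg Ω) :
    ‖qubitZero w‖ ^ 2 = ∑ k, ‖w k‖ ^ 2 := by
  rw [norm_sq_eq_sum_slice (Equiv.prodComm (Ω × Ω) (Fin 2 × K)), Fintype.sum_prod_type,
    Fin.sum_univ_two]
  have h0 : ∀ k, slice (Equiv.prodComm (Ω × Ω) (Fin 2 × K)) (0, k) (qubitZero w) = w k := fun k => by
    ext q; simp [qubitZero]
  have h1 : ∀ k, slice (Equiv.prodComm (Ω × Ω) (Fin 2 × K)) (1, k) (qubitZero w) = 0 := fun k => by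
    ext q; simp [qubitZero]
  simp [h0, h1]

theorem qubitZero_sub {K : Type} (w w' : K → TwoReg Ω) :
    qubitZero w - qubitZero w' = qubitZero fun k => w k - w' k := by
  ext c
  by_cases h : c.2.1 = 0 <;> simp [qubitZero, h]

/-- Flips the qubit if `t < κ`, where `κ` is the content of the counter register. -/
def flipEquiv (Ω : Type*) (M : Type) (d t : ℕ) :
    Conf Ω (M × Fin (d + 1)) ≃ Conf Ω (M × Fin (d + 1)) :=
  Function.Involutive.toPerm
    (fun c => (c.1, (if t < (c.2.2.2 : ℕ) then c.2.1 + 1 else c.2.1, c.2.2))) (by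
      rintro ⟨q, b, m, k⟩
      by_cases h : t < (k : ℕ)
      · simp only [h, if_true]
        fin_cases b <;> rfl
      · simp [h])

/-- `n` rounds of walks, each controlled on the counter register. -/
def selectCircuit (M : Type) [Fintype M] (d : ℕ) {j : ℕ} (h1 : 1 ≤ j) (h2 : j < ℓ) :
    ℕ → List (Gate Ω (M × Fin (d + 1)) ℓ)
  | 0 => []
  | n + 1 => selectCircuit M d h1 h2 n ++
      [Gate.free (LinearIsometryEquiv.piLpCongrLeft 2 ℂ ℂ (flipEquiv Ω M d n)), Gate.walk j h1 h2,
        Gate.free (LinearIsometryEquiv.piLpCongrLeft 2 ℂ ℂ (flipEquiv Ω M d n))]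

theorem walkTotal_selectCircuit {j : ℕ} (h1 : 1 ≤ j) (h2 : j < ℓ) (n : ℕ) :
    walkTotal (selectCircuit (Ω := Ω) M d h1 h2 n) = n := by
  induction n with
  | zero => rfl
  | succ n ih =>
    rw [selectCircuit, walkTotal_append, ih]
    simp [walkTotal, Gate.walkCost]

theorem rotTotal_selectCircuit {j : ℕ} (h1 : 1 ≤ j) (h2 : j < ℓ) (n : ℕ) :
    rotTotal (selectCircuit (Ω := Ω) M d h1 h2 n) = 0 := by
  induction n with
  | zero => rfl
  | succ n ih =>
    rw [selectCircuit, rotTotal_append, ih]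
    simp [rotTotal, Gate.rotCost]

/-- The comparison `t < κ` is written into the qubit, used as the control of one walk, and erased,
which returns the qubit to `0`. -/
theorem run_select_round (I : AnnealingData Ω) (z : Ω) (i : ℕ) {j : ℕ} (h1 : 1 ≤ j) (h2 : j < ℓ)
    (t : ℕ) (w : M × Fin (d + 1) → TwoReg Ω) :
    run I z i [(Gate.free (LinearIsometryEquiv.piLpCongrLeft 2 ℂ ℂ (flipEquiv Ω M d t)) :
        Gate Ω (M × Fin (d + 1)) ℓ), Gate.walk j h1 h2,
        Gate.free (LinearIsometryEquiv.piLpCongrLeft 2 ℂ ℂ (flipEquiv Ω M d t))] (qubitZero w)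
      = qubitZero fun k => if t < (k.2 : ℕ) then walkOp z (I.update j) (w k) else w k := by
  ext ⟨q, b, m, k⟩
  set W := walkOp z (I.update j) with hW
  set e := Equiv.prodComm (Ω × Ω) (Fin 2 × (M × Fin (d + 1)))
  set Fl : EuclideanSpace ℂ (Conf Ω (M × Fin (d + 1))) ≃ₗᵢ[ℂ] _ :=
    LinearIsometryEquiv.piLpCongrLeft 2 ℂ ℂ (flipEquiv Ω M d t)
  have hF : ∀ (ψ : EuclideanSpace ℂ (Conf Ω (M × Fin (d + 1)))) q b m k,
      Fl ψ (q, (b, (m, k))) = ψ (q, (if t < (k : ℕ) then b + 1 else b, (m, k))) :=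
    fun ψ q b m k => rfl
  have hw : ∀ (ψ : EuclideanSpace ℂ (Conf Ω (M × Fin (d + 1)))) q b k,
      gateIso I z i (Gate.walk j h1 h2 : Gate Ω (M × Fin (d + 1)) ℓ) ψ (q, (b, k))
        = if b = 1 then W (slice e (b, k) ψ) q else ψ (q, (b, k)) := by
    intro ψ q b k
    rw [gateIso, blockIso_apply]
    by_cases h : b = 1
    · simp only [h, if_true]; rfl
    · simp only [h, if_false, Equiv.prodComm_apply, Prod.swap]; rfl
  change Fl (gateIso I z i (Gate.walk j h1 h2 : Gate Ω (M × Fin (d + 1)) ℓ) (Fl (qubitZero w)))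
    (q, (b, (m, k))) = _
  rw [hF, hw]
  have hsl : ∀ b', slice e (b', (m, k)) (Fl (qubitZero w))
      = if (if t < (k : ℕ) then b' + 1 else b') = 0 then w (m, k) else 0 := by
    intro b'
    ext q'
    simp only [slice_apply]
    change Fl (qubitZero w) (q', (b', (m, k))) = _
    rw [hF]
    by_cases h : (if t < (k : ℕ) then b' + 1 else b') = 0 <;> simp [qubitZero, h]
  rw [hsl, hF]
  by_cases h : t < (k : ℕ) <;> fin_cases b <;> simp [qubitZero, h]

/-- Round `t` acts exactly when the counter exceeds `t`, so the rounds accumulate the power given by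
the counter. -/
theorem run_selectCircuit (I : AnnealingData Ω) (z : Ω) (i : ℕ) {j : ℕ} (h1 : 1 ≤ j) (h2 : j < ℓ)
    (n : ℕ) (w : M × Fin (d + 1) → TwoReg Ω) :
    run I z i (selectCircuit M d h1 h2 n) (qubitZero w)
      = qubitZero fun k => (toEnd (walkOp z (I.update j)) ^ min (k.2 : ℕ) n) (w k) := by
  induction n with
  | zero => simp only [selectCircuit, Nat.min_zero, pow_zero, Module.End.one_apply]; rfl
  | succ n ih =>
    rw [selectCircuit, run_append, ih, run_select_round]
    congr 1
    ext1 k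
    split_ifs with h
    · have e1 : min (k.2 : ℕ) (n + 1) = n + 1 := by omega
      have e2 : min (k.2 : ℕ) n = n := by omega
      rw [e1, e2, pow_succ', Module.End.mul_apply, toEnd_apply]
    · have e1 : min (k.2 : ℕ) (n + 1) = min (k.2 : ℕ) n := by omega
      rw [e1]

/-- Separates the counter register from the other registers. -/
def counterEquiv (Ω : Type*) (M : Type) (d : ℕ) :
    Conf Ω (M × Fin (d + 1)) ≃ ((Ω × Ω) × (Fin 2 × M)) × Fin (d + 1) where
  toFun c := ((c.1, (c.2.1, c.2.2.1)), c.2.2.2)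
  invFun x := (x.1.1, (x.1.2.1, (x.1.2.2, x.2)))
  left_inv _ := rfl
  right_inv _ := rfl

theorem counter_phaseShift_qubitZero {χ : EuclideanSpace ℂ (Fin (d + 1))} (hχ : ‖χ‖ = 1)
    (φ : M → Circle) (w : M × Fin (d + 1) → TwoReg Ω) :
    blockIso (counterEquiv Ω M d) (fun x => phaseShift χ (φ x.2.2)) (qubitZero w)
      = qubitZero fun k => w k + (((φ k.1 : ℂ) - 1) * χ k.2) •
          ∑ k', conj (χ k') • w (k.1, k') := by
  ext ⟨q, b, m, k⟩
  rw [blockIso_apply, phaseShift_apply hχ]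
  by_cases hb : b = 0
  · subst hb
    simp only [counterEquiv, qubitZero, PiLp.inner_apply]
    simp [Finset.mul_sum, mul_comm, mul_assoc, mul_left_comm]
  · simp [counterEquiv, qubitZero, PiLp.inner_apply, hb]

/-- The embedding of the logical space into the state space of the circuit: second register `z`,
qubit `0`, counter register in the state `χ`. -/
def logical (z : Ω) (M : Type) [Fintype M] (χ : EuclideanSpace ℂ (Fin (d + 1))) (hχ : ‖χ‖ = 1) :
    EuclideanSpace ℂ (Ω × M) →ₗᵢ[ℂ] EuclideanSpace ℂ (Conf Ω (M × Fin (d + 1))) where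
  toFun v := qubitZero fun k => χ k.2 • inA z (slice (Equiv.prodComm Ω M) k.1 v)
  map_add' v w := by
    ext c
    by_cases h : c.2.1 = 0 <;> simp [qubitZero, h, slice_add]
  map_smul' r v := by
    ext c
    by_cases h : c.2.1 = 0 <;> simp [qubitZero, h, slice_smul, mul_left_comm]
  norm_map' v := by
    rw [← sq_eq_sq₀ (norm_nonneg _) (norm_nonneg _)]
    simp only [LinearMap.coe_mk, AddHom.coe_mk]
    rw [norm_sq_qubitZero, norm_sq_eq_sum_slice (Equiv.prodComm Ω M), Fintype.sum_prod_type]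
    refine Finset.sum_congr rfl fun m _ => ?_
    simp only [norm_smul, mul_pow, LinearIsometry.norm_map]
    rw [← Finset.sum_mul, ← EuclideanSpace.norm_sq_eq, hχ]
    ring

theorem logical_eq (z : Ω) (χ : EuclideanSpace ℂ (Fin (d + 1))) (hχ : ‖χ‖ = 1)
    (v : EuclideanSpace ℂ (Ω × M)) :
    logical z M χ hχ v = qubitZero fun k => χ k.2 • inA z (slice (Equiv.prodComm Ω M) k.1 v) := rfl

end Select

/-! ### Phase shifts along Gibbs states -/

section GibbsState

variable {Ω : Type*} [Fintype Ω]

/-- The coherent version of the Boltzmann distribution `π_j`. -/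
def gibbsState (I : AnnealingData Ω) (j : ℕ) : EuclideanSpace ℂ Ω :=
  WithLp.toLp 2 fun x => (Real.sqrt (boltzmann I.energy (I.beta j) x) : ℂ)

theorem partitionFn_pos [Nonempty Ω] (E : Ω → ℝ) (b : ℝ) : 0 < partitionFn E b :=
  Finset.sum_pos (fun _ _ => Real.exp_pos _) Finset.univ_nonempty

theorem boltzmann_pos [Nonempty Ω] (E : Ω → ℝ) (b : ℝ) (x : Ω) : 0 < boltzmann E b x :=
  div_pos (Real.exp_pos _) (partitionFn_pos E b)

theorem sum_boltzmann [Nonempty Ω] (E : Ω → ℝ) (b : ℝ) : ∑ x, boltzmann E b x = 1 := by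
  simp only [boltzmann, ← Finset.sum_div]
  exact div_self (partitionFn_pos E b).ne'

theorem norm_gibbsState [Nonempty Ω] (I : AnnealingData Ω) (j : ℕ) : ‖gibbsState I j‖ = 1 := by
  rw [← sq_eq_sq₀ (norm_nonneg _) zero_le_one, EuclideanSpace.norm_sq_eq, one_pow,
    ← sum_boltzmann I.energy (I.beta j)]
  refine Finset.sum_congr rfl fun x _ => ?_
  simp [gibbsState, Real.sq_sqrt (boltzmann_pos I.energy (I.beta j) x).le]

variable {M : Type} [Fintype M]

/-- Multiplication by a phase, depending on the memory, along the Gibbs state. -/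
def gibbsPhase (I : AnnealingData Ω) (j : ℕ) (φ : M → Circle) :
    EuclideanSpace ℂ (Ω × M) ≃ₗᵢ[ℂ] EuclideanSpace ℂ (Ω × M) :=
  blockIso (Equiv.prodComm Ω M) fun m => phaseShift (gibbsState I j) (φ m)

variable [DecidableEq Ω] {ℓ d : ℕ} {δ : ℝ} {z : Ω}

/-- Split `v` into its component along the Gibbs state, which the walk fixes, and an orthogonal
remainder, which the averages contract. -/
theorem norm_selected_sub_le {I : AnnealingData Ω} (hI : I.Admissible z ℓ δ) {j : ℕ} (h1 : 1 ≤ j)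
    (h2 : j < ℓ) (hδ0 : 0 < δ) (hδ1 : δ ≤ 1) {T : ℕ} (hT : 2 ≤ T * Real.sqrt δ) (r : ℕ)
    (v : EuclideanSpace ℂ Ω) :
    ‖(average (walkOp z (I.update j)) T ^ r) (inA z v)
        - inner ℂ (gibbsState I j) v • inA z (gibbsState I j)‖ ≤ (1 / 2) ^ r * ‖v‖ := by
  have : Nonempty Ω := ⟨z⟩
  set s := gibbsState I j with hs
  have hsn : ‖s‖ = 1 := norm_gibbsState I j
  set u := v - inner ℂ s v • s with hu
  have hsu : inner ℂ s u = 0 := by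
    rw [hu, inner_sub_right, inner_smul_right, inner_self_eq_norm_sq_to_K, hsn]; simp
  have hfix : walkOp z (I.update j) (inA z s) = inA z s :=
    walkOp_inA_sqrt (hI.isUpdate j h1 h2) (boltzmann_pos I.energy (I.beta j))
      (hI.reversible j h1 h2)
  have hTpos : (T : ℂ) ≠ 0 := by
    intro h
    have : (T : ℝ) = 0 := by exact_mod_cast h
    rw [this] at hT; linarith
  have havg : average (walkOp z (I.update j)) T (inA z s) = inA z s := by
    simp [average, toEnd_pow_apply_of_fixed hfix, ← Nat.cast_smul_eq_nsmul ℂ, smul_smul, hTpos]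
  have havg' : (average (walkOp z (I.update j)) T ^ r) (inA z s) = inA z s := by
    induction r with
    | zero => simp
    | succ r ih => rw [pow_succ, Module.End.mul_apply, havg, ih]
  have hdec : (average (walkOp z (I.update j)) T ^ r) (inA z v) - inner ℂ s v • inA z s
      = (average (walkOp z (I.update j)) T ^ r) (inA z u) := by
    rw [hu, map_sub, map_smul, map_sub, map_smul, havg']
  rw [hdec]
  refine (norm_average_pow_walkOp_le (hI.isUpdate j h1 h2) (hI.stochastic j h1 h2)
    (hI.ergodic j h1 h2) (boltzmann_pos I.energy (I.beta j)) (hI.reversible j h1 h2) hδ0 hδ1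
    (hI.gap_ge j h1 h2) hT r u hsu).trans ?_
  refine mul_le_mul_of_nonneg_left ?_ (by positivity)
  have h3 : inner ℂ (inner ℂ s v • s) u = 0 := by rw [inner_smul_left, hsu, mul_zero]
  have h4 := norm_add_sq_eq_norm_sq_add_norm_sq_of_inner_eq_zero _ _ h3
  rw [hu, add_sub_cancel, ← hu] at h4
  nlinarith [norm_nonneg u, norm_nonneg v, mul_self_nonneg ‖inner ℂ s v • s‖]

/-- Compute the controlled powers, apply the phase along the counter state `χ`, and uncompute.
Between the two copies of `χ`, the controlled powers reduce to `∑ |χ_k|² W^k`, which is nearly the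
projection onto the Gibbs state. -/
theorem implementable_gibbsPhase_of_pos {i j : ℕ} (h1 : 1 ≤ j) (h2 : j < ℓ) (hδ0 : 0 < δ)
    (hδ1 : δ ≤ 1) {T r : ℕ} (hT : 2 ≤ T * Real.sqrt δ) {χ : EuclideanSpace ℂ (Fin (d + 1))}
    (hχ : ‖χ‖ = 1)
    (hsel : ∀ W : TwoReg Ω ≃ₗᵢ[ℂ] TwoReg Ω,
      ∑ k, (conj (χ k) * χ k) • toEnd W ^ (k : ℕ) = average W T ^ r) (φ : M → Circle) :
    Implementable ℓ δ z i (logical z M χ hχ) (fun I => gibbsPhase I j φ) (2 * d) 0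
      (2 * (1 / 2) ^ r) := by
  set Φ := blockIso (counterEquiv Ω M d) (fun x => phaseShift χ (φ x.2.2)) with hΦ
  refine ⟨selectCircuit M d h1 h2 d ++ ([Gate.free Φ] ++ invCircuit z (selectCircuit M d h1 h2 d)),
    ?_, ?_, fun I hI v => ?_⟩
  · simp only [walkTotal_append, walkTotal_invCircuit, walkTotal_selectCircuit]
    simp [walkTotal, Gate.walkCost]
    omega
  · simp only [rotTotal_append, rotTotal_invCircuit, rotTotal_selectCircuit]
    simp [rotTotal, Gate.rotCost]
  have : Nonempty Ω := ⟨z⟩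
  set s := gibbsState I j with hs
  have hsn : ‖s‖ = 1 := norm_gibbsState I j
  set W := walkOp z (I.update j) with hW
  have hfix : W (inA z s) = inA z s :=
    walkOp_inA_sqrt (hI.isUpdate j h1 h2) (boltzmann_pos I.energy (I.beta j))
      (hI.reversible j h1 h2)
  set e := Equiv.prodComm Ω M
  have hmin : ∀ k : Fin (d + 1), min (k : ℕ) d = k := fun k => by have := k.2; omega
  have hbound := fun m => norm_selected_sub_le hI h1 h2 hδ0 hδ1 hT r (slice e m v)
  set D : M → TwoReg Ω := fun m => (average W T ^ r) (inA z (slice e m v))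
        - inner ℂ s (slice e m v) • inA z s with hD
  have hrun : run I z i (selectCircuit M d h1 h2 d ++ ([Gate.free Φ] ++
      invCircuit z (selectCircuit M d h1 h2 d))) (logical z M χ hχ v)
      = run I z i (invCircuit z (selectCircuit M d h1 h2 d))
        (Φ (run I z i (selectCircuit M d h1 h2 d) (logical z M χ hχ v))) := by
    rw [run_append, run_append]; rfl
  have hinv := run_invCircuit I z i (selectCircuit M d h1 h2 d)
    (logical z M χ hχ (gibbsPhase I j φ v))
  -- The comparison is made before uncomputing, which preserves distances. Since `W` fixes the Gibbs
  -- state, only the deviation `D` from the projection survives, with a factor `φ - 1` of modulus at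
  -- most `2`.
  have hdiff : Φ (run I z i (selectCircuit M d h1 h2 d) (logical z M χ hχ v))
      - run I z i (selectCircuit M d h1 h2 d) (logical z M χ hχ (gibbsPhase I j φ v))
      = qubitZero fun k => (((φ k.1 : ℂ) - 1) * χ k.2) • D k.1 := by
    rw [logical_eq, logical_eq, run_selectCircuit, run_selectCircuit, hΦ,
      counter_phaseShift_qubitZero hχ, qubitZero_sub]
    congr 1
    ext1 k
    have hsum : ∑ k', conj (χ k') • (toEnd W ^ min (k' : ℕ) d) (χ k' • inA z (slice e k.1 v))
        = (average W T ^ r) (inA z (slice e k.1 v)) := by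
      rw [← hsel W, LinearMap.sum_apply]
      refine Finset.sum_congr rfl fun k' _ => ?_
      rw [hmin, map_smul, smul_smul, LinearMap.smul_apply]
    simp only [← hW]
    rw [hsum]
    simp only [gibbsPhase, slice_blockIso, phaseShift_apply hsn, ← hs, map_add, map_smul,
      smul_add, hmin, toEnd_pow_apply_of_fixed hfix, hD]
    module
  rw [hrun, ← hinv, ← map_sub, LinearIsometryEquiv.norm_map, hdiff,
    ← sq_le_sq₀ (norm_nonneg _) (by positivity), norm_sq_qubitZero, Fintype.sum_prod_type, mul_pow,
    norm_sq_eq_sum_slice e v, Finset.mul_sum]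
  refine Finset.sum_le_sum fun m _ => ?_
  simp only [norm_smul, mul_pow, norm_mul]
  rw [← Finset.sum_mul, ← Finset.mul_sum, ← EuclideanSpace.norm_sq_eq, hχ, one_pow, mul_one]
  have h3 : ‖(φ m : ℂ) - 1‖ ≤ 2 := by
    refine (norm_sub_le _ _).trans ?_
    rw [Circle.norm_coe, norm_one]; norm_num
  have h4 : ‖(φ m : ℂ) - 1‖ ^ 2 ≤ 2 ^ 2 := pow_le_pow_left₀ (norm_nonneg _) h3 2
  have h5 : ‖D m‖ ^ 2 ≤ ((1 / 2) ^ r * ‖slice e m v‖) ^ 2 :=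
    pow_le_pow_left₀ (norm_nonneg _) (hbound m) 2
  calc ‖(φ m : ℂ) - 1‖ ^ 2 * ‖D m‖ ^ 2 ≤ 2 ^ 2 * ((1 / 2) ^ r * ‖slice e m v‖) ^ 2 :=
        mul_le_mul h4 h5 (by positivity) (by positivity)
    _ = _ := by ring

/-- The state `π_0` is the same for all instances. -/
theorem gibbsState_zero {I : AnnealingData Ω} (hI : I.Admissible z ℓ δ) :
    gibbsState I 0 = WithLp.toLp 2 fun _ => (Real.sqrt (1 / (Fintype.card Ω : ℝ)) : ℂ) := by
  ext x
  simp [gibbsState, boltzmann, partitionFn, hI.beta_zero]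

/-- For `j = 0` there is no chain, but infinite temperature makes the Gibbs state uniform, so its
phase shift is instance-independent and free. -/
theorem implementable_gibbsPhase {i j : ℕ} (h2 : j < ℓ) (hδ0 : 0 < δ)
    (hδ1 : δ ≤ 1) {T r : ℕ} (hT : 2 ≤ T * Real.sqrt δ) {χ : EuclideanSpace ℂ (Fin (d + 1))}
    (hχ : ‖χ‖ = 1)
    (hsel : ∀ W : TwoReg Ω ≃ₗᵢ[ℂ] TwoReg Ω,
      ∑ k, (conj (χ k) * χ k) • toEnd W ^ (k : ℕ) = average W T ^ r) (φ : M → Circle) :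
    Implementable ℓ δ z i (logical z M χ hχ) (fun I => gibbsPhase I j φ) (2 * d) 0
      (2 * (1 / 2) ^ r) := by
  rcases Nat.eq_zero_or_pos j with rfl | h1
  · refine ((Implementable.free ℓ δ z i (logical z M χ hχ) (blockIso (Equiv.prodComm Ω M) fun m =>
      phaseShift (WithLp.toLp 2 fun _ => (Real.sqrt (1 / (Fintype.card Ω : ℝ)) : ℂ))
        (φ m))).congr ?_).mono (Nat.zero_le _) le_rfl (by positivity)
    intro I hI x
    rw [gibbsPhase, gibbsState_zero hI]
  · exact implementable_gibbsPhase_of_pos h1 h2 hδ0 hδ1 hT hχ hsel φ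

end GibbsState

end QPartition

end

noncomputable section

namespace QPartition

set_option linter.unusedSectionVars false

open scoped ComplexConjugate

/-! ### Preparing the Gibbs state by annealing -/

section Preparation

variable {Ω : Type*} [Fintype Ω] {M : Type} [Fintype M]

/-- The embedding `v ↦ v ⊗ a`. -/
def withMemory (Ω : Type*) [Fintype Ω] (a : EuclideanSpace ℂ M) (ha : ‖a‖ = 1) :
    EuclideanSpace ℂ Ω →ₗᵢ[ℂ] EuclideanSpace ℂ (Ω × M) where
  toFun v := WithLp.toLp 2 fun q => v q.1 * a q.2
  map_add' v w := by ext q; simp [add_mul]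
  map_smul' c v := by ext q; simp [mul_assoc]
  norm_map' v := by
    rw [← sq_eq_sq₀ (norm_nonneg _) (norm_nonneg _), EuclideanSpace.norm_sq_eq,
      EuclideanSpace.norm_sq_eq v, Fintype.sum_prod_type]
    refine Finset.sum_congr rfl fun x _ => ?_
    simp only [LinearMap.coe_mk, AddHom.coe_mk, norm_mul, mul_pow]
    rw [← Finset.mul_sum, ← EuclideanSpace.norm_sq_eq, ha]
    ring

@[simp] theorem withMemory_apply (a : EuclideanSpace ℂ M) (ha : ‖a‖ = 1) (v : EuclideanSpace ℂ Ω)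
    (q : Ω × M) : withMemory Ω a ha v q = v q.1 * a q.2 := rfl

theorem gibbsPhase_withMemory [Nonempty Ω] (I : AnnealingData Ω) (j : ℕ) (ω : Circle)
    (a : EuclideanSpace ℂ M) (ha : ‖a‖ = 1) (v : EuclideanSpace ℂ Ω) :
    gibbsPhase I j (fun _ => ω) (withMemory Ω a ha v)
      = withMemory Ω a ha (phaseShift (gibbsState I j) ω v) := by
  refine ext_slice (Equiv.prodComm Ω M) fun m => ?_
  have h : ∀ u, slice (Equiv.prodComm Ω M) m (withMemory Ω a ha u) = a m • u := fun u => by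
    ext x; simp [mul_comm]
  rw [gibbsPhase, slice_blockIso, h, h, map_smul]

/-- Pointwise, `π_{j+1} α_j ≤ π_j` because cooling lowers every Boltzmann weight. Hence `π_j ≥
π_{j+1} / 2`, and the overlap `∑ √(π_j π_{j+1})` is at least `√(1/2)`. -/
theorem half_le_norm_inner_gibbsState_sq [DecidableEq Ω] {I : AnnealingData Ω} {z : Ω} {ℓ : ℕ}
    {δ : ℝ} (hI : I.Admissible z ℓ δ) {j : ℕ} (hj : j < ℓ) :
    1 / 2 ≤ ‖inner ℂ (gibbsState I (j + 1)) (gibbsState I j)‖ ^ 2 := by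
  have : Nonempty Ω := ⟨z⟩
  set b := boltzmann I.energy (I.beta j) with hb
  set b' := boltzmann I.energy (I.beta (j + 1)) with hb'
  have hpos : ∀ x, 0 < b x := boltzmann_pos _ _
  have hpos' : ∀ x, 0 < b' x := boltzmann_pos _ _
  have hle : ∀ x, 1 / 2 * b' x ≤ b x := by
    intro x
    have hZ := partitionFn_pos I.energy (I.beta j)
    have hZ' := partitionFn_pos I.energy (I.beta (j + 1))
    have h1 : b' x * I.ratio j = Real.exp (-I.beta (j + 1) * I.energy x)
        / partitionFn I.energy (I.beta j) := by
      simp only [hb', boltzmann, AnnealingData.ratio]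
      field_simp
    have h2 : Real.exp (-I.beta (j + 1) * I.energy x) / partitionFn I.energy (I.beta j) ≤ b x := by
      simp only [hb, boltzmann]
      gcongr
      · exact hI.energy_nonneg x
      · exact hI.beta_mono j hj
    have h3 := hI.ratio_ge j hj
    nlinarith [hpos' x]
  have hin : inner ℂ (gibbsState I (j + 1)) (gibbsState I j)
      = ((∑ x, Real.sqrt (b' x) * Real.sqrt (b x) : ℝ) : ℂ) := by
    rw [PiLp.inner_apply]
    push_cast
    refine Finset.sum_congr rfl fun x _ => ?_
    simp [gibbsState, ← hb, ← hb', mul_comm]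
  have hsum : Real.sqrt (1 / 2) ≤ ∑ x, Real.sqrt (b' x) * Real.sqrt (b x) := by
    calc Real.sqrt (1 / 2) = ∑ x, Real.sqrt (1 / 2) * b' x := by
          rw [← Finset.mul_sum, sum_boltzmann, mul_one]
      _ ≤ _ := by
          refine Finset.sum_le_sum fun x _ => ?_
          have h1 : Real.sqrt (1 / 2) * Real.sqrt (b' x) ≤ Real.sqrt (b x) := by
            rw [← Real.sqrt_mul (by norm_num)]
            exact Real.sqrt_le_sqrt (hle x)
          calc Real.sqrt (1 / 2) * b' x
              = Real.sqrt (b' x) * (Real.sqrt (1 / 2) * Real.sqrt (b' x)) := by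
                nth_rewrite 1 [← Real.mul_self_sqrt (hpos' x).le]; ring
            _ ≤ _ := mul_le_mul_of_nonneg_left h1 (Real.sqrt_nonneg _)
  rw [hin, Complex.norm_real, Real.norm_eq_abs, sq_abs]
  have h := pow_le_pow_left₀ (Real.sqrt_nonneg _) hsum 2
  rwa [Real.sq_sqrt (by norm_num)] at h

/-- The composition of the fixed-point iterations `π_0 → π_1 → … → π_j`. -/
def prepare (I : AnnealingData Ω) (m : ℕ) : ℕ → (EuclideanSpace ℂ Ω ≃ₗᵢ[ℂ] EuclideanSpace ℂ Ω)
  | 0 => LinearIsometryEquiv.refl ℂ _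
  | j + 1 => (prepare I m j).trans (fixedPoint (gibbsState I j) (gibbsState I (j + 1)) m)

variable [DecidableEq Ω] {ℓ : ℕ} {δ : ℝ} {z : Ω}

/-- Each temperature step is accurate up to a phase; the phases multiply, and the errors add by
unitarity. -/
theorem exists_norm_prepare_sub_le {I : AnnealingData Ω} (hI : I.Admissible z ℓ δ) (m : ℕ) {j : ℕ}
    (hj : j < ℓ) :
    ∃ c : Circle, ‖prepare I m j (gibbsState I 0) - (c : ℂ) • gibbsState I j‖
      ≤ j * Real.sqrt (2 * (1 / 2) ^ 3 ^ m) := by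
  have : Nonempty Ω := ⟨z⟩
  induction j with
  | zero => exact ⟨1, by simp [prepare]⟩
  | succ j ih =>
    obtain ⟨c, hc⟩ := ih (Nat.lt_of_succ_lt hj)
    set U := fixedPoint (gibbsState I j) (gibbsState I (j + 1)) m with hU
    have h1 : 1 - ‖inner ℂ (gibbsState I (j + 1)) (U (gibbsState I j))‖ ^ 2 ≤ (1 / 2) ^ 3 ^ m := by
      rw [hU, one_sub_norm_inner_fixedPoint (norm_gibbsState I j) (norm_gibbsState I (j + 1))]
      have h2 := half_le_norm_inner_gibbsState_sq hI (Nat.lt_of_succ_lt hj)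
      have h3 := norm_inner_le_norm (𝕜 := ℂ) (gibbsState I (j + 1)) (gibbsState I j)
      rw [norm_gibbsState, norm_gibbsState, one_mul] at h3
      have h4 := pow_le_pow_left₀ (norm_nonneg _) h3 2
      exact pow_le_pow_left₀ (by linarith) (by linarith) _
    obtain ⟨c', hc'⟩ := exists_phase_norm_sub_sq_le
      (by rw [LinearIsometryEquiv.norm_map, norm_gibbsState]) (norm_gibbsState I (j + 1)) h1
    refine ⟨c * c', ?_⟩
    have h5 : prepare I m (j + 1) (gibbsState I 0) - ((c * c' : Circle) : ℂ) • gibbsState I (j + 1)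
        = U (prepare I m j (gibbsState I 0) - (c : ℂ) • gibbsState I j)
          + (c : ℂ) • (U (gibbsState I j) - (c' : ℂ) • gibbsState I (j + 1)) := by
      rw [map_sub, map_smul, smul_sub, smul_smul, Circle.coe_mul]
      have : prepare I m (j + 1) (gibbsState I 0) = U (prepare I m j (gibbsState I 0)) := rfl
      rw [this]
      abel
    rw [h5]
    refine (norm_add_le _ _).trans ?_
    rw [LinearIsometryEquiv.norm_map, norm_smul, Circle.norm_coe, one_mul]
    have h6 := Real.le_sqrt_of_sq_le hc'
    push_cast
    linarith

variable {X : Type*} [NormedAddCommGroup X] [InnerProductSpace ℂ X] [FiniteDimensional ℂ X]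
  {K : Type} [Fintype K] {i : ℕ} {ι : X →ₗᵢ[ℂ] EuclideanSpace ℂ (Conf Ω K)}

theorem implementable_fixedPoint {s t : AnnealingData Ω → X} {w : ℕ} {e : ℝ}
    (hs : Implementable ℓ δ z i ι (fun I => phaseShift (s I) (Circle.exp (Real.pi / 3))) w 0 e)
    (ht : Implementable ℓ δ z i ι (fun I => phaseShift (t I) (Circle.exp (Real.pi / 3))) w 0 e)
    (m : ℕ) :
    Implementable ℓ δ z i ι (fun I => fixedPoint (s I) (t I) m) ((3 ^ m - 1) * w) 0
      ((3 ^ m - 1) * e) := by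
  induction m with
  | zero =>
    exact (Implementable.free ℓ δ z i ι (LinearIsometryEquiv.refl ℂ X)).mono (by simp) le_rfl
      (by simp)
  | succ m ih =>
    -- One more level uses three copies of the previous one and two phases; `n ↦ 3n + 2` from `0`
    -- gives `3^m - 1`.
    refine (ih.trans (ht.trans (ih.symm.trans (hs.trans ih)))).mono ?_ le_rfl (le_of_eq ?_)
    · obtain ⟨n, hn⟩ : ∃ n, 3 ^ m = n + 1 :=
        ⟨3 ^ m - 1, (Nat.sub_add_cancel (Nat.one_le_pow _ _ (by norm_num))).symm⟩
      have h1 : 3 ^ (m + 1) - 1 = 3 * n + 2 := by rw [pow_succ, hn]; omega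
      rw [h1, hn, Nat.add_sub_cancel]
      exact le_of_eq (by ring)
    · rw [pow_succ]; ring

theorem implementable_prepare {w : ℕ} {e : ℝ} {ι : EuclideanSpace ℂ Ω →ₗᵢ[ℂ]
      EuclideanSpace ℂ (Conf Ω K)}
    (h : ∀ j < ℓ, Implementable ℓ δ z i ι
      (fun I => phaseShift (gibbsState I j) (Circle.exp (Real.pi / 3))) w 0 e) (m : ℕ) {j : ℕ}
    (hj : j < ℓ) :
    Implementable ℓ δ z i ι (fun I => prepare I m j) (j * ((3 ^ m - 1) * w)) 0
      (j * ((3 ^ m - 1) * e)) := by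
  induction j with
  | zero =>
    exact (Implementable.free ℓ δ z i ι (LinearIsometryEquiv.refl ℂ _)).mono (by simp) le_rfl
      (by simp)
  | succ j ih =>
    refine ((ih (Nat.lt_of_succ_lt hj)).trans (implementable_fixedPoint
      (h j (Nat.lt_of_succ_lt hj)) (h (j + 1) hj) m)).mono (le_of_eq (by ring)) le_rfl
      (le_of_eq (by push_cast; ring))

end Preparation

end QPartition

end

noncomputable section

namespace QPartition

set_option linter.unusedSectionVars false

open scoped ComplexConjugate

/-! ### Grover iterates and the Chebyshev recursion -/

section Grover

variable {Y : Type*} [NormedAddCommGroup Y] [InnerProductSpace ℂ Y] [FiniteDimensional ℂ Y]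

/-- The Grover iterate for the initial state `V s`: the reflection `F` followed by the reflection
about `V s`. -/
def grover (F V : Y ≃ₗᵢ[ℂ] Y) (s : Y) : Y ≃ₗᵢ[ℂ] Y :=
  F.trans (V.symm.trans ((phaseShift s (-1)).trans (V.trans (LinearIsometryEquiv.neg ℂ))))

theorem grover_apply (F V : Y ≃ₗᵢ[ℂ] Y) (s : Y) (y : Y) :
    grover F V s y = -V (phaseShift s (-1) (V.symm (F y))) := rfl

theorem grover_apply_eq (F V : Y ≃ₗᵢ[ℂ] Y) {s : Y} (hs : ‖s‖ = 1) (y : Y) :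
    grover F V s y = (2 * inner ℂ (V s) (F y)) • V s - F y := by
  have h1 : inner ℂ s (V.symm (F y)) = inner ℂ (V s) (F y) := by
    rw [← V.inner_map_map, LinearIsometryEquiv.apply_symm_apply]
  have h2 : ((-1 : Circle) : ℂ) = -1 := rfl
  rw [grover_apply, phaseShift_apply hs, map_add, map_smul, LinearIsometryEquiv.apply_symm_apply,
    h1, h2]
  module

/-- With `ψ = V s`, reflection about `ψ` gives `g ψ = 2⟨ψ, Fψ⟩ψ - Fψ`, while `F² = 1` gives `g⁻¹ ψ =
F ψ`. -/
theorem grover_add_symm (F V : Y ≃ₗᵢ[ℂ] Y) (hF : ∀ y, F (F y) = y) {s : Y} (hs : ‖s‖ = 1) :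
    grover F V s (V s) + (grover F V s).symm (V s) = (2 * inner ℂ (V s) (F (V s))) • V s := by
  have h1 : (grover F V s).symm (V s) = F (V s) := by
    rw [LinearIsometryEquiv.symm_apply_eq, grover_apply_eq F V hs, hF, inner_self_eq_norm_sq_to_K,
      V.norm_map, hs]
    simp only [map_one, one_pow]
    module
  rw [h1, grover_apply_eq F V hs]
  abel

theorem toEnd_pow_add_pow_pred {g : Y ≃ₗᵢ[ℂ] Y} {ψ : Y} {c : ℂ}
    (h : g ψ + g.symm ψ = (2 * c) • ψ) (k : ℕ) :
    (toEnd g ^ (k + 2)) ψ + (toEnd g ^ k) ψ = (2 * c) • (toEnd g ^ (k + 1)) ψ := by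
  rw [← map_smul, ← h, map_add, pow_succ, pow_succ, Module.End.mul_apply, Module.End.mul_apply,
    Module.End.mul_apply, Module.End.mul_apply]
  simp

end Grover

/-! ### Window function on a cycle -/

section Window

/-- A cyclic window with small increments. -/
theorem exists_window {p : ℕ} (hp : 0 < p) [NeZero (4 * p)] :
    ∃ a : Fin (4 * p) → ℝ, a 0 = 0 ∧ ∑ k, a k ^ 2 = 1 ∧
      ∀ k, (a (k + 1) - a k) ^ 2 ≤ 1 / (2 * (p : ℝ) ^ 3) := by
  -- A tent with slopes at most `1`, also across the wrap-around, normalised below. Its values are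
  -- at least `p` on the middle half of the cycle, so the squared norm is at least `2p · p²`.
  let f : ℕ → ℝ := fun k => ((min k (4 * p - k) : ℕ) : ℝ)
  have hppos : (0 : ℝ) < p := by exact_mod_cast hp
  set S := ∑ k : Fin (4 * p), f k ^ 2 with hS
  have hSge : 2 * (p : ℝ) ^ 3 ≤ S := by
    rw [hS, Fin.sum_univ_eq_sum_range (fun k => f k ^ 2)]
    have h1 : Finset.Ico p (3 * p) ⊆ Finset.range (4 * p) := by
      intro k hk
      rw [Finset.mem_Ico] at hk
      rw [Finset.mem_range]
      omega
    refine le_trans ?_ (Finset.sum_le_sum_of_subset_of_nonneg h1 fun k _ _ => sq_nonneg _)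
    have h2 : ∀ k ∈ Finset.Ico p (3 * p), (p : ℝ) ^ 2 ≤ f k ^ 2 := by
      intro k hk
      rw [Finset.mem_Ico] at hk
      refine pow_le_pow_left₀ hppos.le ?_ 2
      exact Nat.cast_le.2 (by omega)
    refine le_trans (le_of_eq ?_) (Finset.card_nsmul_le_sum _ _ _ h2)
    rw [Nat.card_Ico, nsmul_eq_mul]
    have : 3 * p - p = 2 * p := by omega
    rw [this]
    push_cast
    ring
  have hSpos : 0 < S := lt_of_lt_of_le (by positivity) hSge
  refine ⟨fun k => f k / Real.sqrt S, by simp [f], ?_, ?_⟩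
  · simp only [div_pow, Real.sq_sqrt hSpos.le]
    rw [← Finset.sum_div, div_self hSpos.ne']
  · intro k
    have h1 : |f ((k + 1 : Fin (4 * p)) : ℕ) - f k| ≤ 1 := by
      have hval : ((k + 1 : Fin (4 * p)) : ℕ) = if (k : ℕ) + 1 = 4 * p then 0 else (k : ℕ) + 1 := by
        have hk := k.2
        rw [Fin.val_add, Fin.val_one']
        split_ifs with h
        · rw [Nat.add_mod_mod, h, Nat.mod_self]
        · rw [Nat.add_mod_mod, Nat.mod_eq_of_lt (by omega)]
      rw [hval]
      have hk := k.2
      have hclose : ∀ x y : ℕ, x ≤ y + 1 → y ≤ x + 1 → |(x : ℝ) - y| ≤ 1 := by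
        intro x y h1 h2
        have h3 : (x : ℝ) ≤ y + 1 := by exact_mod_cast h1
        have h4 : (y : ℝ) ≤ x + 1 := by exact_mod_cast h2
        rw [abs_le]
        constructor <;> linarith
      split_ifs with h <;> exact hclose _ _ (by omega) (by omega)
    rw [← sub_div, div_pow, Real.sq_sqrt hSpos.le]
    have h2 : (f ((k + 1 : Fin (4 * p)) : ℕ) - f k) ^ 2 ≤ 1 := by
      rw [← sq_abs]
      exact pow_le_one₀ (abs_nonneg _) h1
    exact div_le_div₀ zero_le_one h2 (by positivity) hSge

end Window

/-! ### Spectral measurement of the shift cosine -/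

section CyclicShift

variable {n : ℕ} [NeZero n]

/-- The cyclic shift. -/
def cyclicShift (n : ℕ) [NeZero n] : EuclideanSpace ℂ (Fin n) ≃ₗᵢ[ℂ] EuclideanSpace ℂ (Fin n) :=
  LinearIsometryEquiv.piLpCongrLeft 2 ℂ ℂ (Equiv.addRight (1 : Fin n))

theorem cyclicShift_apply (v : EuclideanSpace ℂ (Fin n)) (k : Fin n) :
    cyclicShift n v k = v (k - 1) := by
  rw [sub_eq_add_neg]; rfl

theorem cyclicShift_symm_apply (v : EuclideanSpace ℂ (Fin n)) (k : Fin n) :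
    (cyclicShift n).symm v k = v (k + 1) := by
  have h := cyclicShift_apply ((cyclicShift n).symm v) (k + 1)
  rw [LinearIsometryEquiv.apply_symm_apply, add_sub_cancel_right] at h
  exact h.symm

/-- The self-adjoint part of the cyclic shift. -/
def shiftCos (n : ℕ) [NeZero n] : EuclideanSpace ℂ (Fin n) →ₗ[ℂ] EuclideanSpace ℂ (Fin n) :=
  (1 / 2 : ℂ) • (toEnd (cyclicShift n) + toEnd (cyclicShift n).symm)

theorem shiftCos_apply (v : EuclideanSpace ℂ (Fin n)) (k : Fin n) :
    shiftCos n v k = 1 / 2 * (v (k - 1) + v (k + 1)) := by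
  simp [shiftCos, cyclicShift_apply, cyclicShift_symm_apply, mul_add]

theorem shiftCos_isSymmetric (n : ℕ) [NeZero n] : (shiftCos n).IsSymmetric := by
  intro v w
  have h1 : inner ℂ (cyclicShift n v) w = inner ℂ v ((cyclicShift n).symm w) := by
    rw [← (cyclicShift n).symm.inner_map_map, LinearIsometryEquiv.symm_apply_apply]
  have h2 : inner ℂ ((cyclicShift n).symm v) w = inner ℂ v (cyclicShift n w) := by
    rw [← (cyclicShift n).inner_map_map, LinearIsometryEquiv.apply_symm_apply]
  simp only [shiftCos, LinearMap.smul_apply, LinearMap.add_apply, toEnd_apply, inner_smul_left,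
    inner_smul_right, inner_add_left, inner_add_right, h1, h2]
  have h3 : conj (1 / 2 : ℂ) = 1 / 2 := by
    rw [map_div₀, map_one, Complex.conj_ofNat]
  rw [h3, add_comm]

/-- The eigenvalues of `shiftCos`. -/
def shiftEigenvalue (n : ℕ) [NeZero n] : Fin n → ℝ :=
  (shiftCos_isSymmetric n).eigenvalues finrank_euclideanSpace_fin

/-- Coordinates in an eigenbasis of `shiftCos`. -/
def shiftBasis (n : ℕ) [NeZero n] : EuclideanSpace ℂ (Fin n) ≃ₗᵢ[ℂ] EuclideanSpace ℂ (Fin n) :=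
  ((shiftCos_isSymmetric n).eigenvectorBasis finrank_euclideanSpace_fin).repr

/-- In an eigenbasis, the second moment of the measured eigenvalue about `c` is the squared residual
of `v` as an eigenvector for `c`. -/
theorem sum_shiftEigenvalue_sub_sq (v : EuclideanSpace ℂ (Fin n)) (c : ℝ) :
    ∑ k, (shiftEigenvalue n k - c) ^ 2 * ‖shiftBasis n v k‖ ^ 2
      = ‖shiftCos n v - (c : ℂ) • v‖ ^ 2 := by
  rw [← (shiftBasis n).norm_map (shiftCos n v - (c : ℂ) • v), EuclideanSpace.norm_sq_eq]
  refine Finset.sum_congr rfl fun k _ => ?_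
  have h : shiftBasis n (shiftCos n v) k = (shiftEigenvalue n k : ℂ) * shiftBasis n v k :=
    (shiftCos_isSymmetric n).eigenvectorBasis_apply_self_apply finrank_euclideanSpace_fin v k
  rw [map_sub, map_smul, PiLp.sub_apply, PiLp.smul_apply, h, smul_eq_mul, ← sub_mul, norm_mul,
    mul_pow, ← Complex.ofReal_sub, Complex.norm_real, Real.norm_eq_abs, sq_abs]

variable {Y : Type*} [NormedAddCommGroup Y] [InnerProductSpace ℂ Y] [FiniteDimensional ℂ Y]

/-- The vector `k ↦ a_k g^k ψ` is almost an eigenvector of the cyclic shift cosine. -/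
theorem sum_norm_shift_sub_sq_le {g : Y ≃ₗᵢ[ℂ] Y} {ψ : Y} (hψ : ‖ψ‖ = 1) {c : ℂ}
    (h : g ψ + g.symm ψ = (2 * c) • ψ) {a : Fin n → ℝ} (ha0 : a 0 = 0) {A : ℝ}
    (ha : ∀ k, (a (k + 1) - a k) ^ 2 ≤ A) :
    ∑ k : Fin n, ‖(1 / 2 : ℂ) • ((a (k - 1) : ℂ) • (toEnd g ^ ((k - 1 : Fin n) : ℕ)) ψ
        + (a (k + 1) : ℂ) • (toEnd g ^ ((k + 1 : Fin n) : ℕ)) ψ)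
        - c • (a k : ℂ) • (toEnd g ^ (k : ℕ)) ψ‖ ^ 2 ≤ n * A := by
  -- The successor either increases the index by one or wraps to `0`, where the window vanishes; in
  -- both cases the defect is the window increment.
  have hval : ∀ k : Fin n, ((k + 1 : Fin n) : ℕ) = (k : ℕ) + 1 ∨ (k + 1 : Fin n) = 0 := by
    intro k
    have hk := k.2
    by_cases h : (k : ℕ) + 1 = n
    · right
      ext
      rw [Fin.val_add, Fin.val_one', Nat.add_mod_mod, h, Nat.mod_self]; rfl
    · left
      rw [Fin.val_add, Fin.val_one', Nat.add_mod_mod, Nat.mod_eq_of_lt (by omega)]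
  have hup : ∀ k : Fin n, ‖(a (k + 1) : ℂ) • (toEnd g ^ ((k + 1 : Fin n) : ℕ)) ψ
      - (a k : ℂ) • (toEnd g ^ ((k : ℕ) + 1)) ψ‖ ^ 2 ≤ A := by
    intro k
    refine le_trans (le_of_eq ?_) (ha k)
    rcases hval k with h1 | h1
    · rw [h1, ← sub_smul, norm_smul, norm_toEnd_pow, hψ, mul_one, ← Complex.ofReal_sub,
        Complex.norm_real, Real.norm_eq_abs, sq_abs]
    · rw [h1, ha0]
      simp [norm_smul, norm_toEnd_pow, hψ]
  have hdown : ∀ k : Fin n, ‖(a (k - 1) : ℂ) • (toEnd g ^ ((k - 1 : Fin n) : ℕ)) ψ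
      - (a k : ℂ) • (toEnd g ^ ((k : ℕ) - 1)) ψ‖ ^ 2 ≤ A := by
    intro k
    have h0 := ha (k - 1)
    rw [sub_add_cancel] at h0
    refine le_trans (le_of_eq ?_) h0
    rcases hval (k - 1) with h1 | h1
    · rw [sub_add_cancel] at h1
      have h2 : (k : ℕ) - 1 = ((k - 1 : Fin n) : ℕ) := by omega
      rw [h2, ← sub_smul, norm_smul, norm_toEnd_pow, hψ, mul_one, ← Complex.ofReal_sub,
        Complex.norm_real, Real.norm_eq_abs, sq_abs]
      ring
    · rw [sub_add_cancel] at h1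
      rw [h1, ha0]
      simp [norm_smul, norm_toEnd_pow, hψ]
  have hterm : ∀ k : Fin n, ‖(1 / 2 : ℂ) • ((a (k - 1) : ℂ) • (toEnd g ^ ((k - 1 : Fin n) : ℕ)) ψ
        + (a (k + 1) : ℂ) • (toEnd g ^ ((k + 1 : Fin n) : ℕ)) ψ)
        - c • (a k : ℂ) • (toEnd g ^ (k : ℕ)) ψ‖ ^ 2 ≤ A := by
    intro k
    set u := (a (k + 1) : ℂ) • (toEnd g ^ ((k + 1 : Fin n) : ℕ)) ψ
      - (a k : ℂ) • (toEnd g ^ ((k : ℕ) + 1)) ψ with hu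
    set w := (a (k - 1) : ℂ) • (toEnd g ^ ((k - 1 : Fin n) : ℕ)) ψ
      - (a k : ℂ) • (toEnd g ^ ((k : ℕ) - 1)) ψ with hw
    -- At `k = 0` the truncated `k - 1` is `0`, which is harmless because `a 0 = 0`.
    have hc : c • (a k : ℂ) • (toEnd g ^ (k : ℕ)) ψ = (1 / 2 : ℂ) •
        ((a k : ℂ) • (toEnd g ^ ((k : ℕ) - 1)) ψ + (a k : ℂ) • (toEnd g ^ ((k : ℕ) + 1)) ψ) := by
      rcases Nat.eq_zero_or_pos (k : ℕ) with hk | hk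
      · have : k = 0 := Fin.ext hk
        rw [this, ha0]; simp
      · obtain ⟨l, hl⟩ : ∃ l, (k : ℕ) = l + 1 := ⟨(k : ℕ) - 1, by omega⟩
        have h3 := toEnd_pow_add_pow_pred h l
        rw [hl, Nat.add_sub_cancel, ← smul_add, add_comm ((toEnd g ^ l) ψ), h3]
        module
    have h4 : (1 / 2 : ℂ) • ((a (k - 1) : ℂ) • (toEnd g ^ ((k - 1 : Fin n) : ℕ)) ψ
        + (a (k + 1) : ℂ) • (toEnd g ^ ((k + 1 : Fin n) : ℕ)) ψ)
        - c • (a k : ℂ) • (toEnd g ^ (k : ℕ)) ψ = (1 / 2 : ℂ) • (w + u) := by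
      rw [hc, hu, hw]; module
    rw [h4, norm_smul, mul_pow]
    have h5 := hup k
    have h6 := hdown k
    rw [← hu] at h5
    rw [← hw] at h6
    have h7 : ‖w + u‖ ^ 2 ≤ (‖w‖ + ‖u‖) ^ 2 := pow_le_pow_left₀ (norm_nonneg _) (norm_add_le _ _) 2
    have h8 : ‖(1 / 2 : ℂ)‖ ^ 2 = 1 / 4 := by norm_num
    rw [h8]
    nlinarith [sq_nonneg (‖w‖ - ‖u‖)]
  calc _ ≤ ∑ _k : Fin n, A := Finset.sum_le_sum fun k _ => hterm k
    _ = n * A := by simp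

end CyclicShift

end QPartition

end

noncomputable section

namespace QPartition

set_option linter.unusedSectionVars false

open scoped ComplexConjugate

/-! ### Estimating the ratio from controlled Grover iterates -/

section Estimation

variable {Ω : Type*} [Fintype Ω] {n d : ℕ}

/-- Separates the memory bit. -/
def bitEquiv (Ω : Type*) (n : ℕ) : Ω × (Fin 2 × Fin n) ≃ (Ω × Fin n) × Fin 2 where
  toFun c := ((c.1, c.2.2), c.2.1)
  invFun x := (x.1.1, (x.2, x.1.2))
  left_inv _ := rfl
  right_inv _ := rfl

/-- Separates the index register. -/
def indexEquiv (Ω : Type*) (n : ℕ) : Ω × (Fin 2 × Fin n) ≃ Fin n × (Ω × Fin 2) where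
  toFun c := (c.2.2, (c.1, c.2.1))
  invFun x := (x.2.1, (x.2.2, x.1))
  left_inv _ := rfl
  right_inv _ := rfl

/-- The rotation `V_i`, acting on the memory bit. -/
def memoryRot (I : AnnealingData Ω) (i n : ℕ) :
    EuclideanSpace ℂ (Ω × (Fin 2 × Fin n)) ≃ₗᵢ[ℂ] EuclideanSpace ℂ (Ω × (Fin 2 × Fin n)) :=
  blockIso (bitEquiv Ω n) fun x => rotIso (I.yval i x.1)

/-- The rotation `V_i` on a single copy of the memory bit. -/
def bitRot (I : AnnealingData Ω) (i : ℕ) :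
    EuclideanSpace ℂ (Ω × Fin 2) ≃ₗᵢ[ℂ] EuclideanSpace ℂ (Ω × Fin 2) :=
  blockIso (Equiv.refl (Ω × Fin 2)) fun x => rotIso (I.yval i x)

theorem slice_memoryRot (I : AnnealingData Ω) (i : ℕ) (k : Fin n)
    (Ψ : EuclideanSpace ℂ (Ω × (Fin 2 × Fin n))) :
    slice (indexEquiv Ω n) k (memoryRot I i n Ψ)
      = bitRot I i (slice (indexEquiv Ω n) k Ψ) := by
  ext ⟨x, b⟩
  rfl

theorem slice_memoryRot_symm (I : AnnealingData Ω) (i : ℕ) (k : Fin n)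
    (Ψ : EuclideanSpace ℂ (Ω × (Fin 2 × Fin n))) :
    slice (indexEquiv Ω n) k ((memoryRot I i n).symm Ψ)
      = (bitRot I i).symm (slice (indexEquiv Ω n) k Ψ) := by
  rw [LinearIsometryEquiv.eq_symm_apply, ← slice_memoryRot,
    LinearIsometryEquiv.apply_symm_apply]

/-- The phase `-1` on the bit `0` for the indices larger than `t`. -/
def markPhase (n t : ℕ) : Fin 2 × Fin n → Circle :=
  fun m => if m.1 = 0 ∧ t < (m.2 : ℕ) then -1 else 1

/-- The phase `-1` for the indices larger than `t`. -/
def indexPhase (n t : ℕ) : Fin 2 × Fin n → Circle :=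
  fun m => if t < (m.2 : ℕ) then -1 else 1

/-- One Grover iteration, controlled on the index register. -/
def groverRound (I : AnnealingData Ω) (i n t : ℕ) :
    EuclideanSpace ℂ (Ω × (Fin 2 × Fin n)) ≃ₗᵢ[ℂ] EuclideanSpace ℂ (Ω × (Fin 2 × Fin n)) :=
  (diagIso fun c => markPhase n t c.2).trans ((memoryRot I i n).symm.trans
    ((gibbsPhase I i (markPhase n t)).trans ((memoryRot I i n).trans
      (diagIso fun c => indexPhase n t c.2))))

/-- The reflection that marks the bit `0`. -/
def markBit (Ω : Type*) [Fintype Ω] :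
    EuclideanSpace ℂ (Ω × Fin 2) ≃ₗᵢ[ℂ] EuclideanSpace ℂ (Ω × Fin 2) :=
  diagIso fun c => if c.2 = 0 then -1 else 1

/-- The Gibbs state with the bit `0`. -/
def gibbsBit (I : AnnealingData Ω) (i : ℕ) : EuclideanSpace ℂ (Ω × Fin 2) :=
  WithLp.toLp 2 fun c => if c.2 = 0 then gibbsState I i c.1 else 0

theorem norm_gibbsBit [Nonempty Ω] (I : AnnealingData Ω) (i : ℕ) : ‖gibbsBit I i‖ = 1 := by
  rw [← norm_gibbsState I i, ← sq_eq_sq₀ (norm_nonneg _) (norm_nonneg _), EuclideanSpace.norm_sq_eq,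
    EuclideanSpace.norm_sq_eq, Fintype.sum_prod_type]
  simp [gibbsBit]

/-- A phase that depends on the memory and is `-1` only on bit `0` is, within one index block, the
reflection negating `s_i ⊗ |0⟩`. -/
theorem slice_gibbsPhase_markPhase [Nonempty Ω] (I : AnnealingData Ω) (i t : ℕ) (k : Fin n)
    (Ψ : EuclideanSpace ℂ (Ω × (Fin 2 × Fin n))) :
    slice (indexEquiv Ω n) k (gibbsPhase I i (markPhase n t) Ψ)
      = if t < (k : ℕ) then phaseShift (gibbsBit I i) (-1) (slice (indexEquiv Ω n) k Ψ)
        else slice (indexEquiv Ω n) k Ψ := by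
  ext ⟨x, b⟩
  have hl : slice (indexEquiv Ω n) k (gibbsPhase I i (markPhase n t) Ψ) (x, b)
      = phaseShift (gibbsState I i) (markPhase n t (b, k))
        (slice (Equiv.prodComm Ω (Fin 2 × Fin n)) (b, k) Ψ) x := rfl
  rw [hl, phaseShift_apply (norm_gibbsState I i), phaseShift_apply (norm_gibbsBit I i)]
  by_cases ht : t < (k : ℕ)
  · have hin : inner ℂ (gibbsBit I i) (slice (indexEquiv Ω n) k Ψ)
        = inner ℂ (gibbsState I i) (slice (Equiv.prodComm Ω (Fin 2 × Fin n)) (0, k) Ψ) := by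
      simp [PiLp.inner_apply, Fintype.sum_prod_type, gibbsBit, indexEquiv]
    rw [hin]
    fin_cases b
    · simp [ht, markPhase, gibbsBit, indexEquiv]
    · simp [ht, markPhase, gibbsBit, indexEquiv]
  · simp [ht, markPhase, indexEquiv]

/-- Only the phases are controlled on the index. Where they are trivial the rotation and its inverse
cancel, so no controlled rotation is needed. -/
theorem slice_groverRound [Nonempty Ω] (I : AnnealingData Ω) (i t : ℕ) (k : Fin n)
    (Ψ : EuclideanSpace ℂ (Ω × (Fin 2 × Fin n))) :
    slice (indexEquiv Ω n) k (groverRound I i n t Ψ)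
      = if t < (k : ℕ) then grover (markBit Ω) (bitRot I i) (gibbsBit I i)
          (slice (indexEquiv Ω n) k Ψ)
        else slice (indexEquiv Ω n) k Ψ := by
  have h1 : ∀ Φ : EuclideanSpace ℂ (Ω × (Fin 2 × Fin n)), slice (indexEquiv Ω n) k
      (diagIso (fun c => markPhase n t c.2) Φ)
      = if t < (k : ℕ) then markBit Ω (slice (indexEquiv Ω n) k Φ)
        else slice (indexEquiv Ω n) k Φ := by
    intro Φ
    ext ⟨x, b⟩
    by_cases ht : t < (k : ℕ) <;> by_cases hb : b = 0 <;>
      simp [ht, hb, markPhase, markBit, indexEquiv]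
  have h2 : ∀ Φ : EuclideanSpace ℂ (Ω × (Fin 2 × Fin n)), slice (indexEquiv Ω n) k
      (diagIso (fun c => indexPhase n t c.2) Φ)
      = if t < (k : ℕ) then -(slice (indexEquiv Ω n) k Φ) else slice (indexEquiv Ω n) k Φ := by
    intro Φ
    ext ⟨x, b⟩
    by_cases ht : t < (k : ℕ) <;> simp [ht, indexPhase, indexEquiv]
  simp only [groverRound, LinearIsometryEquiv.trans_apply]
  rw [h2, slice_memoryRot, slice_gibbsPhase_markPhase, slice_memoryRot_symm, h1]
  by_cases ht : t < (k : ℕ)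
  · simp only [ht, if_true, grover_apply]
  · simp only [ht, if_false, LinearIsometryEquiv.apply_symm_apply]

/-- Successive controlled Grover iterations. -/
def groverRounds (I : AnnealingData Ω) (i n : ℕ) :
    ℕ → (EuclideanSpace ℂ (Ω × (Fin 2 × Fin n)) ≃ₗᵢ[ℂ] EuclideanSpace ℂ (Ω × (Fin 2 × Fin n)))
  | 0 => LinearIsometryEquiv.refl ℂ _
  | t + 1 => (groverRounds I i n t).trans (groverRound I i n t)

theorem slice_groverRounds [Nonempty Ω] (I : AnnealingData Ω) (i t : ℕ) (k : Fin n)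
    (Ψ : EuclideanSpace ℂ (Ω × (Fin 2 × Fin n))) :
    slice (indexEquiv Ω n) k (groverRounds I i n t Ψ)
      = (toEnd (grover (markBit Ω) (bitRot I i) (gibbsBit I i)) ^ min (k : ℕ) t)
          (slice (indexEquiv Ω n) k Ψ) := by
  induction t with
  | zero => simp [groverRounds]
  | succ t ih =>
    rw [groverRounds, LinearIsometryEquiv.trans_apply, slice_groverRound, ih]
    split_ifs with h
    · have e1 : min (k : ℕ) (t + 1) = t + 1 := by omega
      have e2 : min (k : ℕ) t = t := by omega
      rw [e1, e2, pow_succ', Module.End.mul_apply, toEnd_apply]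
    · have e1 : min (k : ℕ) (t + 1) = min (k : ℕ) t := by omega
      rw [e1]

/-- The memory state with bit `0` and index amplitudes `a`. -/
def windowState (a : Fin n → ℝ) : EuclideanSpace ℂ (Fin 2 × Fin n) :=
  WithLp.toLp 2 fun m => if m.1 = 0 then (a m.2 : ℂ) else 0

theorem norm_windowState {a : Fin n → ℝ} (ha : ∑ k, a k ^ 2 = 1) : ‖windowState a‖ = 1 := by
  rw [← sq_eq_sq₀ (norm_nonneg _) zero_le_one, EuclideanSpace.norm_sq_eq, Fintype.sum_prod_type]
  simp [windowState, ha]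

theorem slice_withMemory_windowState (I : AnnealingData Ω) (i : ℕ) {a : Fin n → ℝ}
    (ha : ‖windowState a‖ = 1) (k : Fin n) :
    slice (indexEquiv Ω n) k (withMemory Ω (windowState a) ha (gibbsState I i))
      = (a k : ℂ) • gibbsBit I i := by
  ext ⟨x, b⟩
  by_cases hb : b = 0 <;> simp [hb, indexEquiv, windowState, gibbsBit, mul_comm]

/-- Bit `0` has weight `∑ π_i y_i`, and `e^{-β_i E} y_i = e^{-β_{i+1} E}` turns this sum into
`Z_{i+1} / Z_i`. -/
theorem inner_markBit [DecidableEq Ω] {I : AnnealingData Ω} {z : Ω} {ℓ i : ℕ} {δ : ℝ}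
    (hI : I.Admissible z ℓ δ) (hi : i < ℓ) :
    inner ℂ (bitRot I i (gibbsBit I i)) (markBit Ω (bitRot I i (gibbsBit I i)))
      = ((1 - 2 * I.ratio i : ℝ) : ℂ) := by
  have : Nonempty Ω := ⟨z⟩
  set p := boltzmann I.energy (I.beta i) with hp
  have hp0 : ∀ x, 0 < p x := boltzmann_pos _ _
  have h0 : ∀ x, bitRot I i (gibbsBit I i) (x, 0)
      = ((Real.sqrt (I.yval i x) * Real.sqrt (p x) : ℝ) : ℂ) := by
    intro x
    have hx := hI.yval_mem hi x
    have : bitRot I i (gibbsBit I i) (x, 0)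
      = rotIso (I.yval i x) (slice (Equiv.refl (Ω × Fin 2)) x (gibbsBit I i)) 0 := rfl
    rw [this, rotIso_apply hx.1 hx.2]
    simp [rotMatrix, gibbsBit, gibbsState, ← hp]
  have h1 : ∀ x, bitRot I i (gibbsBit I i) (x, 1)
      = ((-Real.sqrt (1 - I.yval i x) * Real.sqrt (p x) : ℝ) : ℂ) := by
    intro x
    have hx := hI.yval_mem hi x
    have : bitRot I i (gibbsBit I i) (x, 1)
      = rotIso (I.yval i x) (slice (Equiv.refl (Ω × Fin 2)) x (gibbsBit I i)) 1 := rfl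
    rw [this, rotIso_apply hx.1 hx.2]
    simp [rotMatrix, gibbsBit, gibbsState, ← hp]
  have hsum : ∑ x, p x * I.yval i x = I.ratio i := by
    rw [AnnealingData.ratio, partitionFn, Finset.sum_div]
    refine Finset.sum_congr rfl fun x _ => ?_
    rw [hp, boltzmann, AnnealingData.yval, div_mul_eq_mul_div, ← Real.exp_add]
    congr 2
    ring
  have hterm : ∀ x, inner ℂ (bitRot I i (gibbsBit I i) (x, 0))
        (markBit Ω (bitRot I i (gibbsBit I i)) (x, 0))
      + inner ℂ (bitRot I i (gibbsBit I i) (x, 1)) (markBit Ω (bitRot I i (gibbsBit I i)) (x, 1))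
      = ((p x - 2 * (p x * I.yval i x) : ℝ) : ℂ) := by
    intro x
    have hx := hI.yval_mem hi x
    simp only [markBit, diagIso_apply, h0, h1]
    have e1 : Real.sqrt (I.yval i x) ^ 2 = I.yval i x := Real.sq_sqrt hx.1
    have e2 : Real.sqrt (1 - I.yval i x) ^ 2 = 1 - I.yval i x := Real.sq_sqrt (by linarith [hx.2])
    have e3 : Real.sqrt (p x) ^ 2 = p x := Real.sq_sqrt (hp0 x).le
    have e4 : p x - 2 * (p x * I.yval i x) = -(Real.sqrt (I.yval i x) * Real.sqrt (p x)) ^ 2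
        + (-Real.sqrt (1 - I.yval i x) * Real.sqrt (p x)) ^ 2 := by
      rw [mul_pow, mul_pow, neg_sq, e1, e2, e3]; ring
    rw [e4]
    simp only [RCLike.inner_apply, Complex.conj_ofReal]
    simp
    ring
  rw [PiLp.inner_apply, Fintype.sum_prod_type]
  simp only [Fin.sum_univ_two, hterm]
  rw [← Complex.ofReal_sum, Finset.sum_sub_distrib, ← Finset.mul_sum, hsum, sum_boltzmann]

/-- Isolates the index register as the inner index. -/
def readEquiv (Ω : Type*) (n : ℕ) : Ω × (Fin 2 × Fin n) ≃ (Ω × Fin 2) × Fin n where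
  toFun c := ((c.1, c.2.1), c.2.2)
  invFun x := (x.1.1, (x.1.2, x.2))
  left_inv _ := rfl
  right_inv _ := rfl

/-- Change of basis of the index register to an eigenbasis of the shift cosine. -/
def readIndex (Ω : Type*) [Fintype Ω] (n : ℕ) [NeZero n] :
    EuclideanSpace ℂ (Ω × (Fin 2 × Fin n)) ≃ₗᵢ[ℂ] EuclideanSpace ℂ (Ω × (Fin 2 × Fin n)) :=
  blockIso (readEquiv Ω n) fun _ => shiftBasis n

/-- The estimation phase: rotation, controlled Grover iterations, and change of basis. -/
def estimate (I : AnnealingData Ω) (i n : ℕ) [NeZero n] :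
    EuclideanSpace ℂ (Ω × (Fin 2 × Fin n)) ≃ₗᵢ[ℂ] EuclideanSpace ℂ (Ω × (Fin 2 × Fin n)) :=
  (memoryRot I i n).trans ((groverRounds I i n n).trans (readIndex Ω n))

theorem sum_readIndex [NeZero n] (c : ℝ) (Ψ : EuclideanSpace ℂ (Ω × (Fin 2 × Fin n))) :
    ∑ q : Ω × (Fin 2 × Fin n), (shiftEigenvalue n q.2.2 - c) ^ 2 * ‖readIndex Ω n Ψ q‖ ^ 2
      = ∑ k : Fin n, ‖(1 / 2 : ℂ) • (slice (indexEquiv Ω n) (k - 1) Ψ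
          + slice (indexEquiv Ω n) (k + 1) Ψ) - (c : ℂ) • slice (indexEquiv Ω n) k Ψ‖ ^ 2 := by
  rw [← Equiv.sum_comp (readEquiv Ω n).symm, Fintype.sum_prod_type]
  have h1 : ∀ y : Ω × Fin 2, ∑ k : Fin n,
      (shiftEigenvalue n ((readEquiv Ω n).symm (y, k)).2.2 - c) ^ 2
        * ‖readIndex Ω n Ψ ((readEquiv Ω n).symm (y, k))‖ ^ 2
      = ∑ k : Fin n, ‖(shiftCos n (slice (readEquiv Ω n) y Ψ)
          - (c : ℂ) • slice (readEquiv Ω n) y Ψ) k‖ ^ 2 := by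
    intro y
    rw [← EuclideanSpace.norm_sq_eq, ← sum_shiftEigenvalue_sub_sq]
    rfl
  simp only [h1]
  rw [Finset.sum_comm]
  refine Finset.sum_congr rfl fun k _ => ?_
  rw [EuclideanSpace.norm_sq_eq]
  refine Finset.sum_congr rfl fun y _ => ?_
  rw [PiLp.sub_apply, PiLp.smul_apply, shiftCos_apply]
  rfl

/-- The index block `k` of the state is `a_k g^k ψ`, so the Chebyshev recursion and the small window
increments bound the residual. -/
theorem sum_estimate_le [DecidableEq Ω] [NeZero n] {I : AnnealingData Ω} {z : Ω} {ℓ i : ℕ} {δ : ℝ}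
    (hI : I.Admissible z ℓ δ) (hi : i < ℓ) {a : Fin n → ℝ} (ha0 : a 0 = 0)
    (ha1 : ‖windowState a‖ = 1) {A : ℝ} (ha : ∀ k, (a (k + 1) - a k) ^ 2 ≤ A) :
    ∑ q : Ω × (Fin 2 × Fin n), (shiftEigenvalue n q.2.2 - (1 - 2 * I.ratio i)) ^ 2
      * ‖estimate I i n (withMemory Ω (windowState a) ha1 (gibbsState I i)) q‖ ^ 2 ≤ n * A := by
  have : Nonempty Ω := ⟨z⟩
  simp only [estimate, LinearIsometryEquiv.trans_apply]
  rw [sum_readIndex]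
  set ψ := bitRot I i (gibbsBit I i) with hψ
  set g := grover (markBit Ω) (bitRot I i) (gibbsBit I i) with hg
  have hslice : ∀ k : Fin n, slice (indexEquiv Ω n) k (groverRounds I i n n (memoryRot I i n
      (withMemory Ω (windowState a) ha1 (gibbsState I i)))) = (a k : ℂ) • (toEnd g ^ (k : ℕ)) ψ := by
    intro k
    rw [slice_groverRounds, slice_memoryRot, slice_withMemory_windowState, map_smul, map_smul,
      min_eq_left k.2.le]
  simp only [hslice]
  have hF : ∀ y, markBit Ω (markBit Ω y) = y := by
    intro y
    ext c
    by_cases hc : c.2 = 0 <;> simp [markBit, hc]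
  have hgr := grover_add_symm (markBit Ω) (bitRot I i) hF (norm_gibbsBit I i)
  rw [inner_markBit hI hi] at hgr
  exact sum_norm_shift_sub_sq_le
    (by rw [LinearIsometryEquiv.norm_map, norm_gibbsBit]) hgr ha0 ha

variable [DecidableEq Ω] {ℓ i : ℕ} {δ : ℝ} {z : Ω}

/-- Exchanges the qubit and the memory bit. -/
def exchangeEquiv (Ω : Type*) (n d : ℕ) :
    Conf Ω ((Fin 2 × Fin n) × Fin (d + 1)) ≃ Conf Ω ((Fin 2 × Fin n) × Fin (d + 1)) :=
  Function.Involutive.toPerm (fun c => (c.1, (c.2.2.1.1, ((c.2.1, c.2.2.1.2), c.2.2.2))))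
    fun _ => rfl

/-- The gate acts on the qubit, which is reserved as the control of the walks; exchanging it with
the memory bit before and after redirects the rotation. -/
theorem implementable_memoryRot (χ : EuclideanSpace ℂ (Fin (d + 1))) (hχ : ‖χ‖ = 1) :
    Implementable ℓ δ z i (logical z (Fin 2 × Fin n) χ hχ) (fun I => memoryRot I i n) 0 1 0 := by
  set X : EuclideanSpace ℂ (Conf Ω ((Fin 2 × Fin n) × Fin (d + 1))) ≃ₗᵢ[ℂ] _ :=
    LinearIsometryEquiv.piLpCongrLeft 2 ℂ ℂ (exchangeEquiv Ω n d)
  refine ⟨[Gate.free X, Gate.rot, Gate.free X], by simp [walkTotal, Gate.walkCost],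
    by simp [rotTotal, Gate.rotCost], fun I hI v => ?_⟩
  rw [zero_mul]
  refine le_of_eq (norm_eq_zero.2 (sub_eq_zero.2 ?_))
  ext ⟨⟨x, y⟩, b', ⟨b, k⟩, κ⟩
  have hl : run I z i [(Gate.free X : Gate Ω ((Fin 2 × Fin n) × Fin (d + 1)) ℓ), Gate.rot,
      Gate.free X] (logical z (Fin 2 × Fin n) χ hχ v) ((x, y), (b', ((b, k), κ)))
      = rotIso (I.yval i x) (WithLp.toLp 2 fun b'' =>
          logical z (Fin 2 × Fin n) χ hχ v ((x, y), (b', ((b'', k), κ)))) b := rfl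
  rw [hl]
  by_cases hb : b' = 0 ∧ y = z
  · obtain ⟨rfl, rfl⟩ := hb
    have h1 : (WithLp.toLp 2 fun b'' =>
        logical y (Fin 2 × Fin n) χ hχ v ((x, y), (0, ((b'', k), κ))) : EuclideanSpace ℂ (Fin 2))
        = χ κ • slice (bitEquiv Ω n) (x, k) v := by
      ext b''
      simp [logical_eq, qubitZero, bitEquiv]
    rw [h1, map_smul]
    simp [logical_eq, qubitZero, memoryRot, blockIso_apply, bitEquiv]
  · have h1 : (WithLp.toLp 2 fun b'' =>
        logical z (Fin 2 × Fin n) χ hχ v ((x, y), (b', ((b'', k), κ))) : EuclideanSpace ℂ (Fin 2))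
        = 0 := by
      ext b''
      rcases not_and_or.1 hb with h | h <;> simp [logical_eq, qubitZero, h]
    rw [h1, map_zero]
    rcases not_and_or.1 hb with h | h <;> simp [logical_eq, qubitZero, h]

theorem implementable_groverRound {χ : EuclideanSpace ℂ (Fin (d + 1))} {hχ : ‖χ‖ = 1} {w : ℕ}
    {e : ℝ}
    (h : ∀ φ : Fin 2 × Fin n → Circle, Implementable ℓ δ z i (logical z (Fin 2 × Fin n) χ hχ)
      (fun I => gibbsPhase I i φ) w 0 e) (t : ℕ) :
    Implementable ℓ δ z i (logical z (Fin 2 × Fin n) χ hχ) (fun I => groverRound I i n t) w 2 e := by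
  have hV := implementable_memoryRot (Ω := Ω) (n := n) (ℓ := ℓ) (i := i) (δ := δ) (z := z) χ hχ
  have h1 := Implementable.free ℓ δ z i (logical z (Fin 2 × Fin n) χ hχ)
    (diagIso fun c => markPhase n t c.2)
  have h2 := Implementable.free ℓ δ z i (logical z (Fin 2 × Fin n) χ hχ)
    (diagIso fun c => indexPhase n t c.2)
  have h3 := h1.trans (hV.symm.trans ((h (markPhase n t)).trans (hV.trans h2)))
  exact h3.mono (by omega) (by omega) (by linarith)

theorem implementable_groverRounds {χ : EuclideanSpace ℂ (Fin (d + 1))} {hχ : ‖χ‖ = 1} {w : ℕ}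
    {e : ℝ}
    (h : ∀ φ : Fin 2 × Fin n → Circle, Implementable ℓ δ z i (logical z (Fin 2 × Fin n) χ hχ)
      (fun I => gibbsPhase I i φ) w 0 e) (t : ℕ) :
    Implementable ℓ δ z i (logical z (Fin 2 × Fin n) χ hχ) (fun I => groverRounds I i n t)
      (t * w) (t * 2) (t * e) := by
  induction t with
  | zero =>
    have h1 := Implementable.free ℓ δ z i (logical z (Fin 2 × Fin n) χ hχ)
      (LinearIsometryEquiv.refl ℂ _)
    exact h1.mono (Nat.zero_le _) (Nat.zero_le _) (by simp)
  | succ t ih =>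
    have h1 := ih.trans (implementable_groverRound h t)
    exact h1.mono (le_of_eq (by ring)) (le_of_eq (by ring)) (le_of_eq (by push_cast; ring))

theorem implementable_estimate [NeZero n] {χ : EuclideanSpace ℂ (Fin (d + 1))} {hχ : ‖χ‖ = 1}
    {w : ℕ} {e : ℝ}
    (h : ∀ φ : Fin 2 × Fin n → Circle, Implementable ℓ δ z i (logical z (Fin 2 × Fin n) χ hχ)
      (fun I => gibbsPhase I i φ) w 0 e) :
    Implementable ℓ δ z i (logical z (Fin 2 × Fin n) χ hχ) (fun I => estimate I i n)
      (n * w) (2 * n + 1) (n * e) := by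
  have h1 := Implementable.free ℓ δ z i (logical z (Fin 2 × Fin n) χ hχ) (readIndex Ω n)
  have h2 := (implementable_memoryRot χ hχ).trans ((implementable_groverRounds h n).trans h1)
  exact h2.mono (by omega) (by omega) (by linarith)

end Estimation

end QPartition

end

noncomputable section

namespace QPartition

set_option linter.unusedSectionVars false

open scoped ComplexConjugate

/-! ### Assembling the scheme -/

section Assembly

/-- If a unit vector is close to one with little mass outside a set, it has much mass inside. -/
theorem three_quarters_le_sum_filter {C : Type*} [Fintype C] (p : C → Prop) {_ : DecidablePred p}
    {ξ ζ : EuclideanSpace ℂ C} (hξ : ‖ξ‖ = 1) (hd : ‖ξ - ζ‖ ≤ 1 / 4)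
    (hbad : ∑ c ∈ Finset.univ.filter (fun c => ¬ p c), ‖ζ c‖ ^ 2 ≤ 1 / 16) :
    3 / 4 ≤ ∑ c ∈ Finset.univ.filter p, ‖ξ c‖ ^ 2 := by
  have h1 : ∑ c ∈ Finset.univ.filter p, ‖ξ c‖ ^ 2
      + ∑ c ∈ Finset.univ.filter (fun c => ¬ p c), ‖ξ c‖ ^ 2 = 1 := by
    rw [Finset.sum_filter_add_sum_filter_not, ← EuclideanSpace.norm_sq_eq, hξ, one_pow]
  -- By `(x + y)² ≤ 2x² + 2y²`, the bad mass of `ξ` is at most `2/16 + 2/16 = 1/4`.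
  have h2 : ∑ c ∈ Finset.univ.filter (fun c => ¬ p c), ‖ξ c‖ ^ 2
      ≤ 2 * ∑ c ∈ Finset.univ.filter (fun c => ¬ p c), ‖ζ c‖ ^ 2
        + 2 * ∑ c ∈ Finset.univ.filter (fun c => ¬ p c), ‖(ξ - ζ) c‖ ^ 2 := by
    rw [Finset.mul_sum, Finset.mul_sum, ← Finset.sum_add_distrib]
    refine Finset.sum_le_sum fun c _ => ?_
    have h3 : ‖ξ c‖ ≤ ‖ζ c‖ + ‖(ξ - ζ) c‖ := by
      calc ‖ξ c‖ = ‖ζ c + (ξ - ζ) c‖ := by simp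
        _ ≤ _ := norm_add_le _ _
    have h4 := pow_le_pow_left₀ (norm_nonneg _) h3 2
    nlinarith [sq_nonneg (‖ζ c‖ - ‖(ξ - ζ) c‖)]
  have h5 : ∑ c ∈ Finset.univ.filter (fun c => ¬ p c), ‖(ξ - ζ) c‖ ^ 2 ≤ 1 / 16 := by
    calc _ ≤ ∑ c, ‖(ξ - ζ) c‖ ^ 2 :=
          Finset.sum_le_sum_of_subset_of_nonneg (Finset.filter_subset _ _) fun _ _ _ => sq_nonneg _
      _ = ‖ξ - ζ‖ ^ 2 := (EuclideanSpace.norm_sq_eq _).symm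
      _ ≤ (1 / 4) ^ 2 := pow_le_pow_left₀ (norm_nonneg _) hd 2
      _ = 1 / 16 := by norm_num
  linarith

variable {Ω : Type*} [Fintype Ω] [DecidableEq Ω]

/-- Multiplication by `f` of the memory commutes with the logical embedding, which is isometric;
statistics of the memory can thus be computed on the logical state. -/
theorem sum_weight_logical {M : Type} [Fintype M] {d : ℕ} (z : Ω)
    {χ : EuclideanSpace ℂ (Fin (d + 1))} (hχ : ‖χ‖ = 1) (f : M → ℝ)
    (Θ : EuclideanSpace ℂ (Ω × M)) :
    ∑ c, f c.2.2.1 ^ 2 * ‖logical z M χ hχ Θ c‖ ^ 2 = ∑ q, f q.2 ^ 2 * ‖Θ q‖ ^ 2 := by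
  have h := (logical z M χ hχ).norm_map (WithLp.toLp 2 fun q => (f q.2 : ℂ) * Θ q)
  have h' := congrArg (fun t => t ^ 2) h
  simp only [EuclideanSpace.norm_sq_eq] at h'
  have e1 : ∀ c, ‖logical z M χ hχ (WithLp.toLp 2 fun q => (f q.2 : ℂ) * Θ q) c‖ ^ 2
      = f c.2.2.1 ^ 2 * ‖logical z M χ hχ Θ c‖ ^ 2 := by
    rintro ⟨⟨x, y⟩, b, m, k⟩
    have : logical z M χ hχ (WithLp.toLp 2 fun q => (f q.2 : ℂ) * Θ q) ((x, y), (b, (m, k)))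
        = (f m : ℂ) * logical z M χ hχ Θ ((x, y), (b, (m, k))) := by
      by_cases hb : b = 0 <;> by_cases hy : y = z <;>
        simp [logical_eq, qubitZero, hb, hy, mul_left_comm]
    rw [this, norm_mul, mul_pow, Complex.norm_real, Real.norm_eq_abs, sq_abs]
  have e2 : ∀ q : Ω × M, ‖(f q.2 : ℂ) * Θ q‖ ^ 2 = f q.2 ^ 2 * ‖Θ q‖ ^ 2 := fun q => by
    rw [norm_mul, mul_pow, Complex.norm_real, Real.norm_eq_abs, sq_abs]
  simp only [e1, e2] at h'
  exact h'

theorem norm_uniform [Nonempty Ω] :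
    ‖(WithLp.toLp 2 fun _ => (Real.sqrt (1 / (Fintype.card Ω : ℝ)) : ℂ) : EuclideanSpace ℂ Ω)‖
      = 1 := by
  rw [← sq_eq_sq₀ (norm_nonneg _) zero_le_one, EuclideanSpace.norm_sq_eq]
  have h : (Fintype.card Ω : ℝ) ≠ 0 := by exact_mod_cast Fintype.card_ne_zero
  simp only [Complex.norm_real, Real.norm_eq_abs, sq_abs]
  rw [Real.sq_sqrt (by positivity)]
  simp [h]

/-- Chebyshev's inequality: the second moment is at most `ε² / 16`, and bad outcomes deviate by more
than `ε`. -/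
theorem sum_bad_estimate_le {z : Ω} {ℓ i n d : ℕ} [NeZero n] (hi : i < ℓ) {δ ε A : ℝ} (hε0 : 0 < ε)
    {χ : EuclideanSpace ℂ (Fin (d + 1))} (hχ : ‖χ‖ = 1) {a : Fin n → ℝ} (ha0 : a 0 = 0)
    (ha1 : ‖windowState a‖ = 1) (ha : ∀ k, (a (k + 1) - a k) ^ 2 ≤ A) (hA : n * A ≤ ε ^ 2 / 16)
    {I : AnnealingData Ω} (hI : I.Admissible z ℓ δ)
    (p : Conf Ω ((Fin 2 × Fin n) × Fin (d + 1)) → Prop) {_ : DecidablePred p}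
    (hp : ∀ c, |shiftEigenvalue n c.2.2.1.2 - (1 - 2 * I.ratio i)| ≤ ε → p c) :
    ∑ c ∈ Finset.univ.filter (fun c => ¬ p c), ‖logical z (Fin 2 × Fin n) χ hχ
      (estimate I i n (withMemory Ω (windowState a) ha1 (gibbsState I i))) c‖ ^ 2 ≤ 1 / 16 := by
  set Θ := estimate I i n (withMemory Ω (windowState a) ha1 (gibbsState I i)) with hΘ
  have hterm : ∀ c ∈ Finset.univ.filter (fun c => ¬ p c),
      ε ^ 2 * ‖logical z (Fin 2 × Fin n) χ hχ Θ c‖ ^ 2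
        ≤ (shiftEigenvalue n c.2.2.1.2 - (1 - 2 * I.ratio i)) ^ 2
          * ‖logical z (Fin 2 × Fin n) χ hχ Θ c‖ ^ 2 := by
    intro c hc
    rw [Finset.mem_filter] at hc
    refine mul_le_mul_of_nonneg_right ?_ (sq_nonneg _)
    rw [← sq_abs (shiftEigenvalue n c.2.2.1.2 - (1 - 2 * I.ratio i))]
    exact pow_le_pow_left₀ hε0.le (le_of_lt (not_le.1 fun h => hc.2 (hp c h))) 2
  have hall := sum_weight_logical z hχ
    (fun q : Fin 2 × Fin n => shiftEigenvalue n q.2 - (1 - 2 * I.ratio i)) Θ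
  have hest := sum_estimate_le hI hi ha0 ha1 ha
  have hle := Finset.sum_le_sum_of_subset_of_nonneg
    (Finset.filter_subset (fun c => ¬ p c) Finset.univ)
    (f := fun c => (shiftEigenvalue n c.2.2.1.2 - (1 - 2 * I.ratio i)) ^ 2
      * ‖logical z (Fin 2 × Fin n) χ hχ Θ c‖ ^ 2) fun _ _ _ => by positivity
  have h1 := Finset.sum_le_sum hterm
  rw [← Finset.mul_sum] at h1
  rw [hall] at hle
  have h2 := h1.trans (hle.trans (hest.trans hA))
  have h3 : 0 < ε ^ 2 := by positivity
  refine le_of_mul_le_mul_left (h2.trans (le_of_eq ?_)) h3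
  ring

theorem norm_run_sub_le {z : Ω} {ℓ i n d m : ℕ} [NeZero n]
    (hi : i < ℓ) {δ : ℝ} {ι : EuclideanSpace ℂ (Ω × (Fin 2 × Fin n)) →ₗᵢ[ℂ]
      EuclideanSpace ℂ (Conf Ω ((Fin 2 × Fin n) × Fin (d + 1)))}
    {τ : EuclideanSpace ℂ Ω →ₗᵢ[ℂ] EuclideanSpace ℂ (Ω × (Fin 2 × Fin n))} {η : ℝ} (hη : 0 ≤ η)
    {I : AnnealingData Ω} (hI : I.Admissible z ℓ δ)
    {gs₁ gs₂ : List (Gate Ω ((Fin 2 × Fin n) × Fin (d + 1)) ℓ)}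
    (h₁ : ∀ x, ‖run I z i gs₁ (ι.comp τ x) - ι.comp τ (prepare I m i x)‖
      ≤ i * ((3 ^ m - 1) * η) * ‖x‖)
    (h₂ : ∀ x, ‖run I z i gs₂ (ι x) - ι (estimate I i n x)‖ ≤ n * η * ‖x‖) :
    ∃ c : Circle, ‖run I z i (gs₁ ++ gs₂) (ι (τ (gibbsState I 0)))
        - (c : ℂ) • ι (estimate I i n (τ (gibbsState I i)))‖
      ≤ ℓ * Real.sqrt (2 * (1 / 2) ^ 3 ^ m) + (ℓ * 3 ^ m + n) * η := by
  have : Nonempty Ω := ⟨z⟩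
  obtain ⟨c, hc⟩ := exists_norm_prepare_sub_le hI m hi
  refine ⟨c, ?_⟩
  have h1 := h₁ (gibbsState I 0)
  rw [norm_gibbsState, mul_one] at h1
  set s := gibbsState I i with hs
  have h2 : ‖run I z i gs₁ (ι (τ (gibbsState I 0))) - (c : ℂ) • ι (τ s)‖
      ≤ i * ((3 ^ m - 1) * η) + i * Real.sqrt (2 * (1 / 2) ^ 3 ^ m) := by
    refine (norm_sub_le_norm_sub_add_norm_sub _ (ι (τ (prepare I m i (gibbsState I 0)))) _).trans
      (add_le_add h1 ?_)
    rw [← map_smul, ← map_smul, ← map_sub, ← map_sub, LinearIsometry.norm_map,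
      LinearIsometry.norm_map]
    exact hc
  have h3 := h₂ (τ s)
  rw [LinearIsometry.norm_map, norm_gibbsState, mul_one] at h3
  have h4 : run I z i (gs₁ ++ gs₂) (ι (τ (gibbsState I 0)))
        - (c : ℂ) • ι (estimate I i n (τ s))
      = run I z i gs₂ (run I z i gs₁ (ι (τ (gibbsState I 0))) - (c : ℂ) • ι (τ s))
      + (c : ℂ) • (run I z i gs₂ (ι (τ s)) - ι (estimate I i n (τ s))) := by
    rw [run_append, map_sub, map_smul, smul_sub]; abel
  rw [h4]
  refine (norm_add_le _ _).trans ?_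
  rw [LinearIsometryEquiv.norm_map, norm_smul, Circle.norm_coe, one_mul]
  refine (add_le_add h2 h3).trans ?_
  have hiℓ : (i : ℝ) ≤ ℓ := by exact_mod_cast hi.le
  have h5 : (i : ℝ) * Real.sqrt (2 * (1 / 2) ^ 3 ^ m)
      ≤ ℓ * Real.sqrt (2 * (1 / 2) ^ 3 ^ m) :=
    mul_le_mul_of_nonneg_right hiℓ (Real.sqrt_nonneg _)
  have h6 : (i : ℝ) * ((3 ^ m - 1) * η) ≤ ℓ * (3 ^ m * η) := by
    have h7 : ((3 : ℝ) ^ m - 1) * η ≤ 3 ^ m * η :=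
      mul_le_mul_of_nonneg_right (by linarith) hη
    calc (i : ℝ) * ((3 ^ m - 1) * η) ≤ i * (3 ^ m * η) :=
          mul_le_mul_of_nonneg_left h7 (Nat.cast_nonneg i)
      _ ≤ _ := mul_le_mul_of_nonneg_right hiℓ (by positivity)
  linarith

theorem exists_scheme_of_window (z : Ω) {ℓ i n d : ℕ} [NeZero n] (hi : i < ℓ) {δ ε A : ℝ}
    (hδ0 : 0 < δ) (hδ1 : δ ≤ 1) (hε0 : 0 < ε) {T r m : ℕ} (hT : 2 ≤ T * Real.sqrt δ)
    {χ : EuclideanSpace ℂ (Fin (d + 1))} (hχ : ‖χ‖ = 1)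
    (hsel : ∀ W : TwoReg Ω ≃ₗᵢ[ℂ] TwoReg Ω,
      ∑ k, (conj (χ k) * χ k) • toEnd W ^ (k : ℕ) = average W T ^ r)
    {a : Fin n → ℝ} (ha0 : a 0 = 0)
    (ha1 : ‖windowState a‖ = 1) (ha : ∀ k, (a (k + 1) - a k) ^ 2 ≤ A) (hA : n * A ≤ ε ^ 2 / 16)
    (herr : ℓ * Real.sqrt (2 * (1 / 2) ^ 3 ^ m)
      + (ℓ * 3 ^ m + n : ℝ) * (2 * (1 / 2) ^ r) ≤ 1 / 4) :
    ∃ A : Scheme Ω ℓ, A.walkCount ≤ (ℓ * 3 ^ m + n) * (2 * d) ∧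
      A.rotCount ≤ 2 * n + 1 ∧ ∀ I : AnnealingData Ω, I.Admissible z ℓ δ →
        3 / 4 ≤ A.prob I z i (Set.Icc ((1 - ε) * I.ratio i) ((1 + ε) * I.ratio i)) := by
  have : Nonempty Ω := ⟨z⟩
  have hphase := fun j (hj : j < ℓ) (φ : Fin 2 × Fin n → Circle) =>
    implementable_gibbsPhase (Ω := Ω) (z := z) (i := i) hj hδ0 hδ1 hT hχ hsel φ
  obtain ⟨gs₁, hw₁, hv₁, hg₁⟩ := implementable_prepare
    (ι := (logical z (Fin 2 × Fin n) χ hχ).comp (withMemory Ω (windowState a) ha1)) (fun j hj =>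
    (hphase j hj fun _ => Circle.exp (Real.pi / 3)).comp (withMemory Ω (windowState a) ha1)
      (u := fun I => phaseShift (gibbsState I j) (Circle.exp (Real.pi / 3)))
      (fun I _ v => gibbsPhase_withMemory I j _ _ ha1 v)) m hi
  obtain ⟨gs₂, hw₂, hv₂, hg₂⟩ := implementable_estimate (hphase i hi)
  set u : EuclideanSpace ℂ Ω :=
    WithLp.toLp 2 fun _ => (Real.sqrt (1 / (Fintype.card Ω : ℝ)) : ℂ) with hu
  obtain ⟨init⟩ : Nonempty (Conf Ω ((Fin 2 × Fin n) × Fin (d + 1))) := inferInstance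
  have hinit : ‖(EuclideanSpace.single init (1 : ℂ))‖ = 1 := by simp
  have hstart : ‖logical z (Fin 2 × Fin n) χ hχ (withMemory Ω (windowState a) ha1 u)‖ = 1 := by
    rw [LinearIsometry.norm_map, LinearIsometry.norm_map]; exact norm_uniform
  -- Window, counter and uniform Gibbs state are the same for all instances, so one free unitary
  -- prepares the start.
  obtain ⟨F, hF⟩ := exists_unitary_comp_eq
    (LinearIsometry.toSpanSingleton ℂ _ hinit) (LinearIsometry.toSpanSingleton ℂ _ hstart)
  have hF1 : F (EuclideanSpace.single init (1 : ℂ))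
      = logical z (Fin 2 × Fin n) χ hχ (withMemory Ω (windowState a) ha1 u) := by
    have := hF 1
    simpa using this
  refine ⟨{ Anc := (Fin 2 × Fin n) × Fin (d + 1)
            init := init
            gates := Gate.free F :: (gs₁ ++ gs₂)
            output := fun c => (1 - shiftEigenvalue n c.2.2.1.2) / 2 }, ?_, ?_, ?_⟩
  · have h : walkTotal (Gate.free F :: (gs₁ ++ gs₂)) = walkTotal gs₁ + walkTotal gs₂ := by
      rw [← walkTotal_append]; simp [walkTotal, Gate.walkCost]
    change walkTotal (Gate.free F :: (gs₁ ++ gs₂)) ≤ _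
    rw [h]
    calc walkTotal gs₁ + walkTotal gs₂
        ≤ i * ((3 ^ m - 1) * (2 * d)) + n * (2 * d) := add_le_add hw₁ hw₂
      _ ≤ ℓ * (3 ^ m * (2 * d)) + n * (2 * d) := by
          gcongr
          exact Nat.sub_le _ _
      _ = (ℓ * 3 ^ m + n) * (2 * d) := by ring
  · have h : rotTotal (Gate.free F :: (gs₁ ++ gs₂)) = rotTotal gs₁ + rotTotal gs₂ := by
      rw [← rotTotal_append]; simp [rotTotal, Gate.rotCost]
    change rotTotal (Gate.free F :: (gs₁ ++ gs₂)) ≤ _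
    omega
  · intro I hI
    obtain ⟨c, hc⟩ := norm_run_sub_le hi
      (by positivity : (0 : ℝ) ≤ 2 * (1 / 2) ^ r) hI (hg₁ I hI) (hg₂ I hI)
    have hstate : run I z i (Gate.free F :: (gs₁ ++ gs₂)) (EuclideanSpace.single init 1)
        = run I z i (gs₁ ++ gs₂) (logical z (Fin 2 × Fin n) χ hχ
          (withMemory Ω (windowState a) ha1 (gibbsState I 0))) := by
      have h1 : run I z i (Gate.free F :: (gs₁ ++ gs₂)) (EuclideanSpace.single init 1)
        = run I z i (gs₁ ++ gs₂) (F (EuclideanSpace.single init 1)) := rfl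
      rw [h1, hF1, gibbsState_zero hI]
    rw [← hstate] at hc
    have hfinal := foldl_act_eq_run hI hi (Gate.free F :: (gs₁ ++ gs₂))
      (EuclideanSpace.single init (1 : ℂ))
    rw [← hfinal] at hc
    refine three_quarters_le_sum_filter _ ?_ (hc.trans herr) ?_
    · change ‖List.foldl _ _ (Gate.free F :: (gs₁ ++ gs₂))‖ = 1
      rw [hfinal, LinearIsometryEquiv.norm_map, hinit]
    · have hsmul : ∀ q, ‖((c : ℂ) • logical z (Fin 2 × Fin n) χ hχ (estimate I i n
          (withMemory Ω (windowState a) ha1 (gibbsState I i)))) q‖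
          = ‖logical z (Fin 2 × Fin n) χ hχ (estimate I i n
          (withMemory Ω (windowState a) ha1 (gibbsState I i))) q‖ := fun q => by
        rw [PiLp.smul_apply, norm_smul, Circle.norm_coe, one_mul]
      simp only [hsmul]
      -- The output `(1 - μ) / 2` differs from `α_i` by at most `ε / 2`, which is at most `ε α_i`
      -- because `α_i ≥ 1/2`.
      refine sum_bad_estimate_le hi hε0 hχ ha0 ha1 ha hA hI _ fun q hq => ?_
      have hr := hI.ratio_ge i hi
      rw [abs_le] at hq
      constructor <;> nlinarith

theorem exists_scheme (z : Ω) {ℓ i : ℕ} (hi : i < ℓ) {δ ε : ℝ} (hδ0 : 0 < δ) (hδ1 : δ ≤ 1)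
    (hε0 : 0 < ε) {T r m p : ℕ} (hT : 2 ≤ T * Real.sqrt δ) (hpε : 6 ≤ p * ε)
    (herr : ℓ * Real.sqrt (2 * (1 / 2) ^ 3 ^ m)
      + (ℓ * 3 ^ m + 4 * p : ℝ) * (2 * (1 / 2) ^ r) ≤ 1 / 4) :
    ∃ A : Scheme Ω ℓ, A.walkCount ≤ (ℓ * 3 ^ m + 4 * p) * (2 * (r * (T - 1))) ∧
      A.rotCount ≤ 8 * p + 1 ∧ ∀ I : AnnealingData Ω, I.Admissible z ℓ δ →
        3 / 4 ≤ A.prob I z i (Set.Icc ((1 - ε) * I.ratio i) ((1 + ε) * I.ratio i)) := by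
  have hTpos : 0 < T := by
    rcases Nat.eq_zero_or_pos T with rfl | h
    · norm_num at hT
    · exact h
  have hp : 0 < p := by
    rcases Nat.eq_zero_or_pos p with rfl | h
    · norm_num at hpε
    · exact h
  have hp' : (0 : ℝ) < p := by exact_mod_cast hp
  have : NeZero (4 * p) := ⟨by omega⟩
  obtain ⟨c, hc0, hc1, hcW⟩ := exists_average_pow_coefficients T r hTpos
  obtain ⟨a, ha0, ha1, ha⟩ := exists_window hp
  have hχ : ‖(WithLp.toLp 2 fun k => (Real.sqrt (c k) : ℂ) :
      EuclideanSpace ℂ (Fin (r * (T - 1) + 1)))‖ = 1 := by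
    rw [← sq_eq_sq₀ (norm_nonneg _) zero_le_one, EuclideanSpace.norm_sq_eq, one_pow, ← hc1]
    refine Finset.sum_congr rfl fun k _ => ?_
    simp only [Complex.norm_real, Real.norm_eq_abs, sq_abs]
    exact Real.sq_sqrt (hc0 k)
  have h := exists_scheme_of_window z hi hδ0 hδ1 hε0 (r := r) (m := m) hT hχ ?_ ha0
    (norm_windowState ha1) ha ?_ ?_
  · obtain ⟨A, h1, h2, h3⟩ := h
    exact ⟨A, h1, by omega, h3⟩
  · intro W
    rw [← hcW W]
    refine Finset.sum_congr rfl fun k _ => ?_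
    congr 1
    simp only [Complex.conj_ofReal]
    rw [← Complex.ofReal_mul, Real.mul_self_sqrt (hc0 k)]
  -- From `p ε ≥ 6`, the second moment bound is `2 / p² ≤ ε² / 18`.
  · have h1 : ((4 * p : ℕ) : ℝ) * (1 / (2 * (p : ℝ) ^ 3)) = 2 / (p : ℝ) ^ 2 := by
      push_cast; field_simp; norm_num
    rw [h1, div_le_iff₀ (by positivity)]
    nlinarith
  · push_cast
    exact herr

end Assembly

end QPartition

end

noncomputable section

namespace QPartition

set_option linter.unusedSectionVars false

/-! ### Choice of parameters -/

section Parameters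

theorem exists_pow_three_between (X : ℕ) (hX : X ≠ 0) : ∃ m : ℕ, X ≤ 3 ^ m ∧ 3 ^ m ≤ 3 * X := by
  refine ⟨Nat.log 3 X + 1, (Nat.lt_pow_succ_log_self (by norm_num) X).le, ?_⟩
  rw [pow_succ']
  exact Nat.mul_le_mul_left 3 (Nat.pow_log_le_self 3 hX)

/-- The number of levels of the fixed-point iteration. -/
theorem exists_levels {ℓ : ℕ} (hℓ : 1 ≤ ℓ) :
    ∃ m : ℕ, ℓ * Real.sqrt (2 * (1 / 2) ^ 3 ^ m) ≤ 1 / 16 ∧ 3 ^ m ≤ 39 * ℓ ∧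
      (2 ≤ ℓ → (3 : ℝ) ^ m ≤ 57 * Real.log ℓ) := by
  -- The target is `2^(3^m) ≥ 512 ℓ²`, and `ℓ ≤ 2^(log₂ ℓ + 1)` with `512 = 2^9` gives the exponent
  -- `11 + 2 log₂ ℓ`.
  obtain ⟨m, h1, h2⟩ := exists_pow_three_between (11 + 2 * Nat.log 2 ℓ) (by omega)
  have hℓ0 : (0 : ℝ) < ℓ := by exact_mod_cast hℓ
  refine ⟨m, ?_, ?_, ?_⟩
  · have h3 : (ℓ : ℝ) ≤ 2 ^ (Nat.log 2 ℓ + 1) := by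
      exact_mod_cast (Nat.lt_pow_succ_log_self (by norm_num) ℓ).le
    have h4 : (512 : ℝ) * ℓ ^ 2 ≤ 2 ^ 3 ^ m := by
      calc (512 : ℝ) * ℓ ^ 2 ≤ 2 ^ 9 * (2 ^ (Nat.log 2 ℓ + 1)) ^ 2 := by
            have := pow_le_pow_left₀ hℓ0.le h3 2
            norm_num at this ⊢
            linarith
        _ = 2 ^ (11 + 2 * Nat.log 2 ℓ) := by rw [← pow_mul, ← pow_add]; congr 1; ring
        _ ≤ 2 ^ 3 ^ m := pow_le_pow_right₀ (by norm_num) h1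
    have h5 : 2 * (1 / 2 : ℝ) ^ 3 ^ m ≤ (1 / (16 * ℓ)) ^ 2 := by
      rw [div_pow, div_pow, one_pow, one_pow, mul_one_div, div_le_div_iff₀ (by positivity)
        (by positivity)]
      nlinarith
    have h6 : Real.sqrt (2 * (1 / 2) ^ 3 ^ m) ≤ 1 / (16 * ℓ) := by
      rw [Real.sqrt_le_left (by positivity)]; exact h5
    calc ℓ * Real.sqrt (2 * (1 / 2) ^ 3 ^ m) ≤ ℓ * (1 / (16 * ℓ)) :=
          mul_le_mul_of_nonneg_left h6 hℓ0.le
      _ = 1 / 16 := by field_simp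
  · have := Nat.log_lt_self 2 (by omega : ℓ ≠ 0)
    omega
  · intro hℓ2
    have h3 : Real.log 2 * Nat.log 2 ℓ ≤ Real.log ℓ := by
      have h4 : ((2 ^ Nat.log 2 ℓ : ℕ) : ℝ) ≤ ℓ := by
        exact_mod_cast Nat.pow_log_le_self 2 (by omega)
      have h5 := Real.log_le_log (by positivity) h4
      rw [Nat.cast_pow, Real.log_pow] at h5
      push_cast at h5
      linarith
    have h6 : Real.log 2 ≤ Real.log ℓ :=
      Real.log_le_log (by norm_num) (by exact_mod_cast hℓ2)
    have h7 : (3 : ℝ) ^ m ≤ 33 + 6 * Nat.log 2 ℓ := by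
      have : (3 : ℕ) ^ m ≤ 33 + 6 * Nat.log 2 ℓ := by omega
      exact_mod_cast this
    have h8 := Real.log_two_gt_d9
    have h9 : (0 : ℝ) < 3 ^ m := by positivity
    have h10 : (3 : ℝ) ^ m * Real.log 2 ≤ 39 * Real.log ℓ := by nlinarith
    nlinarith

/-- The exponent of the averaging operator. -/
theorem exists_exponent {N : ℕ} (hN : 1 ≤ N) {q : ℝ} (hq : 1 ≤ q) (hNq : (N : ℝ) ≤ 67 * q ^ 2) :
    ∃ r : ℕ, (N : ℝ) * (2 * (1 / 2) ^ r) ≤ 1 / 6 ∧ (2 ≤ q → (r : ℝ) ≤ 19 * Real.log q) := by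
  have hN0 : (0 : ℝ) < N := by exact_mod_cast hN
  -- The first bound says `2^r ≥ 12 N`. Minimality gives `2^(r-1) < 12 N ≤ 2^10 q²`, since `12 · 67
  -- ≤ 1024`.
  refine ⟨Nat.clog 2 (12 * N), ?_, ?_⟩
  · have h1 : ((12 * N : ℕ) : ℝ) ≤ 2 ^ Nat.clog 2 (12 * N) := by
      exact_mod_cast Nat.le_pow_clog (by norm_num) (12 * N)
    push_cast at h1
    rw [div_pow, one_pow, mul_one_div, ← mul_div_assoc, div_le_div_iff₀ (by positivity)
      (by norm_num)]
    linarith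
  · intro hq2
    have h1 := Nat.pow_pred_clog_lt_self (by norm_num : 1 < 2) (by omega : 1 < 12 * N)
    set r := Nat.clog 2 (12 * N) with hr
    have h2 : ((2 ^ r.pred : ℕ) : ℝ) ≤ 2 ^ 10 * q ^ 2 := by
      have : ((2 ^ r.pred : ℕ) : ℝ) ≤ ((12 * N : ℕ) : ℝ) := by exact_mod_cast h1.le
      push_cast at this ⊢
      nlinarith
    have h3 := Real.log_le_log (by positivity) h2
    rw [Nat.cast_pow, Real.log_pow, Real.log_mul (by norm_num) (by positivity), Real.log_pow,
      Real.log_pow] at h3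
    push_cast at h3
    have h4 : (r : ℝ) ≤ r.pred + 1 := by
      have : r ≤ r.pred + 1 := by rw [Nat.pred_eq_sub_one]; omega
      exact_mod_cast this
    have h5 : Real.log 2 ≤ Real.log q := Real.log_le_log (by norm_num) hq2
    have h6 := Real.log_two_gt_d9
    have h7 : (r : ℝ) * Real.log 2 ≤ 13 * Real.log q := by nlinarith
    have h8 : (0 : ℝ) ≤ r := Nat.cast_nonneg r
    nlinarith

/-- The mixed terms are `b log a` for `b ≤ a`, and `a log a log b` for `b ≥ a`. The latter is
dominated by `a log² a` while `b ≤ a²`, and by `b log b` beyond, where `a log a ≤ a² ≤ b`. -/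
theorem log_max_mul_le {a b : ℝ} (ha : 2 ≤ a) (hb : 1 < b) :
    Real.log (max a b) * (57 * (a * Real.log a) + 28 * b)
      ≤ 114 * (a * Real.log a ^ 2 + b * Real.log b) := by
  have hL2 := Real.log_two_gt_d9
  have hLa : Real.log 2 ≤ Real.log a := Real.log_le_log (by norm_num) ha
  have hLb : 0 < Real.log b := Real.log_pos hb
  have hLapos : 0 < Real.log a := by linarith
  have hLaa : Real.log a ≤ a := (Real.log_le_sub_one_of_pos (by linarith)).trans (by linarith)
  have haLa : 0 ≤ a * Real.log a ^ 2 := by positivity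
  have hbLb : 0 ≤ b * Real.log b := by positivity
  rcases le_total b a with h | h
  · rw [max_eq_left h]
    have h1 : Real.log a * b ≤ Real.log a * a := mul_le_mul_of_nonneg_left h hLapos.le
    have h2 : a * Real.log a ≤ 2 * (a * Real.log a ^ 2) := by
      have : 0 ≤ a * Real.log a := by positivity
      nlinarith
    nlinarith
  · rw [max_eq_right h]
    rcases le_total b (a ^ 2) with h' | h'
    · have h1 : Real.log b ≤ 2 * Real.log a := by
        have := Real.log_le_log (by linarith) h'
        rw [Real.log_pow] at this
        exact_mod_cast this
      have h2 : Real.log b * (a * Real.log a) ≤ 2 * Real.log a * (a * Real.log a) :=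
        mul_le_mul_of_nonneg_right h1 (by positivity)
      nlinarith
    · have h1 : a * Real.log a ≤ b := by nlinarith
      have h2 : Real.log b * (a * Real.log a) ≤ Real.log b * b :=
        mul_le_mul_of_nonneg_left h1 hLb.le
      nlinarith

theorem exists_parameters {ℓ : ℕ} (hℓ : 1 ≤ ℓ) {δ ε : ℝ} (hδ0 : 0 < δ) (hε0 : 0 < ε)
    (hε1 : ε < 1) :
    ∃ T r m p : ℕ, 2 ≤ T * Real.sqrt δ ∧ 6 ≤ p * ε ∧
      ℓ * Real.sqrt (2 * (1 / 2) ^ 3 ^ m)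
        + (ℓ * 3 ^ m + 4 * p : ℝ) * (2 * (1 / 2) ^ r) ≤ 1 / 4 ∧
      (8 * p + 1 : ℝ) ≤ 10000 / ε ∧
      (2 ≤ ℓ → (((ℓ * 3 ^ m + 4 * p) * (2 * (r * (T - 1))) : ℕ) : ℝ)
        ≤ 10000 * ((ℓ : ℝ) / Real.sqrt δ * Real.log ℓ ^ 2
          + 1 / (ε * Real.sqrt δ) * Real.log (1 / ε))) := by
  have hsδ : 0 < Real.sqrt δ := Real.sqrt_pos.2 hδ0
  have hb : 1 < 1 / ε := by rw [lt_div_iff₀ hε0]; linarith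
  obtain ⟨m, hm1, hm2, hm3⟩ := exists_levels hℓ
  set p := ⌈6 / ε⌉₊ with hp
  have hp1 : 6 / ε ≤ p := Nat.le_ceil _
  have hp2 : (p : ℝ) ≤ 7 * (1 / ε) := by
    have := (Nat.ceil_lt_add_one (by positivity : 0 ≤ 6 / ε)).le
    rw [← hp] at this
    have h6 : 6 / ε = 6 * (1 / ε) := by ring
    linarith
  have hℓ1 : (1 : ℝ) ≤ ℓ := by exact_mod_cast hℓ
  set q := max (ℓ : ℝ) (1 / ε) with hq
  have hqℓ : (ℓ : ℝ) ≤ q := le_max_left _ _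
  have hqb : 1 / ε ≤ q := le_max_right _ _
  have hm2' : (3 : ℝ) ^ m ≤ 39 * ℓ := by exact_mod_cast hm2
  have hNpos : 1 ≤ ℓ * 3 ^ m + 4 * p := by
    have : 1 ≤ 3 ^ m := Nat.one_le_pow _ _ (by norm_num)
    nlinarith
  -- The constant `67 = 39 + 28` comes from `3^m ≤ 39 ℓ` and `4p ≤ 28 / ε`.
  obtain ⟨r, hr1, hr2⟩ := exists_exponent hNpos (hℓ1.trans hqℓ) (by
    push_cast
    have h1 : (ℓ : ℝ) * 3 ^ m ≤ 39 * q ^ 2 := by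
      calc (ℓ : ℝ) * 3 ^ m ≤ ℓ * (39 * ℓ) := mul_le_mul_of_nonneg_left hm2' (by linarith)
        _ ≤ 39 * q ^ 2 := by nlinarith
    nlinarith)
  push_cast at hr1
  set T := ⌈2 / Real.sqrt δ⌉₊ with hT
  -- The two error budgets are `1/16` for the fixed-point iteration and `1/6` for the phases,
  -- together below `1/4`.
  refine ⟨T, r, m, p, ?_, ?_, by linarith, ?_, fun hℓ2 => ?_⟩
  · rw [← div_le_iff₀ hsδ]; exact Nat.le_ceil _
  · rw [← div_le_iff₀ hε0]; exact hp1
  · have : 10000 / ε = 10000 * (1 / ε) := by ring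
    rw [this]; linarith
  · have hℓ2' : (2 : ℝ) ≤ ℓ := by exact_mod_cast hℓ2
    have hrq := hr2 (hℓ2'.trans hqℓ)
    have hT1 : ((T - 1 : ℕ) : ℝ) ≤ 2 / Real.sqrt δ := by
      have h1 := Nat.ceil_lt_add_one (by positivity : 0 ≤ 2 / Real.sqrt δ)
      rw [← hT] at h1
      have h2 : 1 ≤ T := Nat.one_le_iff_ne_zero.2 (Nat.ceil_pos.2 (by positivity)).ne'
      rw [Nat.cast_sub h2]
      push_cast
      linarith
    have hm3' := hm3 hℓ2
    have hkey := log_max_mul_le hℓ2' hb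
    rw [← hq] at hkey
    have hlogq : 0 ≤ Real.log q := Real.log_nonneg (by linarith)
    have hlogℓ : 0 ≤ Real.log ℓ := Real.log_nonneg hℓ1
    push_cast
    have h1 : (ℓ : ℝ) * 3 ^ m + 4 * p ≤ 57 * (ℓ * Real.log ℓ) + 28 * (1 / ε) := by
      have : (ℓ : ℝ) * 3 ^ m ≤ ℓ * (57 * Real.log ℓ) :=
        mul_le_mul_of_nonneg_left hm3' (by linarith)
      linarith
    have h2 : (2 : ℝ) * (r * ((T - 1 : ℕ) : ℝ)) ≤ 2 * (19 * Real.log q * (2 / Real.sqrt δ)) := by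
      gcongr
    have h3 : (0 : ℝ) ≤ 2 * (r * ((T - 1 : ℕ) : ℝ)) := by positivity
    have h4 : (0 : ℝ) ≤ 57 * (ℓ * Real.log ℓ) + 28 * (1 / ε) := by positivity
    calc ((ℓ : ℝ) * 3 ^ m + 4 * p) * (2 * (r * ((T - 1 : ℕ) : ℝ)))
        ≤ (57 * (ℓ * Real.log ℓ) + 28 * (1 / ε)) * (2 * (19 * Real.log q * (2 / Real.sqrt δ))) :=
          mul_le_mul h1 h2 h3 h4
      _ = 76 / Real.sqrt δ * (Real.log q * (57 * (ℓ * Real.log ℓ) + 28 * (1 / ε))) := by ring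
      _ ≤ 76 / Real.sqrt δ * (114 * (ℓ * Real.log ℓ ^ 2 + 1 / ε * Real.log (1 / ε))) :=
          mul_le_mul_of_nonneg_left hkey (by positivity)
      _ = 8664 * ((ℓ : ℝ) / Real.sqrt δ * Real.log ℓ ^ 2
          + 1 / (ε * Real.sqrt δ) * Real.log (1 / ε)) := by
          field_simp
          ring
      _ ≤ _ := by
          refine mul_le_mul_of_nonneg_right (by norm_num) ?_
          have : 0 ≤ Real.log (1 / ε) := Real.log_nonneg hb.le
          positivity

end Parameters

/-! ### Degenerate cases and conclusion -/

section Main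

variable {Ω : Type*} [Fintype Ω] [DecidableEq Ω]

theorem AnnealingData.Admissible.mono {I : AnnealingData Ω} {z : Ω} {ℓ : ℕ} {δ δ' : ℝ}
    (hI : I.Admissible z ℓ δ) (h : δ' ≤ δ) : I.Admissible z ℓ δ' :=
  { hI with gap_ge := fun j h1 h2 => h.trans (hI.gap_ge j h1 h2) }

theorem walkCount_eq_zero {A : Scheme Ω 1} : A.walkCount = 0 := by
  unfold Scheme.walkCount
  rw [List.sum_eq_zero_iff]
  intro x hx
  obtain ⟨g, -, rfl⟩ := List.mem_map.1 hx
  cases g with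
  | free F => rfl
  | walk j h1 h2 => omega
  | rot => rfl

end Main

end QPartition

end

/-- There is a universal constant `C` such that for every finite state space with a reference
state, every `ℓ`, `i < ℓ`, `δ > 0` and `ε ∈ (0,1)`, one scheme, with the stated number of controlled
walks (and of uses of `V_i`), works for all admissible instances. -/
theorem lemma5 :
    ∃ C : ℝ, 0 < C ∧
      ∀ (Ω : Type*) [Fintype Ω] [DecidableEq Ω] (z : Ω) (ℓ i : ℕ), i < ℓ →
        ∀ δ ε : ℝ, 0 < δ → 0 < ε → ε < 1 →
          ∃ A : QPartition.Scheme Ω ℓ,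
            (A.walkCount : ℝ) ≤
              C * ((ℓ : ℝ) / Real.sqrt δ * Real.log ℓ ^ 2
                + 1 / (ε * Real.sqrt δ) * Real.log (1 / ε)) ∧
            (A.rotCount : ℝ) ≤ C / ε ∧
            ∀ I : QPartition.AnnealingData Ω, I.Admissible z ℓ δ →
              3 / 4 ≤ A.prob I z i
                (Set.Icc ((1 - ε) * I.ratio i) ((1 + ε) * I.ratio i)) := by
  refine ⟨10000, by norm_num, ?_⟩
  intro Ω _ _ z ℓ i hi δ ε hδ0 hε0 hε1
  have hbound : 0 ≤ 10000 * ((ℓ : ℝ) / Real.sqrt δ * Real.log ℓ ^ 2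
      + 1 / (ε * Real.sqrt δ) * Real.log (1 / ε)) := by
    have : 0 ≤ Real.log (1 / ε) := Real.log_nonneg (by rw [le_div_iff₀ hε0]; linarith)
    positivity
  -- A spectral gap never exceeds `1`, so if `δ > 1` and some chain is present, no instance is
  -- admissible and an empty circuit suffices.
  by_cases hcase : 2 ≤ ℓ ∧ 1 < δ
  · refine ⟨{ Anc := Unit, init := ((z, z), (0, ())), gates := [], output := fun _ => 0 }, ?_, ?_,
      fun I hI => ?_⟩
    · simpa [QPartition.Scheme.walkCount] using hbound
    · simp only [QPartition.Scheme.rotCount, List.map_nil, List.sum_nil, Nat.cast_zero]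
      positivity
    · have h1 := hI.gap_ge 1 le_rfl (by omega)
      have h2 := QPartition.spectralGap_le_one (I.chain 1)
      linarith
  -- For `ℓ = 1` the value of `δ` is unconstrained, so it is truncated to `1`; the walk bound is
  -- unaffected, as the circuit has no walks. For `ℓ ≥ 2` the truncation changes nothing.
  · have hδ' : 0 < min δ 1 := lt_min hδ0 one_pos
    obtain ⟨T, r, m, p, hT, hpε, herr, hrot, hwalk⟩ :=
      QPartition.exists_parameters (by omega : 1 ≤ ℓ) hδ' hε0 hε1
    obtain ⟨A, hA1, hA2, hA3⟩ :=
      QPartition.exists_scheme z hi hδ' (min_le_right _ _) hε0 hT hpε herr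
    refine ⟨A, ?_, ?_, fun I hI => hA3 I (hI.mono (min_le_left _ _))⟩
    · rcases Nat.lt_or_ge 1 ℓ with hℓ | hℓ
      · have hδ1 : δ ≤ 1 := by
          by_contra h
          exact hcase ⟨hℓ, not_le.1 h⟩
        have h1 := hwalk hℓ
        rw [min_eq_left hδ1] at h1
        exact le_trans (by exact_mod_cast hA1) h1
      · obtain rfl : ℓ = 1 := by omega
        rw [QPartition.walkCount_eq_zero]
        simpa using hbound
    · exact le_trans (by exact_mod_cast hA2) hrot
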